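/- **Setting.** Let $J=\begin{pmatrix}0&-\mathrm{Id}\\ \mathrm{Id}&0\end{pmatrix}$, $\sigma(\rho,\rho')=\langle\rho,J\rho'\rangle$ on $\mathbb R^{2d}\ni\rho=(x,\xi)$, $\mathbb T^{2d}=\mathbb R^{2d}/\mathbb Z^{2d}$. Let $A\in Sp(2d,\mathbb Z)$ be such that $1$ is not an eigenvalue of $A$ and $A$ has an eigenvalue of modulus larger than $1$; put $\lambda_{\max}=\max\{\log|\beta|:\beta\in\mathrm{sp}(A)\}$. Let $$A=Q\,(A_0\diamond A_1\diamond\cdots\diamond A_r)\,Q^{-1},\qquad Q\in Sp(2d,\mathbb R),\quad A_0\in Sp(2d_0,\mathbb R),\quad A_i=\mathrm{diag}(D_i,(D_i^{*})^{-1}),\ D_i\in GL(d_i,\mathbb R)\ (1\le i\le r),$$ with $d_0\ge 0$, $d_i\geq 1$ for $1\le i\le r$, $d=d_0+\dots+d_r$, where the spectrum of $A_0$ lies on the unit circle, that of $D_i$ on $\{|z|=e^{\lambda_i^+}\}$, and $0<\lambda_1^+<\dots<\lambda_r^+$. Here the $\diamond$-product of matrices $M_i=\begin{pmatrix}a_i&b_i\\c_i&e_i\end{pmatrix}$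 of size $2d_i$ is $\begin{pmatrix}\mathrm{diag}(a_i)&\mathrm{diag}(b_i)\\ \mathrm{diag}(c_i)&\mathrm{diag}(e_i)\end{pmatrix}$ (block diagonal blocks). Let $N\ge1$ be an integer and $2\pi\hbar N=1$. Let $U_\hbar(x,\xi)=e^{\frac i\hbar\sigma((x,\xi),(Q,P))}$ on $\mathcal S'(\mathbb R^d)$, i.e. $(U_\hbar(x,\xi)u)(y)=e^{\frac i\hbar(\langle\xi,y\rangle-\langle\xi,x\rangle/2)}u(y-x)$. For $\kappa=(\kappa_1,\kappa_2)\in[0,2\pi)^{2d}$ let $\mathcal H_N(\kappa)$ be the space of $\psi\in\mathcal S'(\mathbb R^d)$ with $U_\hbar(q,p)\psi=e^{\frac{i}{2\hbar}\langle q,p\rangle}e^{-i\langle\kappa_1,q\rangle+i\langle\kappa_2,p\rangle}\psi$ for all $(q,p)\in\mathbb Z^{2d}$, with the Hilbert structure (unique up to a positive factor) for which all $U_\hbar(r/N)$, $r\in\mathbb Z^{2d}$, are unitary. Let $M(A)$ be the quantum propagator: the operator, unitary on $L^2(\mathbb R^d)$ and unique up to a phase, with $M(A)U_\hbar(\rho)M(A)^{-1}=U_\hbar(A\rho)$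 for all $\rho\in\mathbb R^{2d}$ (it preserves $\mathcal S(\mathbb R^d)$ and acts on $\mathcal S'(\mathbb R^d)$). Let $\kappa$ be such that $M(A)\mathcal H_N(\kappa)=\mathcal H_N(\kappa)$, and let $M_\kappa(A)$ be the restriction of $M(A)$ to $\mathcal H_N(\kappa)$. For $a\in C^\infty(\mathbb T^{2d})$ let $\mathrm{Op}^w_\kappa(a)$ be the restriction to $\mathcal H_N(\kappa)$ of the Weyl quantization $\mathrm{Op}_\hbar^w(a)$. Fix $\epsilon_0>0$. Let $D_1(\hbar)=\mathrm{diag}\big(\hbar^{-\epsilon_0/(2\lambda_{\max})}\mathrm{Id}_{d_0},\hbar^{-\lambda_1^+/(2\lambda_{\max})}\mathrm{Id}_{d_1},\dots,\hbar^{-\lambda_r^+/(2\lambda_{\max})}\mathrm{Id}_{d_r}\big)$, $B(\hbar)=Q\,\mathrm{diag}(D_1(\hbar),D_1(\hbar))\,Q^{-1}$, $$G_\hbar(\rho)=2^{d/2}|\det B(\hbar)|^{1/2}e^{-\pi\|B(\hbar)\rho\|^2},\qquad G_\hbar^{\rho_0}(\rho)=G_\hbar(\rho-\rho_0),$$ $$T_\rho(F)(\rho')=\sum_{r\in\mathbb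 Z^{2d}}F\Big(\rho'+r-\frac{J\rho}{2N}\Big)e^{2i\pi\langle r+\rho',\rho\rangle},\qquad \mathrm{Op}^+_\kappa(a)=\mathrm{Op}^w_\kappa\big(a\star(G_\hbar\sharp G_\hbar)\big),$$ where $\star$ is convolution on $\mathbb R^{2d}$ and $(F_1\sharp F_2)(\rho)=(\pi\hbar)^{-2d}\iint_{\mathbb R^{4d}} e^{-\frac{2i}{\hbar}\sigma(w_1,w_2)}F_1(\rho+w_1)F_2(\rho+w_2)\,dw_1dw_2$ is the Moyal product. Let $\psi_N\in\mathcal H_N(\kappa)$ be a unit eigenvector of $M_\kappa(A)$ and $\mu^N(a)=\langle\psi_N,\mathrm{Op}_\kappa^+(a)\psi_N\rangle$. Let $\mathcal P=(P_i)_{i=1}^K$ be functions in $C^\infty(\mathbb T^{2d},[0,1])$ with $\sum_iP_i^2=1$. For $\alpha=(\alpha_{-m},\dots,\alpha_{m-1})\in\{1,\dots,K\}^{2m}$ put $\mathbf P_\alpha=\prod_{j=-m}^{m-1}P_{\alpha_j}\circ A^j$, and let $$h_{2m}(\psi_N,\mathcal P)=-\sum_{|\alpha|=2m}\mu^N(\mathbf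 P_\alpha^2)\log\mu^N(\mathbf P_\alpha^2)\qquad(0\log 0=0).$$ **Corollary.** For all integers $n\ge 0$ and $m\ge 0$, the quantity $$c(A,n):=\sup_{\rho,\rho',\rho_0,\rho_0'\in\mathbb T^{2d}}\left\|\mathrm{Op}^w_\kappa(T_\rho(G_\hbar^{\rho_0}))\,M_\kappa(A)^n\,\mathrm{Op}^w_\kappa(T_{\rho'}(G_\hbar^{\rho_0'}))^*\right\|_{\mathcal L(\mathcal H_N(\kappa))}$$ is finite and positive, and $$h_{2m}(\psi_N,\mathcal P)\ \ge\ -\log\sup_{|\alpha|=2m}\mathrm{Leb}(\mathbf P_\alpha^2)\;-\;\log c(A,n),\qquad \mathrm{Leb}(\mathbf P_\alpha^2):=\int_{\mathbb T^{2d}}\mathbf P_\alpha^2 .$$ -/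

import Mathlib

open scoped SchwartzMap Matrix
open MeasureTheory

noncomputable section

namespace CatMap

/-! ### Phase space -/

/-- Points `ρ = (x, ξ)` of the phase space `ℝ^{2d}`; `x` is indexed by `Sum.inl`, `ξ` by `Sum.inr`.
Functions on the torus `𝕋^{2d} = ℝ^{2d}/ℤ^{2d}` are the `ℤ^{2d}`-periodic functions on this space. -/
abbrev Phase (d : ℕ) := Fin d ⊕ Fin d → ℝ

/-- The configuration space `ℝ^d` with its Euclidean structure. -/
abbrev Conf (d : ℕ) := EuclideanSpace ℝ (Fin d)

variable {d : ℕ}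

/-- The position component `x` of `(x, ξ)`. -/
def pos (ρ : Phase d) : Conf d := WithLp.toLp 2 fun j => ρ (Sum.inl j)

/-- The momentum component `ξ` of `(x, ξ)`. -/
def mom (ρ : Phase d) : Conf d := WithLp.toLp 2 fun j => ρ (Sum.inr j)

/-- The point `(x, ξ)` of phase space. -/
def mkPhase (x ξ : Conf d) : Phase d := Sum.elim (fun j => x j) (fun j => ξ j)

/-- The symplectic form `σ(ρ, ρ') = ⟨ρ, J ρ'⟩`, `J = (0, -Id; Id, 0)`. -/
def sigma (ρ ρ' : Phase d) : ℝ := ρ ⬝ᵥ (Matrix.J (Fin d) ℝ *ᵥ ρ')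

/-- An integer vector as a point of phase space. -/
def ofInt (r : Fin d ⊕ Fin d → ℤ) : Phase d := fun j => (r j : ℝ)

/-- The semiclassical parameter, `2πħN = 1`. -/
def hbar (N : ℕ) : ℝ := 1 / (2 * Real.pi * N)

/-- The half-open unit cube, a fundamental domain of `𝕋^{2d}`. -/
def cube (d : ℕ) : Set (Phase d) := {ρ | ∀ j, ρ j ∈ Set.Ico (0 : ℝ) 1}

/-- `a ∈ C^∞(𝕋^{2d})`: smooth and `ℤ^{2d}`-periodic. -/
structure IsSmoothTorusFun (a : Phase d → ℝ) : Prop where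
  smooth : ContDiff ℝ ((⊤ : ℕ∞) : WithTop ℕ∞) a
  periodic : ∀ (r : Fin d ⊕ Fin d → ℤ) (ρ : Phase d), a (ρ + ofInt r) = a ρ

/-! ### Translation operators and the spaces `H_N(κ)` -/

/-- The translation operator `U_ħ(x, ξ) = exp((i/ħ) σ((x, ξ), (Q, P)))` on Schwartz functions, where
`Q_j u(y) = y_j u(y)`, `P_j = (ħ/i) ∂_j`. Explicitly
`(U_ħ(x, ξ) u)(y) = exp((i/ħ)(⟨ξ, y⟩ - ⟨ξ, x⟩/2)) u(y - x)`. -/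
def transS (ħ : ℝ) (ρ : Phase d) : 𝓢(Conf d, ℂ) →L[ℂ] 𝓢(Conf d, ℂ) :=
  (SchwartzMap.smulLeftCLM ℂ fun y : Conf d =>
      Complex.exp (Complex.I *
        (((inner ℝ (mom ρ) y - inner ℝ (mom ρ) (pos ρ) / 2) / ħ : ℝ) : ℂ))) ∘L
    SchwartzMap.compSubConstCLM ℂ (pos ρ)

/-- The operator on tempered distributions dual to an operator on Schwartz functions,
`(T' ψ)(φ) = ψ(T φ)`. -/
def dual (T : 𝓢(Conf d, ℂ) →L[ℂ] 𝓢(Conf d, ℂ)) : 𝓢'(Conf d, ℂ) →ₗ[ℂ] 𝓢'(Conf d, ℂ) :=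
  (PointwiseConvergenceCLM.precomp ℂ T).toLinearMap

/-- `U_ħ(x, ξ)` on tempered distributions: for functions `u, φ` one has
`∫ (U_ħ(x, ξ) u) φ = ∫ u (U_ħ(-x, ξ) φ)`. -/
def trans (ħ : ℝ) (ρ : Phase d) : 𝓢'(Conf d, ℂ) →ₗ[ℂ] 𝓢'(Conf d, ℂ) :=
  dual (transS ħ (mkPhase (-pos ρ) (mom ρ)))

/-- The scalar `e^{(i/2ħ)⟨q, p⟩} e^{-i⟨κ₁, q⟩ + i⟨κ₂, p⟩}` for `r = (q, p)`. -/
def quasiPhase (ħ : ℝ) (κ : Phase d) (r : Fin d ⊕ Fin d → ℤ) : ℂ :=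
  Complex.exp (Complex.I * (((∑ j, (r (Sum.inl j) : ℝ) * r (Sum.inr j)) / (2 * ħ) : ℝ) : ℂ)) *
    Complex.exp (Complex.I * ((-(∑ j, κ (Sum.inl j) * r (Sum.inl j))
      + ∑ j, κ (Sum.inr j) * r (Sum.inr j) : ℝ) : ℂ))

/-- The space `H_N(κ)` of quantum states on the torus, `ħ = 1/(2πN)`: the tempered distributions
with `U_ħ(q, p) ψ = e^{(i/2ħ)⟨q, p⟩} e^{-i⟨κ₁, q⟩ + i⟨κ₂, p⟩} ψ` for all `(q, p) ∈ ℤ^{2d}`. -/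
def torusSpace (N : ℕ) (κ : Phase d) : Submodule ℂ 𝓢'(Conf d, ℂ) where
  carrier := {ψ | ∀ r : Fin d ⊕ Fin d → ℤ,
    trans (hbar N) (ofInt r) ψ = quasiPhase (hbar N) κ r • ψ}
  add_mem' := by
    intro a b ha hb r
    rw [map_add, ha r, hb r, smul_add]
  zero_mem' := by
    intro r
    rw [map_zero, smul_zero]
  smul_mem' := by
    intro c a ha r
    rw [map_smul, ha r, smul_comm]

open Classical in
/-- The restriction to `H_N(κ)` of an operator on tempered distributions that preserves `H_N(κ)`
(the value `0` otherwise is never used: every operator restricted below preserves `H_N(κ)`). -/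
def restrictH (N : ℕ) (κ : Phase d) (T : 𝓢'(Conf d, ℂ) →ₗ[ℂ] 𝓢'(Conf d, ℂ)) :
    torusSpace N κ →ₗ[ℂ] torusSpace N κ :=
  if h : ∀ ψ ∈ torusSpace N κ, T ψ ∈ torusSpace N κ then T.restrict h else 0

/-- A Hilbert structure on `H_N(κ)` for which every `U_ħ(r/N)`, `r ∈ ℤ^{2d}`, is unitary. It is
unique up to a positive factor, on which no quantity below depends. -/
structure TorusHilbert (N : ℕ) (κ : Phase d) where
  /-- the inner product, conjugate linear in its first argument -/
  core : InnerProductSpace.Core ℂ (torusSpace N κ)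
  unitary : ∀ (r : Fin d ⊕ Fin d → ℤ) (v w : torusSpace N κ),
    core.inner (restrictH N κ (trans (hbar N) ((N : ℝ)⁻¹ • ofInt r)) v)
      (restrictH N κ (trans (hbar N) ((N : ℝ)⁻¹ • ofInt r)) w) = core.inner v w

namespace TorusHilbert

variable {N : ℕ} {κ : Phase d} (H : TorusHilbert N κ)

/-- The norm of `H_N(κ)`. -/
def norm (v : torusSpace N κ) : ℝ := Real.sqrt (H.core.inner v v).re

/-- The operator norm on `L(H_N(κ))`. -/
def opNorm (T : torusSpace N κ →ₗ[ℂ] torusSpace N κ) : ℝ :=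
  sInf {C : ℝ | 0 ≤ C ∧ ∀ v, H.norm (T v) ≤ C * H.norm v}

open Classical in
/-- The Hilbert space adjoint `T*` (it exists and is unique, `H_N(κ)` being of finite dimension). -/
def adj (T : torusSpace N κ →ₗ[ℂ] torusSpace N κ) : torusSpace N κ →ₗ[ℂ] torusSpace N κ :=
  if h : ∃ S : torusSpace N κ →ₗ[ℂ] torusSpace N κ, ∀ v w, H.core.inner (S v) w = H.core.inner v (T w)
  then h.choose else 0

end TorusHilbert

/-! ### Weyl quantization -/

/-- `(2πħ)^{-d} ∫∫ e^{(i/ħ)⟨x - y, ξ⟩} a((x + y)/2, ξ) u(y) dy dξ`, as an iterated integral. -/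
def weylIntegral (ħ : ℝ) (a : Phase d → ℂ) (u : 𝓢(Conf d, ℂ)) (x : Conf d) : ℂ :=
  (((2 * Real.pi * ħ) ^ d)⁻¹ : ℝ) *
    ∫ ξ : Conf d, ∫ y : Conf d, Complex.exp (Complex.I * ((inner ℝ (x - y) ξ / ħ : ℝ) : ℂ)) *
      a (mkPhase ((1 / 2 : ℝ) • (x + y)) ξ) * u y

open Classical in
/-- `Op_ħ^w(a)` as a continuous operator on Schwartz functions. (It exists when `a` is smooth with
all derivatives bounded, in particular for every symbol in `C^∞(𝕋^{2d})`.) -/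
def weylS (ħ : ℝ) (a : Phase d → ℂ) : 𝓢(Conf d, ℂ) →L[ℂ] 𝓢(Conf d, ℂ) :=
  if h : ∃ T : 𝓢(Conf d, ℂ) →L[ℂ] 𝓢(Conf d, ℂ), ∀ u x, T u x = weylIntegral ħ a u x
  then h.choose else 0

/-- `Op_ħ^w(a)` on tempered distributions: the transpose of `Op_ħ^w(a)` for the bilinear pairing
`∫ u φ` is the Weyl quantization of `(x, ξ) ↦ a(x, -ξ)`. -/
def weyl (ħ : ℝ) (a : Phase d → ℂ) : 𝓢'(Conf d, ℂ) →ₗ[ℂ] 𝓢'(Conf d, ℂ) :=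
  dual (weylS ħ fun ρ => a (mkPhase (pos ρ) (-mom ρ)))

/-- `Op_κ^w(a)`, the restriction of `Op_ħ^w(a)` to `H_N(κ)`. -/
def opW (N : ℕ) (κ : Phase d) (a : Phase d → ℂ) : torusSpace N κ →ₗ[ℂ] torusSpace N κ :=
  restrictH N κ (weyl (hbar N) a)

/-! ### Quantum propagator -/

/-- The real matrix underlying an integral symplectic matrix. -/
def toReal (A : Matrix.symplecticGroup (Fin d) ℤ) : Matrix (Fin d ⊕ Fin d) (Fin d ⊕ Fin d) ℝ :=
  (A : Matrix (Fin d ⊕ Fin d) (Fin d ⊕ Fin d) ℤ).map (fun k => (k : ℝ))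

/-- The complex spectrum of `A`. -/
def spec (A : Matrix.symplecticGroup (Fin d) ℤ) : Set ℂ :=
  spectrum ℂ ((A : Matrix (Fin d ⊕ Fin d) (Fin d ⊕ Fin d) ℤ).map (fun k => (k : ℂ)))

/-- `M` is the quantum propagator `M(A)` (which is unique up to a phase): it is unitary for the
`L²(ℝ^d)` norm and `M U_ħ(ρ) M⁻¹ = U_ħ(A ρ)` for every `ρ ∈ ℝ^{2d}`. It is given by its action on
Schwartz functions, which extends by density to `L²(ℝ^d)` and by duality to tempered
distributions. -/
structure IsQuantumPropagator (ħ : ℝ) (A : Matrix.symplecticGroup (Fin d) ℤ)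
    (M : 𝓢(Conf d, ℂ) ≃L[ℂ] 𝓢(Conf d, ℂ)) : Prop where
  isometry : ∀ u : 𝓢(Conf d, ℂ), ∫ x, ‖M u x‖ ^ 2 = ∫ x, ‖u x‖ ^ 2
  intertwine : ∀ (ρ : Phase d) (u : 𝓢(Conf d, ℂ)),
    M (transS ħ ρ u) = transS ħ (toReal A *ᵥ ρ) (M u)

/-- Pointwise complex conjugation of Schwartz functions. -/
def conjS : 𝓢(Conf d, ℂ) →L[ℝ] 𝓢(Conf d, ℂ) :=
  SchwartzMap.postcompCLM (𝕜 := ℝ) (Complex.conjCLE : ℂ →L[ℝ] ℂ)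

/-- The transpose `φ ↦ conj (M⁻¹ (conj φ))` of an `L²`-unitary operator `M`. -/
def transposeS (M : 𝓢(Conf d, ℂ) ≃L[ℂ] 𝓢(Conf d, ℂ)) : 𝓢(Conf d, ℂ) →L[ℂ] 𝓢(Conf d, ℂ) where
  toFun φ := conjS (M.symm (conjS φ))
  map_add' := by
    intro φ φ'
    rw [map_add, map_add, map_add]
  map_smul' := by
    intro c φ
    have h1 : conjS (c • φ) = (starRingEnd ℂ c) • conjS φ := by
      ext x; simp [conjS]
    have h2 : ∀ χ : 𝓢(Conf d, ℂ), conjS ((starRingEnd ℂ c) • χ) = c • conjS χ := by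
      intro χ; ext x; simp [conjS]
    rw [h1, map_smul, h2, RingHom.id_apply]
  cont := conjS.continuous.comp (M.symm.continuous.comp conjS.continuous)

/-- `M(A)` on tempered distributions. -/
def propagator (M : 𝓢(Conf d, ℂ) ≃L[ℂ] 𝓢(Conf d, ℂ)) :
    𝓢'(Conf d, ℂ) →ₗ[ℂ] 𝓢'(Conf d, ℂ) :=
  dual (transposeS M)

/-- `M_κ(A)`, the restriction of `M(A)` to `H_N(κ)`. -/
def opM (N : ℕ) (κ : Phase d) (M : 𝓢(Conf d, ℂ) ≃L[ℂ] 𝓢(Conf d, ℂ)) :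
    torusSpace N κ →ₗ[ℂ] torusSpace N κ :=
  restrictH N κ (propagator M)

/-! ### Symplectic reduction adapted to the Lyapunov exponents -/

/-- `λ_max = sup {log |β| : β ∈ sp(A)}`. -/
def lambdaMax (A : Matrix.symplecticGroup (Fin d) ℤ) : ℝ :=
  sSup ((fun β : ℂ => Real.log ‖β‖) '' spec A)

/-- The iterated `⋄`-product of the `2dᵢ × 2dᵢ` matrices `Mᵢ = (Aᵢ, Bᵢ; Cᵢ, Dᵢ)`: the matrix whose
four blocks are the block diagonal matrices `diag(Aᵢ)`, `diag(Bᵢ)`, `diag(Cᵢ)`, `diag(Dᵢ)`. -/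
def diamond {s : ℕ} {k : Fin s → ℕ}
    (M : ∀ i, Matrix (Fin (k i) ⊕ Fin (k i)) (Fin (k i) ⊕ Fin (k i)) ℝ) :
    Matrix ((Σ i, Fin (k i)) ⊕ (Σ i, Fin (k i))) ((Σ i, Fin (k i)) ⊕ (Σ i, Fin (k i))) ℝ :=
  Matrix.fromBlocks
    (Matrix.blockDiagonal' fun i => (M i).toBlocks₁₁)
    (Matrix.blockDiagonal' fun i => (M i).toBlocks₁₂)
    (Matrix.blockDiagonal' fun i => (M i).toBlocks₂₁)
    (Matrix.blockDiagonal' fun i => (M i).toBlocks₂₂)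

/-- The diagonal blocks of the reduction: `A₀` and, for `i ≥ 1`, `Aᵢ = diag(Dᵢ, Dᵢ*⁻¹)`. -/
def reducedBlocks {r : ℕ} {k : Fin (r + 1) → ℕ}
    (A₀ : Matrix (Fin (k 0) ⊕ Fin (k 0)) (Fin (k 0) ⊕ Fin (k 0)) ℝ)
    (D : ∀ i : Fin r, Matrix (Fin (k i.succ)) (Fin (k i.succ)) ℝ) :
    ∀ i : Fin (r + 1), Matrix (Fin (k i) ⊕ Fin (k i)) (Fin (k i) ⊕ Fin (k i)) ℝ :=
  Fin.cases A₀ fun i => Matrix.fromBlocks (D i) 0 0 ((D i)ᵀ)⁻¹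

/-- A symplectic reduction `A = Q (A₀ ⋄ A₁ ⋄ ⋯ ⋄ A_r) Q⁻¹` adapted to the Lyapunov exponents
`0 < λ₁⁺ < ⋯ < λ_r⁺` of `A`. -/
structure Reduction (A : Matrix.symplecticGroup (Fin d) ℤ) where
  /-- the number of positive exponents -/
  r : ℕ
  /-- the dimensions `d₀, d₁, …, d_r` -/
  k : Fin (r + 1) → ℕ
  k_pos : ∀ i : Fin r, 0 < k i.succ
  /-- the identification of the `d = d₀ + ⋯ + d_r` coordinates with the coordinates of the blocks -/
  e : (Σ i, Fin (k i)) ≃ Fin d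
  /-- the positive Lyapunov exponents -/
  lam : Fin r → ℝ
  lam_pos : ∀ i, 0 < lam i
  lam_strictMono : StrictMono lam
  /-- the neutral block -/
  A₀ : Matrix.symplecticGroup (Fin (k 0)) ℝ
  spec_A₀ : ∀ β ∈ spectrum ℂ ((A₀ : Matrix (Fin (k 0) ⊕ Fin (k 0)) (Fin (k 0) ⊕ Fin (k 0)) ℝ).map
    Complex.ofReal), ‖β‖ = 1
  /-- the expanding blocks -/
  D : ∀ i : Fin r, Matrix (Fin (k i.succ)) (Fin (k i.succ)) ℝ
  spec_D : ∀ i, ∀ β ∈ spectrum ℂ ((D i).map Complex.ofReal), ‖β‖ = Real.exp (lam i)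
  /-- the symplectic change of basis -/
  Q : Matrix.symplecticGroup (Fin d) ℝ
  eq : toReal A = (Q : Matrix (Fin d ⊕ Fin d) (Fin d ⊕ Fin d) ℝ) *
    (diamond (reducedBlocks (A₀ : Matrix (Fin (k 0) ⊕ Fin (k 0)) (Fin (k 0) ⊕ Fin (k 0)) ℝ) D)).reindex
      (e.sumCongr e) (e.sumCongr e) *
    (Q : Matrix (Fin d ⊕ Fin d) (Fin d ⊕ Fin d) ℝ)⁻¹

namespace Reduction

variable {A : Matrix.symplecticGroup (Fin d) ℤ} (R : Reduction A)

/-- The diagonal entries of `D₁(ħ)`: `ħ^{-ε₀/(2λ_max)}` on the neutral block and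
`ħ^{-λᵢ⁺/(2λ_max)}` on the `i`-th block. -/
def weight (ε₀ ħ : ℝ) (j : Fin d) : ℝ :=
  ħ ^ (-((Fin.cases ε₀ R.lam (R.e.symm j).1 : ℝ) / (2 * lambdaMax A)))

/-- `B(ħ) = Q diag(D₁(ħ), D₁(ħ)) Q⁻¹`. -/
def B (ε₀ ħ : ℝ) : Matrix (Fin d ⊕ Fin d) (Fin d ⊕ Fin d) ℝ :=
  (R.Q : Matrix (Fin d ⊕ Fin d) (Fin d ⊕ Fin d) ℝ) *
    Matrix.diagonal (Sum.elim (R.weight ε₀ ħ) (R.weight ε₀ ħ)) *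
    (R.Q : Matrix (Fin d ⊕ Fin d) (Fin d ⊕ Fin d) ℝ)⁻¹

/-- The adapted Gaussian observable `G_ħ = 2^{d/2} |det B(ħ)|^{1/2} G ∘ B(ħ)`, where
`G(ρ) = exp(-π ‖ρ‖²)` with the Euclidean norm. -/
def gauss (ε₀ ħ : ℝ) (ρ : Phase d) : ℂ :=
  (((2 : ℝ) ^ ((d : ℝ) / 2) * |(R.B ε₀ ħ).det| ^ (1 / 2 : ℝ) *
    Real.exp (-Real.pi * ((R.B ε₀ ħ *ᵥ ρ) ⬝ᵥ (R.B ε₀ ħ *ᵥ ρ))) : ℝ) : ℂ)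

end Reduction

/-! ### The positive quantization adapted to the dynamics -/

/-- The Moyal product
`(F₁ ♯ F₂)(ρ) = (πħ)^{-2d} ∫∫ e^{-(2i/ħ) σ(w₁, w₂)} F₁(ρ + w₁) F₂(ρ + w₂) dw₁ dw₂`, that is the
symbol of `Op_ħ^w(F₁) ∘ Op_ħ^w(F₂)`, of two Schwartz symbols. -/
def moyal (ħ : ℝ) (F₁ F₂ : Phase d → ℂ) (ρ : Phase d) : ℂ :=
  (((Real.pi * ħ) ^ (2 * d))⁻¹ : ℝ) *
    ∫ w₁ : Phase d, ∫ w₂ : Phase d,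
      Complex.exp (-Complex.I * ((2 / ħ * sigma w₁ w₂ : ℝ) : ℂ)) * F₁ (ρ + w₁) * F₂ (ρ + w₂)

/-- The convolution `(a ⋆ F)(ρ) = ∫ a(ρ₀) F(ρ - ρ₀) dρ₀` over `ℝ^{2d}`. -/
def conv (a : Phase d → ℝ) (F : Phase d → ℂ) (ρ : Phase d) : ℂ :=
  ∫ ρ₀ : Phase d, (a ρ₀ : ℂ) * F (ρ - ρ₀)

/-- `Op_κ^+(a) = Op_κ^w(a ⋆ (G_ħ ♯ G_ħ))` for `G = G_ħ`. -/
def opPlus (N : ℕ) (κ : Phase d) (G : Phase d → ℂ) (a : Phase d → ℝ) :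
    torusSpace N κ →ₗ[ℂ] torusSpace N κ :=
  opW N κ (conv a (moyal (hbar N) G G))

/-- `T_ρ(F)(ρ') = ∑_{r ∈ ℤ^{2d}} F(ρ' + r - Jρ/(2N)) e^{2iπ⟨r + ρ', ρ⟩}`. -/
def periodize (N : ℕ) (ρ : Phase d) (F : Phase d → ℂ) (ρ' : Phase d) : ℂ :=
  ∑' r : Fin d ⊕ Fin d → ℤ,
    F (ρ' + ofInt r - (1 / (2 * N) : ℝ) • (Matrix.J (Fin d) ℝ *ᵥ ρ)) *
      Complex.exp (2 * Real.pi * Complex.I * (((ofInt r + ρ') ⬝ᵥ ρ : ℝ) : ℂ))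

/-- `Op_κ^w(T_ρ(G^{ρ₀}))`, where `G^{ρ₀}(ρ') = G(ρ' - ρ₀)`. -/
def opLoc (N : ℕ) (κ : Phase d) (G : Phase d → ℂ) (ρ ρ₀ : Phase d) :
    torusSpace N κ →ₗ[ℂ] torusSpace N κ :=
  opW N κ (periodize N ρ fun ρ' => G (ρ' - ρ₀))

/-- The set of the norms
`‖Op_κ^w(T_ρ(G^{ρ₀})) M_κ(A)^n Op_κ^w(T_{ρ'}(G^{ρ₀'}))*‖`, `ρ, ρ', ρ₀, ρ₀' ∈ 𝕋^{2d}`. -/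
def corrNorms {N : ℕ} {κ : Phase d} (H : TorusHilbert N κ) (G : Phase d → ℂ)
    (M : 𝓢(Conf d, ℂ) ≃L[ℂ] 𝓢(Conf d, ℂ)) (n : ℕ) : Set ℝ :=
  {t | ∃ ρ ∈ cube d, ∃ ρ' ∈ cube d, ∃ ρ₀ ∈ cube d, ∃ ρ₀' ∈ cube d,
    t = H.opNorm (opLoc N κ G ρ ρ₀ ∘ₗ (opM N κ M ^ n : Module.End ℂ (torusSpace N κ)) ∘ₗ
      H.adj (opLoc N κ G ρ' ρ₀'))}

/-- `c(A, n)`. -/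
def corr {N : ℕ} {κ : Phase d} (H : TorusHilbert N κ) (G : Phase d → ℂ)
    (M : 𝓢(Conf d, ℂ) ≃L[ℂ] 𝓢(Conf d, ℂ)) (n : ℕ) : ℝ :=
  sSup (corrNorms H G M n)

/-! ### Smooth partitions and quantum entropy -/

/-- A smooth partition `∑ Pᵢ² = 1` of the torus with `Pᵢ ∈ C^∞(𝕋^{2d}, [0, 1])`. -/
structure IsSmoothPartition {K : ℕ} (P : Fin K → Phase d → ℝ) : Prop where
  smooth : ∀ i, IsSmoothTorusFun (P i)
  mem_Icc : ∀ i ρ, P i ρ ∈ Set.Icc (0 : ℝ) 1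
  sum_sq : ∀ ρ, ∑ i, P i ρ ^ 2 = 1

/-- `P_α = ∏_{j=-m}^{m-1} P_{α_j} ∘ A^j` for a word `α` of length `2m`; the letter of index
`j ∈ {0, …, 2m - 1}` is `α_{j - m}`. -/
def refined (A : Matrix.symplecticGroup (Fin d) ℤ) {K : ℕ} (P : Fin K → Phase d → ℝ) {m : ℕ}
    (α : Fin (2 * m) → Fin K) (ρ : Phase d) : ℝ :=
  ∏ j : Fin (2 * m), P (α j) (toReal (A ^ ((j : ℤ) - (m : ℤ))) *ᵥ ρ)

/-- `μ^N(a) = ⟨ψ, Op_κ^+(a) ψ⟩` (a real number for real `a`, which is nonnegative for `a ≥ 0`). -/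
def quantumMeasure {N : ℕ} {κ : Phase d} (H : TorusHilbert N κ) (G : Phase d → ℂ)
    (ψ : torusSpace N κ) (a : Phase d → ℝ) : ℝ :=
  (H.core.inner ψ (opPlus N κ G a ψ)).re

/-- The quantum entropy `h_{2m}(ψ, P) = -∑_{|α| = 2m} μ^N(P_α²) log μ^N(P_α²)`, `0 log 0 = 0`. -/
def quantumEntropy {N : ℕ} {κ : Phase d} (H : TorusHilbert N κ) (G : Phase d → ℂ)
    (ψ : torusSpace N κ) (A : Matrix.symplecticGroup (Fin d) ℤ) {K : ℕ}
    (P : Fin K → Phase d → ℝ) (m : ℕ) : ℝ :=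
  ∑ α : Fin (2 * m) → Fin K,
    Real.negMulLog (quantumMeasure H G ψ fun ρ => refined A P α ρ ^ 2)

/-- `Leb(a) = ∫_{𝕋^{2d}} a`. -/
def leb (a : Phase d → ℝ) : ℝ := ∫ ρ in cube d, a ρ

end CatMap

end

set_option linter.unusedSectionVars false

noncomputable section

namespace CatMap

section

/-! ### Characters and lattice sums -/

section Lattice

variable {ι : Type*} [Fintype ι]

/-! Let `W(p)` be the localized operator `opLoc` at `p = (ρ, ρ₀)`, a point of the probability space
`𝕋^{2d} × 𝕋^{2d}`. Because the Fourier transform of the window has unit `L²` norm, `∫ W(p)* W(p) dp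
= Id`, and more generally `∫ a(ρ₀) W(p)* W(p) dp = Op⁺(a)` (`IsWindow.integral_ip_opLoc`). So `f(p)
= ‖W(p) ψ‖²` is a probability density and `μ^N(a) = ∫ a(ρ₀) f(p) dp`. Jensen's inequality for `x log
x` on each piece of the partition (`mul_log_integral_le`) bounds the entropy below by `-log sup Leb
- ∫ f log f`, and it remains to prove `∫ f log f ≤ log c(A, n)`.

This last bound is an entropic uncertainty principle for `U = M_κ(A)^n`, proved by complex
interpolation (`IsTightFamily.integral_mul_log_add_le`). With `g = log (f + ε)`, put `v(z) = ∫ e^{z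
g} W* W ψ` and `F(z) = ⟨v(z̄), U v(z)⟩`. On `Re z = 0` tightness gives `‖v(z)‖ ≤ 1`, so `|F| ≤ 1`;
on `Re z = 1/2` the correlation bound gives `|F| ≤ c (1 + ε)²`. The three lines theorem yields
`|F(t)| ≤ (c (1 + ε)²)^{2t}` for small `t > 0`. Since `ψ` is an eigenvector, `|F(t)| ≥ 1 + 2t ∫ f g
- O(t²)`; comparing first orders at `t = 0` and letting `ε → 0` gives the claim. The same inequality
shows that `c` is positive.

Two facts about the torus feed this argument. First, the propagator is unitary for every Hilbert
structure in which the `U_ħ(r/N)` are unitary (`TorusHilbert.ip_opM`). Poisson summation exchanges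
the lattices `ℤ^{2d}` and `N⁻¹ ℤ^{2d}` and gives an orthogonality relation (`comb_mul_apply`,
`apply_mul_apply_eq_sum`): the product `a(f) ψ(h)` of values of two states is a finite sum over
residues modulo `N`. It implies finite dimension, and it computes the inner product from values on
test functions by a sum whose terms the lattice automorphism only permutes.

Second, the Weyl quantization of a Fourier series is the corresponding series of the unitaries
`U_ħ(Jk/N)` (`hasSum_toS_opW`). The decomposition of `Op⁺` is then a computation with Fourier
coefficients, in which a lattice sum unfolds the integral over `ρ ∈ 𝕋^{2d}` into the twisted
convolution giving the Moyal square of the window. -/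

/-- The character `t ↦ e^{2iπt}`. -/
def ee (t : ℝ) : ℂ := Complex.exp (2 * Real.pi * Complex.I * t)

theorem ee_add (s t : ℝ) : ee (s + t) = ee s * ee t := by
  rw [ee, ee, ee, ← Complex.exp_add]; push_cast; ring_nf

@[simp] theorem ee_zero : ee 0 = 1 := by simp [ee]

@[simp] theorem norm_ee (t : ℝ) : ‖ee t‖ = 1 := by
  rw [ee, show (2 * Real.pi * Complex.I * t : ℂ) = ((2 * Real.pi * t : ℝ) : ℂ) * Complex.I by
    push_cast; ring, Complex.norm_exp_ofReal_mul_I]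

@[simp] theorem ee_intCast (n : ℤ) : ee n = 1 := by
  rw [ee, Complex.exp_eq_one_iff]; exact ⟨n, by push_cast; ring⟩

theorem ee_neg (t : ℝ) : ee (-t) = (ee t)⁻¹ := by
  rw [ee, ee, ← Complex.exp_neg]; push_cast; ring_nf

theorem conj_ee (t : ℝ) : (starRingEnd ℂ) (ee t) = ee (-t) := by
  rw [ee_neg, Complex.inv_eq_conj (norm_ee t)]

@[fun_prop] theorem continuous_ee : Continuous ee := by unfold ee; fun_prop

/-- An integer vector as a real vector. -/
def intVec (n : ι → ℤ) : ι → ℝ := fun j => (n j : ℝ)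

theorem intVec_add (m n : ι → ℤ) : intVec (m + n) = intVec m + intVec n := by
  ext j; simp [intVec]

theorem intVec_neg (n : ι → ℤ) : intVec (-n) = -intVec n := by ext j; simp [intVec]

theorem intVec_sub (m n : ι → ℤ) : intVec (m - n) = intVec m - intVec n := by
  ext j; simp [intVec]

@[simp] theorem intVec_zero : intVec (0 : ι → ℤ) = 0 := by ext j; simp [intVec]

theorem intVec_injective : Function.Injective (intVec : (ι → ℤ) → ι → ℝ) := by
  intro m n h; ext j; have := congrFun h j; simpa [intVec] using this

theorem intVec_dotProduct (m n : ι → ℤ) : intVec m ⬝ᵥ intVec n = ((m ⬝ᵥ n : ℤ) : ℝ) := by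
  simp [intVec, dotProduct]

/-- The half-open unit cube of `ℝ^ι`. -/
def unitCube (ι : Type*) : Set (ι → ℝ) := {x | ∀ j, x j ∈ Set.Ico (0 : ℝ) 1}

theorem unitCube_eq_pi : unitCube ι = Set.univ.pi fun _ => Set.Ico (0 : ℝ) 1 := by
  ext x; simp [unitCube]

theorem measurableSet_unitCube : MeasurableSet (unitCube ι) := by
  rw [unitCube_eq_pi]; exact MeasurableSet.univ_pi fun _ => measurableSet_Ico

theorem volume_unitCube : volume (unitCube ι) = 1 := by
  rw [unitCube_eq_pi, volume_pi_pi]; simp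

theorem norm_le_one_of_mem_unitCube {x : ι → ℝ} (hx : x ∈ unitCube ι) : ‖x‖ ≤ 1 := by
  rw [pi_norm_le_iff_of_nonneg zero_le_one]
  intro j
  rw [Real.norm_eq_abs, abs_of_nonneg (hx j).1]
  exact (hx j).2.le

theorem one_add_norm_add_le {E : Type*} [NormedAddCommGroup E] (x y : E) :
    1 + ‖x + y‖ ≤ (1 + ‖x‖) * (1 + ‖y‖) := by
  nlinarith [norm_add_le x y, norm_nonneg x, norm_nonneg y,
    mul_nonneg (norm_nonneg x) (norm_nonneg y)]

/-- The integral of a function over `ℝ^ι` is the sum over the lattice of the integrals over the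
translates of the unit cube. -/
theorem hasSum_integral_unitCube {E : Type*} [NormedAddCommGroup E] [NormedSpace ℝ E]
    {f : (ι → ℝ) → E} (hf : Integrable f) :
    HasSum (fun n : ι → ℤ => ∫ x in unitCube ι, f (x + intVec n)) (∫ x, f x) := by
  set S : (ι → ℤ) → Set (ι → ℝ) := fun n => (fun x => x + intVec n) '' unitCube ι with hS
  -- The translate by `n` is a fibre of the coordinatewise floor; disjointness and covering both
  -- follow from this.
  have hSe : ∀ n, S n = {x | ∀ j, ⌊x j⌋ = n j} := by
    intro n; ext x
    constructor
    · rintro ⟨y, hy, rfl⟩ j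
      have := hy j
      simp only [Pi.add_apply, intVec, Int.floor_add_intCast, Int.floor_eq_zero_iff.2 this, zero_add]
    · intro hx
      refine ⟨x - intVec n, fun j => ?_, by simp⟩
      have := (Int.floor_eq_iff.1 (hx j))
      simp only [Pi.sub_apply, intVec, Set.mem_Ico]
      constructor <;> linarith [this.1, this.2]
  have hmeas : ∀ n, MeasurableSet (S n) := fun n =>
    (measurableEmbedding_addRight (intVec n)).measurableSet_image.2 measurableSet_unitCube
  have hdisj : Pairwise (Function.onFun Disjoint S) := by
    intro m n hmn
    rw [Function.onFun, hSe, hSe, Set.disjoint_left]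
    intro x hx hx'
    exact hmn (funext fun j => (hx j).symm.trans (hx' j))
  have hU : (⋃ n, S n) = Set.univ := by
    rw [Set.eq_univ_iff_forall]
    intro x
    rw [Set.mem_iUnion]
    exact ⟨fun j => ⌊x j⌋, by rw [hSe]; intro j; rfl⟩
  have h := hasSum_integral_iUnion (μ := volume) (f := f) hmeas hdisj hf.integrableOn
  rw [hU, setIntegral_univ] at h
  convert h using 2 with n
  exact (((measurePreserving_add_right volume (intVec n)).setIntegral_image_emb
    (measurableEmbedding_addRight (intVec n)) f (unitCube ι))).symm

/-- Rapid decay at infinity. -/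
def RapidDecay {E F : Type*} [NormedAddCommGroup E] [NormedAddCommGroup F] (f : E → F) : Prop :=
  ∀ M : ℕ, ∃ C : ℝ, ∀ x, (1 + ‖x‖) ^ M * ‖f x‖ ≤ C

/-- Comparison with `‖n‖⁻ᵖ`, summable on a lattice once `p` exceeds the rank. The comparison fails
only at `n = 0`, where the majorant is the junk value `0⁻¹ = 0`. -/
theorem summable_inv_one_add_norm_intVec_pow :
    Summable fun n : ι → ℤ => ((1 + ‖intVec n‖) ^ (Fintype.card ι + 1))⁻¹ := by
  classical
  set b := Pi.basisFun ℝ ι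
  set L := Submodule.span ℤ (Set.range b)
  have hmem : ∀ n : ι → ℤ, intVec n ∈ L := fun n =>
    (b.mem_span_iff_repr_mem ℤ _).2 fun j => ⟨n j, by simp [b, intVec]⟩
  have hfr : Module.finrank ℤ L = Fintype.card ι := by
    rw [ZLattice.rank ℝ L, Module.finrank_fintype_fun_eq_card]
  have h := ZLattice.summable_norm_pow_inv L (Fintype.card ι + 1) (by omega)
  have h2 := h.comp_injective (i := fun n : ι → ℤ => (⟨intVec n, hmem n⟩ : L))
    (fun m n hmn => intVec_injective (congrArg Subtype.val hmn))
  refine Summable.of_norm_bounded_eventually (g := _) h2 ?_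
  have : ∀ n : ι → ℤ, n ≠ 0 → ‖((1 + ‖intVec n‖) ^ (Fintype.card ι + 1))⁻¹‖ ≤
      (‖intVec n‖ ^ (Fintype.card ι + 1))⁻¹ := by
    intro n hn
    have hpos : 0 < ‖intVec n‖ := by
      rw [norm_pos_iff]; intro h0; exact hn (intVec_injective (h0.trans intVec_zero.symm))
    rw [Real.norm_of_nonneg (by positivity)]
    gcongr
    linarith
  rw [Filter.eventually_cofinite]
  refine (Set.finite_singleton (0 : ι → ℤ)).subset fun n hn => ?_
  by_contra h0
  exact hn (by simpa [inv_pow] using this n h0)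

theorem integrable_inv_one_add_norm_pow {E : Type*} [NormedAddCommGroup E] [NormedSpace ℝ E]
    [FiniteDimensional ℝ E] [MeasurableSpace E] [BorelSpace E] (μ : Measure E)
    [μ.IsAddHaarMeasure] :
    Integrable (fun x : E => ((1 + ‖x‖) ^ (Module.finrank ℝ E + 1))⁻¹) μ := by
  have h := integrable_one_add_norm (E := E) (μ := μ) (r := (Module.finrank ℝ E + 1 : ℕ))
    (by push_cast; linarith)
  refine h.congr (Filter.Eventually.of_forall fun x => ?_)
  simp only
  rw [Real.rpow_neg (by positivity), Real.rpow_natCast]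

namespace RapidDecay

variable {E F : Type*} [NormedAddCommGroup E] [NormedAddCommGroup F] {f : E → F}

theorem exists_le (hf : RapidDecay f) (M : ℕ) :
    ∃ C, 0 ≤ C ∧ ∀ x, ‖f x‖ ≤ C * ((1 + ‖x‖) ^ M)⁻¹ := by
  obtain ⟨C, hC⟩ := hf M
  refine ⟨C, le_trans (by positivity) (hC 0), fun x => ?_⟩
  rw [← div_eq_mul_inv, le_div_iff₀ (by positivity), mul_comm]
  exact hC x

theorem of_norm_le {G : Type*} [NormedAddCommGroup G] {g : E → G} (hf : RapidDecay f) (C : ℝ)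
    (h : ∀ x, ‖g x‖ ≤ C * ‖f x‖) : RapidDecay g := by
  intro M
  obtain ⟨D, hD⟩ := hf M
  refine ⟨|C| * D, fun x => ?_⟩
  calc (1 + ‖x‖) ^ M * ‖g x‖ ≤ (1 + ‖x‖) ^ M * (|C| * ‖f x‖) := by
        gcongr
        exact (h x).trans (mul_le_mul_of_nonneg_right (le_abs_self C) (norm_nonneg _))
    _ = |C| * ((1 + ‖x‖) ^ M * ‖f x‖) := by ring
    _ ≤ |C| * D := by gcongr; exact hD x

/-- Translates of a rapidly decaying function, uniformly for bounded translations. -/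
theorem exists_translate_le (hf : RapidDecay f) (M : ℕ) (R : ℝ) :
    ∃ C, 0 ≤ C ∧ ∀ x y, ‖y‖ ≤ R → ‖f (x + y)‖ ≤ C * ((1 + ‖x‖) ^ M)⁻¹ := by
  obtain ⟨C, hC0, hC⟩ := hf.exists_le M
  refine ⟨C * (1 + |R|) ^ M, by positivity, fun x y hy => (hC _).trans ?_⟩
  rw [mul_assoc, ← div_eq_mul_inv ((1 + |R|) ^ M)]
  gcongr
  rw [inv_eq_one_div, div_le_div_iff₀ (by positivity) (by positivity), one_mul, ← mul_pow]
  gcongr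
  have h1 : 1 + ‖x‖ ≤ (1 + ‖x + y‖) * (1 + ‖y‖) := by
    have := one_add_norm_add_le (x + y) (-y)
    simpa using this
  have h2 : ‖y‖ ≤ |R| := hy.trans (le_abs_self R)
  calc 1 + ‖x‖ ≤ (1 + ‖x + y‖) * (1 + ‖y‖) := h1
    _ ≤ (1 + ‖x + y‖) * (1 + |R|) := by gcongr
    _ = _ := by ring

theorem comp_add (hf : RapidDecay f) (y : E) : RapidDecay fun x => f (x + y) := by
  intro M
  obtain ⟨C, hC0, hC⟩ := hf.exists_translate_le M ‖y‖
  refine ⟨C, fun x => ?_⟩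
  have := hC x y le_rfl
  rwa [← div_eq_mul_inv, le_div_iff₀ (by positivity), mul_comm] at this

theorem summable_intVec {f : (ι → ℝ) → F} (hf : RapidDecay f) :
    Summable fun n : ι → ℤ => ‖f (intVec n)‖ := by
  obtain ⟨C, _, hC⟩ := hf.exists_le (Fintype.card ι + 1)
  exact Summable.of_nonneg_of_le (fun _ => norm_nonneg _) (fun n => hC _)
    (summable_inv_one_add_norm_intVec_pow.mul_left C)

theorem integrable [NormedSpace ℝ E] [FiniteDimensional ℝ E] [MeasurableSpace E] [BorelSpace E]
    {μ : Measure E} [μ.IsAddHaarMeasure] (hf : RapidDecay f) (hm : AEStronglyMeasurable f μ) :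
    Integrable f μ := by
  obtain ⟨C, _, hC⟩ := hf.exists_le (Module.finrank ℝ E + 1)
  exact ((integrable_inv_one_add_norm_pow μ).const_mul C).mono' hm (Filter.Eventually.of_forall hC)

end RapidDecay

/-- The periodization of a continuous rapidly decaying function is continuous. -/
theorem continuous_tsum_add_intVec {f : (ι → ℝ) → ℂ} (hc : Continuous f) (hf : RapidDecay f) :
    Continuous fun x => ∑' n : ι → ℤ, f (x + intVec n) := by
  rw [continuous_iff_continuousAt]
  intro x₀
  obtain ⟨C, _, hC⟩ := hf.exists_translate_le (Fintype.card ι + 1) (‖x₀‖ + 1)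
  have : ContinuousOn (fun x => ∑' n : ι → ℤ, f (x + intVec n)) (Metric.ball x₀ 1) := by
    refine continuousOn_tsum (fun n => (by fun_prop : Continuous _).continuousOn)
      (summable_inv_one_add_norm_intVec_pow.mul_left C) fun n x hx => ?_
    rw [add_comm]
    refine hC _ _ ?_
    have h1 : ‖x - x₀‖ < 1 := by simpa [dist_eq_norm] using hx
    have h2 := norm_add_le x₀ (x - x₀)
    rw [add_sub_cancel] at h2
    linarith
  exact this.continuousAt (Metric.ball_mem_nhds _ one_pos)

theorem unitCube_ae_eq :
    (unitCube ι : Set (ι → ℝ)) =ᵐ[volume] {x : ι → ℝ | ∀ i, x i ∈ Set.Ioc (0 : ℝ) (0 + 1)} := by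
  have h1 : (unitCube ι : Set (ι → ℝ)) =ᵐ[volume] Set.Icc (0 : ι → ℝ) 1 := by
    rw [unitCube_eq_pi]; exact Measure.univ_pi_Ico_ae_eq_Icc (f := 0) (g := 1)
  have h2 : {x : ι → ℝ | ∀ i, x i ∈ Set.Ioc (0 : ℝ) (0 + 1)} =ᵐ[volume] Set.Icc (0 : ι → ℝ) 1 := by
    have := Measure.univ_pi_Ioc_ae_eq_Icc (μ := fun _ : ι => (volume : Measure ℝ)) (f := 0) (g := 1)
    rwa [show {x : ι → ℝ | ∀ i, x i ∈ Set.Ioc (0 : ℝ) (0 + 1)} =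
      Set.univ.pi fun i => Set.Ioc ((0 : ι → ℝ) i) ((1 : ι → ℝ) i) by ext x; simp]
  exact h1.trans h2.symm

/-- The Poisson summation formula on `ℝ^ι`. -/
theorem hasSum_poisson {f : (ι → ℝ) → ℂ} (hc : Continuous f) (hf : RapidDecay f)
    (hs : Summable fun k : ι → ℤ => ‖∫ t, ee (-(intVec k ⬝ᵥ t)) * f t‖) (x : ι → ℝ) :
    HasSum (fun k : ι → ℤ => (∫ t, ee (-(intVec k ⬝ᵥ t)) * f t) * ee (intVec k ⬝ᵥ x))
      (∑' n : ι → ℤ, f (x + intVec n)) := by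
  set g : (ι → ℝ) → ℂ := fun x => ∑' n : ι → ℤ, f (x + intVec n) with hg
  have hgc : Continuous g := continuous_tsum_add_intVec hc hf
  have hgp : ∀ x (m : ι → ℤ), g (x + intVec m) = g x := by
    intro x m
    simp only [hg]
    rw [← (Equiv.addRight m).tsum_eq (fun n : ι → ℤ => f (x + intVec n))]
    refine tsum_congr fun n => ?_
    rw [Equiv.coe_addRight, intVec_add, add_assoc, add_comm (intVec m)]
  -- The periodization descends to a continuous function on the torus because `mk` is a quotient
  -- map; the discontinuous section `sec` only serves to write that function down.
  set mk : (ι → ℝ) → UnitAddTorus ι := fun x i => (x i : UnitAddCircle) with hmk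
  have hq : IsOpenQuotientMap mk :=
    IsOpenQuotientMap.piMap (fun _ : ι => QuotientAddGroup.isOpenQuotientMap_mk)
  set sec : UnitAddTorus ι → ι → ℝ := fun y i => (AddCircle.equivIco 1 0 (y i) : ℝ)
  have hsec : ∀ x, ∃ m : ι → ℤ, sec (mk x) = x + intVec m := by
    intro x
    refine ⟨fun i => -⌊x i⌋, ?_⟩
    ext i
    simp only [sec, mk, intVec, Pi.add_apply]
    rw [AddCircle.coe_equivIco_mk_apply]
    rw [div_one, mul_one, ← Int.self_sub_floor]
    push_cast
    ring
  set G0 : UnitAddTorus ι → ℂ := fun y => g (sec y)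
  have hG0 : ∀ x, G0 (mk x) = g x := by
    intro x
    obtain ⟨m, hm⟩ := hsec x
    simp only [G0, hm, hgp]
  have hG0c : Continuous G0 := by
    rw [hq.isQuotientMap.continuous_iff]
    exact hgc.congr fun x => (hG0 x).symm
  set G : C(UnitAddTorus ι, ℂ) := ⟨G0, hG0c⟩
  have hF : ∀ (k : ι → ℤ) (x : ι → ℝ), UnitAddTorus.mFourier k (mk x) = ee (intVec k ⬝ᵥ x) := by
    intro k x
    simp only [UnitAddTorus.mFourier, ContinuousMap.coe_mk, mk, fourier_coe_apply, dotProduct,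
      intVec, ee]
    rw [← Complex.exp_sum]
    congr 1
    push_cast
    rw [Finset.mul_sum]
    refine Finset.sum_congr rfl fun i _ => ?_
    ring
  -- Unfolding: the character is `ℤ^ι`-periodic, so it enters the lattice sum, and the cube
  -- translates reassemble into `ℝ^ι`.
  have hcoef : ∀ k : ι → ℤ, UnitAddTorus.mFourierCoeff G k = ∫ t, ee (-(intVec k ⬝ᵥ t)) * f t := by
    intro k
    rw [UnitAddTorus.mFourierCoeff_eq_integral _ _ 0]
    have h1 : ∫ x in {x : ι → ℝ | ∀ i, x i ∈ Set.Ioc ((0 : ι → ℝ) i) ((0 : ι → ℝ) i + 1)},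
        UnitAddTorus.mFourier (-k) (fun i => (x i : UnitAddCircle)) • G (fun i => x i) =
        ∫ x in unitCube ι, ∑' n : ι → ℤ,
          (fun t => ee (-(intVec k ⬝ᵥ t)) * f t) (x + intVec n) := by
      rw [show {x : ι → ℝ | ∀ i, x i ∈ Set.Ioc ((0 : ι → ℝ) i) ((0 : ι → ℝ) i + 1)} =
        {x : ι → ℝ | ∀ i, x i ∈ Set.Ioc (0 : ℝ) (0 + 1)} by simp,
        ← setIntegral_congr_set unitCube_ae_eq]
      refine integral_congr_ae (Filter.Eventually.of_forall fun x => ?_)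
      simp only
      rw [show UnitAddTorus.mFourier (-k) (fun i => (x i : UnitAddCircle)) =
        ee (-(intVec k ⬝ᵥ x)) by rw [← neg_dotProduct, ← intVec_neg]; exact hF (-k) x,
        show G (fun i => (x i : UnitAddCircle)) = g x from hG0 x, smul_eq_mul, hg,
        ← tsum_mul_left]
      refine tsum_congr fun n => ?_
      congr 1
      rw [dotProduct_add, neg_add, ee_add, intVec_dotProduct, ← Int.cast_neg, ee_intCast, mul_one]
    rw [h1]
    have hm : Continuous fun t => ee (-(intVec k ⬝ᵥ t)) * f t := by fun_prop
    have hint : Integrable fun t => ee (-(intVec k ⬝ᵥ t)) * f t :=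
      (hf.of_norm_le 1 fun t => by simp).integrable hm.aestronglyMeasurable
    have h2 := hasSum_integral_unitCube hint
    have h3 := hasSum_integral_unitCube hint.norm
    rw [← h2.tsum_eq]
    refine (integral_tsum_of_summable_integral_norm (fun n => ?_) h3.summable).symm
    exact (hint.comp_add_right (intVec n)).integrableOn
  have hsum := UnitAddTorus.hasSum_mFourier_series_apply_of_summable (f := G)
    (by refine Summable.of_norm ?_; simpa only [hcoef] using hs) (mk x)
  rw [show G (mk x) = g x from hG0 x] at hsum
  simpa only [hcoef, hF, smul_eq_mul] using hsum

/-- Orthogonality of the characters on the unit cube. -/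
theorem integral_unitCube_ee (k : ι → ℤ) :
    ∫ x in unitCube ι, ee (intVec k ⬝ᵥ x) = if k = 0 then 1 else 0 := by
  classical
  split_ifs with h
  · subst h
    simp [measureReal_def, volume_unitCube]
  · obtain ⟨i, hi⟩ := Function.ne_iff.1 h
    have h1 : ∀ x : ι → ℝ, ee (intVec k ⬝ᵥ x) = ∏ j, ee (k j * x j) := by
      intro x
      simp only [ee, dotProduct, intVec]
      rw [← Complex.exp_sum, ← Finset.mul_sum]
      push_cast; rfl
    simp only [h1]
    rw [unitCube_eq_pi, volume_pi, Measure.restrict_pi_pi,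
      integral_fintype_prod_eq_prod (fun j (t : ℝ) => ee (k j * t))]
    refine Finset.prod_eq_zero (Finset.mem_univ i) ?_
    rw [integral_Ico_eq_integral_Ioo, ← integral_Ioc_eq_integral_Ioo,
      ← intervalIntegral.integral_of_le zero_le_one]
    have hki : (2 * Real.pi * Complex.I * k i : ℂ) ≠ 0 := by
      simpa [Real.pi_ne_zero] using hi
    have := integral_exp_mul_complex (a := 0) (b := 1) hki
    have h2 : ∀ t : ℝ, ee (k i * t) = Complex.exp (2 * Real.pi * Complex.I * k i * t) := by
      intro t; rw [ee]; push_cast; ring_nf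
    simp only [h2, this]
    have h3 : Complex.exp (2 * Real.pi * Complex.I * k i) = 1 := by
      have := ee_intCast (k i)
      rwa [ee, Complex.ofReal_intCast] at this
    simp [h3]

/-- The mean value of an absolutely convergent Fourier series is its constant coefficient. -/
theorem integral_unitCube_tsum {c : (ι → ℤ) → ℂ} (hc : Summable fun k => ‖c k‖) :
    ∫ x in unitCube ι, ∑' k : ι → ℤ, c k * ee (intVec k ⬝ᵥ x) = c 0 := by
  classical
  have hfin : IsFiniteMeasure (volume.restrict (unitCube ι : Set (ι → ℝ))) :=
    ⟨by simp [volume_unitCube]⟩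
  have hn : ∀ k : ι → ℤ, ∫ x in unitCube ι, ‖c k * ee (intVec k ⬝ᵥ x)‖ = ‖c k‖ := by
    intro k
    simp [measureReal_def, volume_unitCube]
  rw [← integral_tsum_of_summable_integral_norm]
  · simp_rw [integral_const_mul, integral_unitCube_ee]
    rw [tsum_eq_single 0 (fun k hk => by simp [hk])]
    simp
  · intro k
    refine Integrable.const_mul ?_ _
    exact Integrable.of_bound (by fun_prop : Continuous _).aestronglyMeasurable 1
      (Filter.Eventually.of_forall fun x => by simp)
  · simpa only [hn] using hc

end Lattice

end

section

/-! ### Series of Schwartz functions -/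

section SchwartzSeries

variable {E : Type*} [NormedAddCommGroup E] [NormedSpace ℝ E] {I : Type*}

/-- The sum of a series of Schwartz functions that converges absolutely for every seminorm. -/
def schwartzTsum (F : I → 𝓢(E, ℂ))
    (hF : ∀ k n : ℕ, Summable fun i => SchwartzMap.seminorm ℂ k n (F i)) : 𝓢(E, ℂ) where
  toFun x := ∑' i, F i x
  smooth' := by
    refine contDiff_tsum (v := fun n i => SchwartzMap.seminorm ℂ 0 n (F i))
      (fun i => (F i).smooth ⊤) (fun n _ => hF 0 n) fun n i x _ => ?_
    exact SchwartzMap.norm_iteratedFDeriv_le_seminorm ℂ (F i) n x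
  decay' := by
    intro k n
    refine ⟨∑' i, SchwartzMap.seminorm ℂ k n (F i), fun x => ?_⟩
    rw [iteratedFDeriv_tsum_apply (N := ⊤) (v := fun n i => SchwartzMap.seminorm ℂ 0 n (F i))
      (fun i => (F i).smooth ⊤) (fun n _ => hF 0 n)
      (fun n i x _ => SchwartzMap.norm_iteratedFDeriv_le_seminorm ℂ (F i) n x) le_top]
    have hs : Summable fun i => ‖iteratedFDeriv ℝ n (F i) x‖ :=
      Summable.of_nonneg_of_le (fun _ => norm_nonneg _)
        (fun i => SchwartzMap.norm_iteratedFDeriv_le_seminorm ℂ (F i) n x) (hF 0 n)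
    calc ‖x‖ ^ k * ‖∑' i, iteratedFDeriv ℝ n (F i) x‖
        ≤ ‖x‖ ^ k * ∑' i, ‖iteratedFDeriv ℝ n (F i) x‖ := by
          gcongr; exact norm_tsum_le_tsum_norm hs
      _ = ∑' i, ‖x‖ ^ k * ‖iteratedFDeriv ℝ n (F i) x‖ := tsum_mul_left.symm
      _ ≤ _ := (hs.mul_left _).tsum_le_tsum (fun i => SchwartzMap.le_seminorm ℂ k n (F i) x)
          (hF k n)

theorem seminorm_schwartzTsum_le (F : I → 𝓢(E, ℂ))
    (hF : ∀ k n : ℕ, Summable fun i => SchwartzMap.seminorm ℂ k n (F i)) (k n : ℕ) :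
    SchwartzMap.seminorm ℂ k n (schwartzTsum F hF) ≤ ∑' i, SchwartzMap.seminorm ℂ k n (F i) := by
  refine SchwartzMap.seminorm_le_bound ℂ k n _ (tsum_nonneg fun i => apply_nonneg _ _) fun x => ?_
  change ‖x‖ ^ k * ‖iteratedFDeriv ℝ n (fun y => ∑' i, F i y) x‖ ≤ _
  rw [iteratedFDeriv_tsum_apply (N := ⊤) (v := fun n i => SchwartzMap.seminorm ℂ 0 n (F i))
    (fun i => (F i).smooth ⊤) (fun n _ => hF 0 n)
    (fun n i x _ => SchwartzMap.norm_iteratedFDeriv_le_seminorm ℂ (F i) n x) le_top]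
  have hs : Summable fun i => ‖iteratedFDeriv ℝ n (F i) x‖ :=
    Summable.of_nonneg_of_le (fun _ => norm_nonneg _)
      (fun i => SchwartzMap.norm_iteratedFDeriv_le_seminorm ℂ (F i) n x) (hF 0 n)
  calc ‖x‖ ^ k * ‖∑' i, iteratedFDeriv ℝ n (F i) x‖
      ≤ ‖x‖ ^ k * ∑' i, ‖iteratedFDeriv ℝ n (F i) x‖ := by
        gcongr; exact norm_tsum_le_tsum_norm hs
    _ = ∑' i, ‖x‖ ^ k * ‖iteratedFDeriv ℝ n (F i) x‖ := tsum_mul_left.symm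
    _ ≤ _ := (hs.mul_left _).tsum_le_tsum (fun i => SchwartzMap.le_seminorm ℂ k n (F i) x)
        (hF k n)

theorem summable_schwartz_apply (F : I → 𝓢(E, ℂ))
    (hF : ∀ k n : ℕ, Summable fun i => SchwartzMap.seminorm ℂ k n (F i)) (x : E) :
    Summable fun i => F i x :=
  Summable.of_norm_bounded (hF 0 0) fun i => SchwartzMap.norm_le_seminorm ℂ (F i) x

/-- The remainder after a finite partial sum is a series of the same kind over the complement, so
its seminorms are bounded by tails of convergent series. Convergence in the Schwartz topology is
what allows a distribution to be applied term by term. -/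
theorem hasSum_schwartzTsum (F : I → 𝓢(E, ℂ))
    (hF : ∀ k n : ℕ, Summable fun i => SchwartzMap.seminorm ℂ k n (F i)) :
    HasSum F (schwartzTsum F hF) := by
  classical
  rw [HasSum, (schwartz_withSeminorms ℂ E ℂ).tendsto_nhds]
  rintro ⟨k, n⟩ ε hε
  have h := tendsto_order.1 (tendsto_tsum_compl_atTop_zero
    fun i => SchwartzMap.seminorm ℂ k n (F i)) |>.2 ε hε
  filter_upwards [h] with s hs
  refine lt_of_le_of_lt ?_ hs
  have hF' : ∀ k n : ℕ, Summable fun i : {i // i ∉ s} => SchwartzMap.seminorm ℂ k n (F i) :=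
    fun k n => (hF k n).subtype _
  have heq : ∑ i ∈ s, F i - schwartzTsum F hF = -schwartzTsum (fun i : {i // i ∉ s} => F i) hF' := by
    ext x
    have hx := (summable_schwartz_apply F hF x).sum_add_tsum_subtype_compl s
    have : schwartzTsum F hF x = ∑' i, F i x := rfl
    have h2 : schwartzTsum (fun i : {i // i ∉ s} => F i) hF' x = ∑' i : {i // i ∉ s}, F i x := rfl
    rw [sub_apply, neg_apply, sum_apply, this, h2, ← hx]
    ring
  rw [heq, map_neg_eq_map]
  exact seminorm_schwartzTsum_le _ hF' k n

end SchwartzSeries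

/-! ### Phase space -/

variable {d : ℕ}

/-- The projection `ρ ↦ x` as a linear map. -/
def posL (d : ℕ) : Phase d →L[ℝ] Conf d := LinearMap.toContinuousLinearMap
  { toFun := pos
    map_add' := fun _ _ => by ext j; simp [pos]
    map_smul' := fun _ _ => by ext j; simp [pos] }

/-- The projection `ρ ↦ ξ` as a linear map. -/
def momL (d : ℕ) : Phase d →L[ℝ] Conf d := LinearMap.toContinuousLinearMap
  { toFun := mom
    map_add' := fun _ _ => by ext j; simp [mom]
    map_smul' := fun _ _ => by ext j; simp [mom] }

theorem pos_add (s t : Phase d) : pos (s + t) = pos s + pos t := (posL d).map_add s t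
theorem mom_add (s t : Phase d) : mom (s + t) = mom s + mom t := (momL d).map_add s t
theorem pos_neg (s : Phase d) : pos (-s) = -pos s := (posL d).map_neg s
theorem mom_neg (s : Phase d) : mom (-s) = -mom s := (momL d).map_neg s
theorem pos_smul (c : ℝ) (s : Phase d) : pos (c • s) = c • pos s := (posL d).map_smul c s
theorem mom_smul (c : ℝ) (s : Phase d) : mom (c • s) = c • mom s := (momL d).map_smul c s
@[simp] theorem pos_zero : pos (0 : Phase d) = 0 := (posL d).map_zero
@[simp] theorem mom_zero : mom (0 : Phase d) = 0 := (momL d).map_zero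
@[simp] theorem pos_mkPhase (x ξ : Conf d) : pos (mkPhase x ξ) = x := by ext j; simp [pos, mkPhase]
@[simp] theorem mom_mkPhase (x ξ : Conf d) : mom (mkPhase x ξ) = ξ := by ext j; simp [mom, mkPhase]
@[simp] theorem mkPhase_pos_mom (s : Phase d) : mkPhase (pos s) (mom s) = s := by
  ext (j | j) <;> simp [pos, mom, mkPhase]

theorem phase_ext {s t : Phase d} (h1 : pos s = pos t) (h2 : mom s = mom t) : s = t := by
  rw [← mkPhase_pos_mom s, h1, h2, mkPhase_pos_mom]

@[fun_prop] theorem continuous_pos : Continuous (pos : Phase d → Conf d) := (posL d).continuous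
@[fun_prop] theorem continuous_mom : Continuous (mom : Phase d → Conf d) := (momL d).continuous

theorem dotProduct_eq_inner (s t : Phase d) :
    s ⬝ᵥ t = inner ℝ (pos s) (pos t) + inner ℝ (mom s) (mom t) := by
  simp [dotProduct, pos, mom, PiLp.inner_apply, mul_comm]

/-- `J ρ`. -/
def jmul (s : Phase d) : Phase d := Matrix.J (Fin d) ℝ *ᵥ s

theorem pos_jmul (s : Phase d) : pos (jmul s) = -mom s := by
  ext j
  simp [pos, mom, jmul, Matrix.J, Matrix.mulVec, dotProduct, Fintype.sum_sum_type, Matrix.one_apply]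

theorem mom_jmul (s : Phase d) : mom (jmul s) = pos s := by
  ext j
  simp [pos, mom, jmul, Matrix.J, Matrix.mulVec, dotProduct, Fintype.sum_sum_type, Matrix.one_apply]

theorem sigma_eq (s t : Phase d) :
    sigma s t = inner ℝ (mom s) (pos t) - inner ℝ (pos s) (mom t) := by
  change s ⬝ᵥ jmul t = _
  rw [dotProduct_eq_inner, pos_jmul, mom_jmul, inner_neg_right]; ring

theorem sigma_comm (s t : Phase d) : sigma s t = -sigma t s := by
  rw [sigma_eq, sigma_eq, real_inner_comm (mom t), real_inner_comm (pos t)]; ring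

@[simp] theorem sigma_self (s : Phase d) : sigma s s = 0 := by
  have := sigma_comm s s; linarith

theorem sigma_add_left (s s' t : Phase d) : sigma (s + s') t = sigma s t + sigma s' t := by
  simp only [sigma_eq, mom_add, pos_add, inner_add_left]; ring

theorem sigma_add_right (s t t' : Phase d) : sigma s (t + t') = sigma s t + sigma s t' := by
  simp only [sigma_eq, mom_add, pos_add, inner_add_right]; ring

theorem sigma_neg_left (s t : Phase d) : sigma (-s) t = -sigma s t := by
  simp only [sigma_eq, mom_neg, pos_neg, inner_neg_left]; ring

theorem sigma_neg_right (s t : Phase d) : sigma s (-t) = -sigma s t := by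
  simp only [sigma_eq, mom_neg, pos_neg, inner_neg_right]; ring

theorem sigma_smul_left (c : ℝ) (s t : Phase d) : sigma (c • s) t = c * sigma s t := by
  simp only [sigma_eq, mom_smul, pos_smul, real_inner_smul_left]; ring

theorem sigma_smul_right (c : ℝ) (s t : Phase d) : sigma s (c • t) = c * sigma s t := by
  simp only [sigma_eq, mom_smul, pos_smul, real_inner_smul_right]; ring

theorem sigma_jmul_jmul (s t : Phase d) : sigma (jmul s) (jmul t) = sigma s t := by
  rw [sigma_eq, sigma_eq, pos_jmul, pos_jmul, mom_jmul, mom_jmul, inner_neg_right, inner_neg_left,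
    real_inner_comm]
  ring

theorem exists_sigma_intVec_eq (r s : Fin d ⊕ Fin d → ℤ) :
    ∃ k : ℤ, sigma (intVec r) (intVec s) = k := by
  refine ⟨∑ j, r (Sum.inr j) * s (Sum.inl j) - ∑ j, r (Sum.inl j) * s (Sum.inr j), ?_⟩
  rw [sigma_eq]
  simp [pos, mom, intVec, PiLp.inner_apply, mul_comm]

/-! ### Translation operators -/

theorem hbar_pos {N : ℕ} (hN : 0 < N) : 0 < hbar N := by
  unfold hbar; have : (0 : ℝ) < N := by exact_mod_cast hN
  positivity

theorem exp_div_hbar (N : ℕ) (t : ℝ) :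
    Complex.exp (Complex.I * ((t / hbar N : ℝ) : ℂ)) = ee (N * t) := by
  rw [ee, hbar]; congr 1; push_cast; rw [div_div_eq_mul_div]; ring

/-- Each derivative brings down a factor `2πi L`. The bound is uniform in `y` and polynomial in
`‖L‖`, so the growth of modulated functions in the frequency stays under control. -/
theorem norm_iteratedFDeriv_ee_comp_le (L : Conf d →L[ℝ] ℝ) (c : ℝ) (n : ℕ) (y : Conf d) :
    ‖iteratedFDeriv ℝ n (fun y => ee (L y + c)) y‖ ≤ (2 * Real.pi * ‖L‖) ^ n := by
  have hee : ContDiff ℝ ⊤ fun t : ℝ => ee (t + c) := by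
    unfold ee
    exact ((contDiff_const.mul ((Complex.ofRealCLM.contDiff (n := ⊤)).comp
      (contDiff_id.add contDiff_const)))).cexp
  have h := L.iteratedFDeriv_comp_right (f := fun t : ℝ => ee (t + c))
    (hee.of_le le_top) y (i := n) (n := n) le_rfl
  change ‖iteratedFDeriv ℝ n ((fun t : ℝ => ee (t + c)) ∘ L) y‖ ≤ _
  rw [h]
  refine (ContinuousMultilinearMap.norm_compContinuousLinearMap_le _ _).trans ?_
  rw [norm_iteratedFDeriv_eq_norm_iteratedDeriv, Finset.prod_const, Finset.card_univ,
    Fintype.card_fin, mul_pow]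
  gcongr
  have hd : ∀ (m : ℕ), iteratedDeriv m (fun t : ℝ => ee (t + c)) =
      fun t : ℝ => (2 * Real.pi * Complex.I) ^ m * ee (t + c) := by
    intro m
    induction m with
    | zero => simp
    | succ m ih =>
      rw [iteratedDeriv_succ, ih]
      ext t
      have h1 : HasDerivAt (fun t : ℝ => ee (t + c)) (ee (t + c) * (2 * Real.pi * Complex.I)) t := by
        unfold ee
        have h0 : HasDerivAt (fun t : ℝ => 2 * Real.pi * Complex.I * ((t + c : ℝ) : ℂ))
            (2 * Real.pi * Complex.I * ((1 : ℝ) : ℂ)) t :=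
          (((hasDerivAt_id t).add_const c).ofReal_comp).const_mul _
        have h2 := h0.cexp
        simpa using h2
      rw [(h1.const_mul _).deriv]; ring
  rw [hd]
  simp [abs_of_pos Real.pi_pos]

theorem hasTemperateGrowth_ee_comp (L : Conf d →L[ℝ] ℝ) (c : ℝ) :
    (fun y : Conf d => ee (L y + c)).HasTemperateGrowth := by
  refine ⟨?_, fun n => ⟨0, (2 * Real.pi * ‖L‖) ^ n, fun y => ?_⟩⟩
  · unfold ee
    exact (contDiff_const.mul ((Complex.ofRealCLM.contDiff (n := _)).comp
      (L.contDiff.add contDiff_const))).cexp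
  · simpa using norm_iteratedFDeriv_ee_comp_le L c n y

/-- The linear form `y ↦ N⟨ξ, y⟩`. -/
def modL (N : ℕ) (s : Phase d) : Conf d →L[ℝ] ℝ := (N : ℝ) • innerSL ℝ (mom s)

theorem modL_apply (N : ℕ) (s : Phase d) (y : Conf d) : modL N s y = N * inner ℝ (mom s) y := rfl

theorem transS_fun_eq (N : ℕ) (s : Phase d) :
    (fun y : Conf d => Complex.exp (Complex.I *
        (((inner ℝ (mom s) y - inner ℝ (mom s) (pos s) / 2) / hbar N : ℝ) : ℂ))) =
      fun y => ee (modL N s y + (-(N * (inner ℝ (mom s) (pos s) / 2)))) := by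
  ext y
  rw [exp_div_hbar, modL_apply]; congr 1; ring

theorem transS_apply (N : ℕ) (s : Phase d) (u : 𝓢(Conf d, ℂ)) (y : Conf d) :
    transS (hbar N) s u y =
      ee (N * (inner ℝ (mom s) y - inner ℝ (mom s) (pos s) / 2)) * u (y - pos s) := by
  rw [transS, transS_fun_eq, ContinuousLinearMap.comp_apply,
    SchwartzMap.smulLeftCLM_apply_apply (hasTemperateGrowth_ee_comp _ _),
    SchwartzMap.compSubConstCLM_apply, smul_eq_mul, modL_apply]
  congr 2; ring

/-- The Weyl relations. The symmetric phase `-⟨ξ, x⟩/2` in `transS` is what makes the cocycle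
exactly half the symplectic form. -/
theorem transS_transS (N : ℕ) (s t : Phase d) (u : 𝓢(Conf d, ℂ)) :
    transS (hbar N) s (transS (hbar N) t u) =
      ee (N / 2 * sigma s t) • transS (hbar N) (s + t) u := by
  ext y
  rw [smul_apply, transS_apply, transS_apply, transS_apply, smul_eq_mul, ← mul_assoc,
    ← mul_assoc, ← ee_add, ← ee_add, sigma_eq, pos_add, mom_add, sub_sub]
  congr 2
  simp only [inner_add_left, inner_add_right, inner_sub_right]
  rw [real_inner_comm (mom t) (pos s)]
  ring

@[simp] theorem transS_zero (N : ℕ) (u : 𝓢(Conf d, ℂ)) : transS (hbar N) 0 u = u := by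
  ext y; rw [transS_apply]; simp

/-- The seminorms of `U_ħ(s) u` grow at most polynomially in `s`. -/
theorem exists_seminorm_transS_le (N : ℕ) (k n : ℕ) :
    ∃ (C : ℝ), 0 ≤ C ∧ ∀ (s : Phase d) (u : 𝓢(Conf d, ℂ)),
      SchwartzMap.seminorm ℂ k n (transS (hbar N) s u) ≤
        C * (1 + ‖s‖) ^ (k + n) *
          (Finset.Iic (k, n)).sup (schwartzSeminormFamily ℂ (Conf d) ℂ) u := by
  set a : ℝ := 1 + 2 * Real.pi * (N * ‖momL d‖) with ha
  set b : ℝ := 1 + ‖posL d‖ with hb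
  have ha1 : 1 ≤ a := by rw [ha]; have := Real.pi_pos; simp; positivity
  have hb1 : 1 ≤ b := by rw [hb]; simp
  refine ⟨2 ^ n * (a ^ n * b ^ k * 2 ^ k), by positivity, fun s u => ?_⟩
  set q := (Finset.Iic (k, n)).sup (schwartzSeminormFamily ℂ (Conf d) ℂ) u with hq
  have hq0 : 0 ≤ q := apply_nonneg _ _
  refine SchwartzMap.seminorm_le_bound ℂ k n _ (by positivity) fun y => ?_
  set c := -(N * (inner ℝ (mom s) (pos s) / 2)) with hc
  have hfun : (transS (hbar N) s u : Conf d → ℂ) =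
      fun y => ee (modL N s y + c) * u.compSubConstCLM ℂ (pos s) y := by
    ext y
    rw [transS_apply, SchwartzMap.compSubConstCLM_apply, modL_apply, hc]
    congr 2; ring
  have hmodL : 2 * Real.pi * ‖modL N s‖ ≤ a * (1 + ‖s‖) := by
    have h1 : ‖modL N s‖ ≤ N * ‖momL d‖ * ‖s‖ := by
      rw [modL, norm_smul, innerSL_apply_norm, Real.norm_natCast, mul_assoc]
      gcongr; exact (momL d).le_opNorm s
    have : 0 ≤ N * ‖momL d‖ := by positivity
    calc 2 * Real.pi * ‖modL N s‖ ≤ 2 * Real.pi * (N * ‖momL d‖ * ‖s‖) := by gcongr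
      _ ≤ a * (1 + ‖s‖) := by
        rw [ha]; nlinarith [norm_nonneg s, mul_nonneg Real.pi_pos.le this]
  have hterm : ∀ i ∈ Finset.range (n + 1),
      ‖y‖ ^ k * ((n.choose i : ℝ) * ‖iteratedFDeriv ℝ i (fun y => ee (modL N s y + c)) y‖ *
        ‖iteratedFDeriv ℝ (n - i) (u.compSubConstCLM ℂ (pos s)) y‖) ≤
      (n.choose i : ℝ) * (a ^ n * b ^ k * 2 ^ k * (1 + ‖s‖) ^ (k + n) * q) := by
    intro i hi
    have hin : i ≤ n := Finset.mem_range_succ_iff.1 hi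
    have h1 : ‖iteratedFDeriv ℝ i (fun y => ee (modL N s y + c)) y‖ ≤ (a * (1 + ‖s‖)) ^ n := by
      refine (norm_iteratedFDeriv_ee_comp_le _ _ _ _).trans ?_
      calc (2 * Real.pi * ‖modL N s‖) ^ i ≤ (a * (1 + ‖s‖)) ^ i := by gcongr
        _ ≤ _ := pow_le_pow_right₀ (by nlinarith [norm_nonneg s]) hin
    -- The weight is moved to `y - pos s`, the point where `u` is evaluated, at the price of one
    -- factor `1 + ‖s‖` per power.
    have h2 : ‖y‖ ^ k ≤ (b * (1 + ‖s‖)) ^ k * (1 + ‖y - pos s‖) ^ k := by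
      rw [← mul_pow]; gcongr
      have h3 := one_add_norm_add_le (pos s) (y - pos s)
      rw [add_sub_cancel] at h3
      have h4 : 1 + ‖pos s‖ ≤ b * (1 + ‖s‖) := by
        have := (posL d).le_opNorm s
        change ‖pos s‖ ≤ _ at this
        rw [hb]; nlinarith [norm_nonneg s, norm_nonneg (posL d)]
      calc ‖y‖ ≤ 1 + ‖y‖ := by linarith
        _ ≤ _ := h3
        _ ≤ _ := by gcongr
    have h3 : (1 + ‖y - pos s‖) ^ k * ‖iteratedFDeriv ℝ (n - i) (u.compSubConstCLM ℂ (pos s)) y‖ ≤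
        2 ^ k * q := by
      have : iteratedFDeriv ℝ (n - i) (u.compSubConstCLM ℂ (pos s)) y =
          iteratedFDeriv ℝ (n - i) u (y - pos s) := by
        rw [← iteratedFDeriv_comp_sub]; rfl
      rw [this]
      exact SchwartzMap.one_add_le_sup_seminorm_apply (𝕜 := ℂ) (m := (k, n)) le_rfl
        (Nat.sub_le n i) u (y - pos s)
    calc _ ≤ ((b * (1 + ‖s‖)) ^ k * (1 + ‖y - pos s‖) ^ k) * ((n.choose i : ℝ) *
          (a * (1 + ‖s‖)) ^ n * ‖iteratedFDeriv ℝ (n - i) (u.compSubConstCLM ℂ (pos s)) y‖) := by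
          gcongr
      _ = (n.choose i : ℝ) * ((b * (1 + ‖s‖)) ^ k * (a * (1 + ‖s‖)) ^ n) * ((1 + ‖y - pos s‖) ^ k *
          ‖iteratedFDeriv ℝ (n - i) (u.compSubConstCLM ℂ (pos s)) y‖) := by ring
      _ ≤ (n.choose i : ℝ) * ((b * (1 + ‖s‖)) ^ k * (a * (1 + ‖s‖)) ^ n) * (2 ^ k * q) := by gcongr
      _ = _ := by rw [mul_pow, mul_pow, pow_add]; ring
  rw [hfun]
  have hL := norm_iteratedFDeriv_mul_le (n := n) (hasTemperateGrowth_ee_comp (modL N s) c).1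
    ((u.compSubConstCLM ℂ (pos s)).smooth ⊤) y (mod_cast le_top)
  calc _ ≤ ‖y‖ ^ k * _ := mul_le_mul_of_nonneg_left hL (by positivity)
    _ ≤ ∑ i ∈ Finset.range (n + 1),
        (n.choose i : ℝ) * (a ^ n * b ^ k * 2 ^ k * (1 + ‖s‖) ^ (k + n) * q) := by
      rw [Finset.mul_sum]; exact Finset.sum_le_sum hterm
    _ = _ := by
      rw [← Finset.sum_mul, ← Nat.cast_sum, Nat.sum_range_choose]; push_cast; ring

/-! ### Decay of the matrix coefficients of the translation operators -/

/-- The bilinear pairing `∫ f g` of Schwartz functions. -/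
def pair (f g : 𝓢(Conf d, ℂ)) : ℂ := ∫ y, f y * g y

theorem integrable_mul_schwartz (f g : 𝓢(Conf d, ℂ)) : Integrable fun y => f y * g y :=
  (SchwartzMap.pairing (ContinuousLinearMap.mul ℂ ℂ) f g).integrable

theorem pair_add_left (f f' g : 𝓢(Conf d, ℂ)) : pair (f + f') g = pair f g + pair f' g := by
  simp only [pair, add_apply, add_mul]
  exact integral_add (integrable_mul_schwartz _ _) (integrable_mul_schwartz _ _)

theorem pair_smul_left (c : ℂ) (f g : 𝓢(Conf d, ℂ)) : pair (c • f) g = c * pair f g := by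
  simp only [pair, smul_apply, smul_eq_mul, mul_assoc]
  exact integral_const_mul _ _

theorem pair_comm (f g : 𝓢(Conf d, ℂ)) : pair f g = pair g f := by
  simp only [pair, mul_comm]

theorem pair_smul_right (c : ℂ) (f g : 𝓢(Conf d, ℂ)) : pair f (c • g) = c * pair f g := by
  rw [pair_comm, pair_smul_left, pair_comm]

theorem pair_add_right (f g g' : 𝓢(Conf d, ℂ)) : pair f (g + g') = pair f g + pair f g' := by
  rw [pair_comm, pair_add_left, pair_comm, pair_comm g']

/-- Multiplication by the `j`-th coordinate. -/
def coordCLM (j : Fin d) : 𝓢(Conf d, ℂ) →L[ℂ] 𝓢(Conf d, ℂ) :=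
  SchwartzMap.smulLeftCLM ℂ fun y : Conf d => ((inner ℝ (EuclideanSpace.single j (1 : ℝ)) y : ℝ) : ℂ)

theorem coordCLM_apply (j : Fin d) (u : 𝓢(Conf d, ℂ)) (y : Conf d) :
    coordCLM j u y = (y j : ℂ) * u y := by
  rw [coordCLM, SchwartzMap.smulLeftCLM_apply_apply]
  · rw [EuclideanSpace.inner_single_left]; simp
  · exact (Complex.ofRealCLM.comp (innerSL ℝ (EuclideanSpace.single j (1 : ℝ)))).hasTemperateGrowth

/-- The partial derivative in the `j`-th coordinate. -/
def partialCLM (j : Fin d) : 𝓢(Conf d, ℂ) →L[ℂ] 𝓢(Conf d, ℂ) :=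
  LineDeriv.lineDerivOpCLM ℂ 𝓢(Conf d, ℂ) (EuclideanSpace.single j (1 : ℝ))

theorem pair_coordCLM (j : Fin d) (f g : 𝓢(Conf d, ℂ)) :
    pair (coordCLM j f) g = pair f (coordCLM j g) := by
  simp only [pair, coordCLM_apply]
  congr 1; ext y; ring

theorem pair_partialCLM (j : Fin d) (f g : 𝓢(Conf d, ℂ)) :
    pair (partialCLM j f) g = -pair f (partialCLM j g) := by
  have : pair f (partialCLM j g) = -pair (partialCLM j f) g :=
    SchwartzMap.integral_mul_lineDerivOp_right_eq_neg_left (μ := volume) f g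
      (EuclideanSpace.single j (1 : ℝ))
  rw [this, neg_neg]

/-- The commutator of position and translation. It trades a factor `pos s j` of a matrix coefficient
for coordinate multiplications of the two test functions. -/
theorem coordCLM_transS (N : ℕ) (s : Phase d) (j : Fin d) (u : 𝓢(Conf d, ℂ)) :
    coordCLM j (transS (hbar N) s u) =
      transS (hbar N) s (coordCLM j u) + ((pos s j : ℝ) : ℂ) • transS (hbar N) s u := by
  ext y
  rw [add_apply, smul_apply, coordCLM_apply, transS_apply, transS_apply, coordCLM_apply, smul_eq_mul,
    PiLp.sub_apply]
  push_cast; ring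

/-- The momentum counterpart of `coordCLM_transS`; the constant `2πi N` is `i/ħ`. -/
theorem partialCLM_transS (N : ℕ) (s : Phase d) (j : Fin d) (u : 𝓢(Conf d, ℂ)) :
    partialCLM j (transS (hbar N) s u) = transS (hbar N) s (partialCLM j u) +
      (2 * Real.pi * Complex.I * N * ((mom s j : ℝ) : ℂ)) • transS (hbar N) s u := by
  ext y
  set v := EuclideanSpace.single j (1 : ℝ)
  have hu : HasFDerivAt u (fderiv ℝ u (y - pos s)) (y - pos s) := u.hasFDerivAt _
  have h1 : HasFDerivAt (fun y => u (y - pos s)) (fderiv ℝ u (y - pos s)) y := by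
    exact hu.comp y ((hasFDerivAt_id y).sub_const (pos s))
  set c : ℝ := -(N * (inner ℝ (mom s) (pos s) / 2))
  have h2 : HasFDerivAt (fun y => ee (modL N s y + c))
      (ee (modL N s y + c) • (2 * Real.pi * Complex.I) • (Complex.ofRealCLM.comp (modL N s))) y := by
    unfold ee
    have h0 : HasFDerivAt (fun y => ((modL N s y + c : ℝ) : ℂ))
        (Complex.ofRealCLM.comp (modL N s)) y :=
      Complex.ofRealCLM.hasFDerivAt.comp y ((modL N s).hasFDerivAt.add_const c)
    exact (h0.const_mul _).cexp
  have hfun : (transS (hbar N) s u : Conf d → ℂ) = fun y => ee (modL N s y + c) * u (y - pos s) := by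
    ext y
    rw [transS_apply, modL_apply]
    congr 2; ring
  have h3 : HasFDerivAt (fun y => ee (modL N s y + c) * u (y - pos s)) _ y := h2.mul h1
  have h4 : partialCLM j (transS (hbar N) s u) y = fderiv ℝ (transS (hbar N) s u) y v :=
    SchwartzMap.lineDerivOp_apply_eq_fderiv _ _ _
  have h5 : partialCLM j u (y - pos s) = fderiv ℝ u (y - pos s) v :=
    SchwartzMap.lineDerivOp_apply_eq_fderiv _ _ _
  rw [h4, add_apply, smul_apply, transS_apply, transS_apply, h5, hfun, h3.fderiv]
  have h6 : modL N s v = N * mom s j := by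
    rw [modL_apply, EuclideanSpace.inner_single_right]; simp
  have h7 : (N * (inner ℝ (mom s) y - inner ℝ (mom s) (pos s) / 2)) = modL N s y + c := by
    rw [modL_apply]; ring
  rw [h7]
  simp [h6]
  ring

theorem norm_pair_transS_le (N : ℕ) (s : Phase d) (h g : 𝓢(Conf d, ℂ)) :
    ‖pair (transS (hbar N) s h) g‖ ≤ SchwartzMap.seminorm ℂ 0 0 h * ∫ y, ‖g y‖ := by
  rw [pair, ← integral_const_mul]
  refine norm_integral_le_of_norm_le (g.integrable.norm.const_mul _)
    (Filter.Eventually.of_forall fun y => ?_)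
  rw [norm_mul, transS_apply, norm_mul, norm_ee, one_mul]
  gcongr
  exact SchwartzMap.norm_le_seminorm ℂ h _

/-- The matrix coefficients `∫ (U_ħ(s) h) g` decay rapidly in `s`. -/
theorem exists_pow_mul_norm_pair_transS_le {N : ℕ} (hN : 0 < N) (M : ℕ) (g : 𝓢(Conf d, ℂ)) :
    ∃ q : Seminorm ℂ 𝓢(Conf d, ℂ), Continuous q ∧ ∀ (s : Phase d) (h : 𝓢(Conf d, ℂ)),
      (1 + ‖s‖) ^ M * ‖pair (transS (hbar N) s h) g‖ ≤ q h := by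
  induction M generalizing g with
  | zero =>
    refine ⟨(∫ y, ‖g y‖).toNNReal •
      SchwartzMap.seminorm ℂ 0 0 (E := Conf d) (F := ℂ), ?_, fun s h => ?_⟩
    · exact ((schwartz_withSeminorms ℂ (Conf d) ℂ).continuous_seminorm (0, 0)).const_smul
        (∫ y, ‖g y‖).toNNReal
    · rw [pow_zero, one_mul]
      refine (norm_pair_transS_le N s h g).trans (le_of_eq ?_)
      rw [smul_apply, NNReal.smul_def, smul_eq_mul, mul_comm,
        Real.coe_toNNReal _ (integral_nonneg fun y => norm_nonneg _)]
  -- One more factor `1 + ‖s‖` is bounded by the coordinates of `s`, and each coordinate is removed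
  -- by a commutator, which lands on `g` or on `h`. For this reason the induction is over all `g`
  -- and the bound is a continuous seminorm of `h`.
  | succ M ih =>
    obtain ⟨q₀, hq₀c, hq₀⟩ := ih g
    choose qx hqxc hqx using fun j : Fin d => ih (coordCLM j g)
    choose qp hqpc hqp using fun j : Fin d => ih (partialCLM j g)
    refine ⟨q₀ + ∑ j, ((qx j + q₀.comp (coordCLM j).toLinearMap) +
      (qp j + q₀.comp (partialCLM j).toLinearMap)), ?_, fun s h => ?_⟩
    · have : ((q₀ + ∑ j, ((qx j + q₀.comp (coordCLM j).toLinearMap) +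
          (qp j + q₀.comp (partialCLM j).toLinearMap)) : Seminorm ℂ 𝓢(Conf d, ℂ)) :
          𝓢(Conf d, ℂ) → ℝ) = fun h => q₀ h + ∑ j, ((qx j h + q₀ (coordCLM j h)) +
            (qp j h + q₀ (partialCLM j h))) := by
        ext h; simp [add_apply, sum_apply]
      rw [this]
      fun_prop
    · have hx : ∀ j, (1 + ‖s‖) ^ M * (|pos s j| * ‖pair (transS (hbar N) s h) g‖) ≤
          qx j h + q₀ (coordCLM j h) := by
        intro j
        have h1 : ((pos s j : ℝ) : ℂ) * pair (transS (hbar N) s h) g =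
            pair (transS (hbar N) s h) (coordCLM j g) - pair (transS (hbar N) s (coordCLM j h)) g := by
          rw [← pair_coordCLM, coordCLM_transS, pair_add_left, pair_smul_left]; ring
        calc _ = (1 + ‖s‖) ^ M * ‖((pos s j : ℝ) : ℂ) * pair (transS (hbar N) s h) g‖ := by
              rw [norm_mul, Complex.norm_real, Real.norm_eq_abs]
          _ ≤ (1 + ‖s‖) ^ M * (‖pair (transS (hbar N) s h) (coordCLM j g)‖ +
                ‖pair (transS (hbar N) s (coordCLM j h)) g‖) := by
              rw [h1]; gcongr; exact norm_sub_le _ _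
          _ ≤ _ := by rw [mul_add]; exact add_le_add (hqx j s h) (hq₀ s _)
      have hp : ∀ j, (1 + ‖s‖) ^ M * (|mom s j| * ‖pair (transS (hbar N) s h) g‖) ≤
          qp j h + q₀ (partialCLM j h) := by
        intro j
        have h1 : (2 * Real.pi * Complex.I * N * ((mom s j : ℝ) : ℂ)) * pair (transS (hbar N) s h) g =
            -pair (transS (hbar N) s h) (partialCLM j g) -
              pair (transS (hbar N) s (partialCLM j h)) g := by
          rw [← pair_partialCLM, partialCLM_transS, pair_add_left, pair_smul_left]; ring
        have h2 : |mom s j| ≤ ‖(2 * Real.pi * Complex.I * N * ((mom s j : ℝ) : ℂ))‖ := by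
          simp only [norm_mul, Complex.norm_real, Real.norm_eq_abs, Complex.norm_I, mul_one,
            Complex.norm_natCast, Complex.norm_ofNat, abs_of_pos Real.pi_pos]
          have h3 : (1 : ℝ) ≤ 2 * Real.pi * N := by
            have : (1 : ℝ) ≤ N := by exact_mod_cast hN
            nlinarith [Real.pi_gt_three]
          exact le_mul_of_one_le_left (abs_nonneg _) h3
        calc _ ≤ (1 + ‖s‖) ^ M * ‖(2 * Real.pi * Complex.I * N * ((mom s j : ℝ) : ℂ)) *
              pair (transS (hbar N) s h) g‖ := by
              rw [norm_mul]; gcongr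
          _ ≤ (1 + ‖s‖) ^ M * (‖pair (transS (hbar N) s h) (partialCLM j g)‖ +
                ‖pair (transS (hbar N) s (partialCLM j h)) g‖) := by
              rw [h1]; gcongr; exact (norm_sub_le _ _).trans (by rw [norm_neg])
          _ ≤ _ := by rw [mul_add]; exact add_le_add (hqp j s h) (hq₀ s _)
      have hs : ‖s‖ ≤ ∑ j, (|pos s j| + |mom s j|) := by
        rw [pi_norm_le_iff_of_nonneg (by positivity)]
        rintro (j | j)
        · exact (le_add_of_nonneg_right (abs_nonneg _)).trans
            (Finset.single_le_sum (f := fun j => |pos s j| + |mom s j|)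
              (fun _ _ => by positivity) (Finset.mem_univ j))
        · exact (le_add_of_nonneg_left (abs_nonneg _)).trans
            (Finset.single_le_sum (f := fun j => |pos s j| + |mom s j|)
              (fun _ _ => by positivity) (Finset.mem_univ j))
      rw [add_apply, sum_apply]
      calc (1 + ‖s‖) ^ (M + 1) * ‖pair (transS (hbar N) s h) g‖
          ≤ (1 + ‖s‖) ^ M * (1 + ∑ j, (|pos s j| + |mom s j|)) *
              ‖pair (transS (hbar N) s h) g‖ := by
            rw [pow_succ]; gcongr
        _ = (1 + ‖s‖) ^ M * ‖pair (transS (hbar N) s h) g‖ +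
            ∑ j, ((1 + ‖s‖) ^ M * (|pos s j| * ‖pair (transS (hbar N) s h) g‖) +
              (1 + ‖s‖) ^ M * (|mom s j| * ‖pair (transS (hbar N) s h) g‖)) := by
            rw [mul_add, add_mul, mul_one, Finset.mul_sum, Finset.sum_mul]
            congr 1
            exact Finset.sum_congr rfl fun j _ => by ring
        _ ≤ _ := add_le_add (hq₀ s h)
            (Finset.sum_le_sum fun j _ => add_le_add (hx j) (hp j))

theorem rapidDecay_pair_transS {N : ℕ} (hN : 0 < N) (h g : 𝓢(Conf d, ℂ)) :
    RapidDecay fun s : Phase d => pair (transS (hbar N) s h) g := fun M => by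
  obtain ⟨q, -, hq⟩ := exists_pow_mul_norm_pair_transS_le hN M g
  exact ⟨q h, fun s => hq s h⟩

end

section

variable {d : ℕ}

/-! ### The Poisson summation formula for Schwartz functions -/

/-- An integer vector as a point of the configuration space. -/
def cvec (n : Fin d → ℤ) : Conf d := WithLp.toLp 2 (intVec n)

theorem inner_cvec (k : Fin d → ℤ) (y : Conf d) : inner ℝ (cvec k) y = intVec k ⬝ᵥ y.ofLp := by
  simp [cvec, PiLp.inner_apply, dotProduct, mul_comm]

theorem rapidDecay_schwartz (u : 𝓢(Conf d, ℂ)) : RapidDecay u := by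
  intro M
  refine ⟨2 ^ M * (Finset.Iic (M, 0)).sup (schwartzSeminormFamily ℂ (Conf d) ℂ) u, fun x => ?_⟩
  have := SchwartzMap.one_add_le_sup_seminorm_apply (𝕜 := ℂ) (m := (M, 0)) le_rfl le_rfl u x
  rwa [norm_iteratedFDeriv_zero] at this

theorem rapidDecay_schwartz_comp (u : 𝓢(Conf d, ℂ)) (y : Conf d) {c : ℝ} (hc : c ≠ 0) :
    RapidDecay fun x : Fin d → ℝ => u (y + c • (WithLp.toLp 2 x : Conf d)) := by
  intro M
  obtain ⟨C, hC⟩ := rapidDecay_schwartz u M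
  set b : ℝ := (1 + |c|⁻¹) * (1 + ‖y‖) with hb
  have hb0 : 0 ≤ b := by positivity
  refine ⟨b ^ M * C, fun x => ?_⟩
  have h1 : ‖x‖ ≤ ‖(WithLp.toLp 2 x : Conf d)‖ := by
    rw [pi_norm_le_iff_of_nonneg (norm_nonneg _)]
    exact fun j => PiLp.norm_apply_le (WithLp.toLp 2 x : Conf d) j
  set z : Conf d := WithLp.toLp 2 x
  have h2 : ‖z‖ = |c|⁻¹ * ‖c • z‖ := by
    rw [norm_smul, Real.norm_eq_abs, inv_mul_cancel_left₀ (abs_ne_zero.2 hc)]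
  have h3 : 1 + ‖c • z‖ ≤ (1 + ‖y + c • z‖) * (1 + ‖y‖) := by
    have := one_add_norm_add_le (y + c • z) (-y)
    simpa using this
  have h4 : 1 + ‖x‖ ≤ b * (1 + ‖y + c • z‖) := by
    have h5 : 0 ≤ |c|⁻¹ := by positivity
    calc 1 + ‖x‖ ≤ 1 + |c|⁻¹ * ‖c • z‖ := by rw [← h2]; gcongr
      _ ≤ (1 + |c|⁻¹) * (1 + ‖c • z‖) := by nlinarith [norm_nonneg (c • z)]
      _ ≤ (1 + |c|⁻¹) * ((1 + ‖y + c • z‖) * (1 + ‖y‖)) := by gcongr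
      _ = _ := by rw [hb]; ring
  calc (1 + ‖x‖) ^ M * ‖u (y + c • z)‖ ≤ (b * (1 + ‖y + c • z‖)) ^ M * ‖u (y + c • z)‖ := by gcongr
    _ = b ^ M * ((1 + ‖y + c • z‖) ^ M * ‖u (y + c • z)‖) := by rw [mul_pow]; ring
    _ ≤ _ := by gcongr; exact hC _

theorem RapidDecay.comp_smul {E F : Type*} [NormedAddCommGroup E] [NormedSpace ℝ E]
    [NormedAddCommGroup F] {f : E → F} (hf : RapidDecay f) {a : ℝ} (ha : a ≠ 0) :
    RapidDecay fun x => f (a • x) := by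
  intro M
  obtain ⟨C, hC⟩ := hf M
  refine ⟨(1 + |a|⁻¹) ^ M * C, fun x => ?_⟩
  have h2 : ‖x‖ = |a|⁻¹ * ‖a • x‖ := by
    rw [norm_smul, Real.norm_eq_abs, inv_mul_cancel_left₀ (abs_ne_zero.2 ha)]
  have h3 : 1 + ‖x‖ ≤ (1 + |a|⁻¹) * (1 + ‖a • x‖) := by
    have h5 : 0 ≤ |a|⁻¹ := by positivity
    rw [h2]; nlinarith [norm_nonneg (a • x)]
  calc (1 + ‖x‖) ^ M * ‖f (a • x)‖ ≤ ((1 + |a|⁻¹) * (1 + ‖a • x‖)) ^ M * ‖f (a • x)‖ := by gcongr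
    _ = (1 + |a|⁻¹) ^ M * ((1 + ‖a • x‖) ^ M * ‖f (a • x)‖) := by rw [mul_pow]; ring
    _ ≤ _ := by gcongr; exact hC _

theorem summable_schwartz_lattice (u : 𝓢(Conf d, ℂ)) (y : Conf d) {c : ℝ} (hc : c ≠ 0) :
    Summable fun n : Fin d → ℤ => ‖u (y + c • cvec n)‖ :=
  (rapidDecay_schwartz_comp u y hc).summable_intVec

/-- These integrals are the values of the Schwartz function `𝓕 F` at the points of `c ℤ^d`. -/
theorem summable_fourier_lattice (F : 𝓢(Conf d, ℂ)) {c : ℝ} (hc : c ≠ 0) :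
    Summable fun k : Fin d → ℤ => ‖∫ t, ee (-(c * inner ℝ (cvec k) t)) * F t‖ := by
  have h := summable_schwartz_lattice (FourierTransform.fourier F) 0 hc
  refine h.congr fun k => ?_
  rw [SchwartzMap.fourier_coe, Real.fourier_eq]
  congr 1
  refine integral_congr_ae (Filter.Eventually.of_forall fun t => ?_)
  simp only [zero_add]
  rw [Circle.smul_def, Real.fourierChar_apply, ee, smul_eq_mul, inner_smul_right,
    real_inner_comm]
  congr 2
  push_cast; ring

/-- The Poisson summation formula for the lattice `c⁻¹ ℤ^d`. -/
theorem hasSum_poisson_schwartz (F : 𝓢(Conf d, ℂ)) {c : ℝ} (hc : 0 < c) (y : Conf d) :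
    HasSum (fun k : Fin d → ℤ => (∫ t, ee (-(c * inner ℝ (cvec k) t)) * F t) *
        ee (c * inner ℝ (cvec k) y))
      (((c : ℂ) ^ d)⁻¹ * ∑' n : Fin d → ℤ, F (y + c⁻¹ • cvec n)) := by
  set f : (Fin d → ℝ) → ℂ := fun x => F (c⁻¹ • (WithLp.toLp 2 x : Conf d)) with hf
  have hfd : RapidDecay f := by
    simpa using rapidDecay_schwartz_comp F 0 (inv_ne_zero hc.ne')
  have hfc : Continuous f := by
    have : Continuous fun x : Fin d → ℝ => (WithLp.toLp 2 x : Conf d) :=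
      PiLp.continuous_toLp 2 _
    fun_prop
  have hcoef : ∀ k : Fin d → ℤ, ∫ t, ee (-(intVec k ⬝ᵥ t)) * f t =
      (c ^ d : ℝ) * ∫ t, ee (-(c * inner ℝ (cvec k) t)) * F t := by
    intro k
    have h1 := (EuclideanSpace.volume_preserving_symm_measurableEquiv_toLp (Fin d)).symm.integral_comp'
      (g := fun t : Conf d => ee (-(inner ℝ (cvec k) t)) * F (c⁻¹ • t))
    have h2 := Measure.integral_comp_smul (volume : Measure (Conf d))
      (fun t : Conf d => ee (-(c * inner ℝ (cvec k) t)) * F t) c⁻¹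
    have h3 : ∫ t, ee (-(intVec k ⬝ᵥ t)) * f t =
        ∫ t : Conf d, ee (-(inner ℝ (cvec k) t)) * F (c⁻¹ • t) := by
      rw [← h1]
      refine integral_congr_ae (Filter.Eventually.of_forall fun t => ?_)
      simp only [hf, inner_cvec]
      rfl
    have h4 : ∫ t : Conf d, ee (-(inner ℝ (cvec k) t)) * F (c⁻¹ • t) =
        ∫ t : Conf d, ee (-(c * inner ℝ (cvec k) (c⁻¹ • t))) * F (c⁻¹ • t) := by
      refine integral_congr_ae (Filter.Eventually.of_forall fun t => ?_)
      simp only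
      rw [inner_smul_right, mul_inv_cancel_left₀ hc.ne']
    rw [h3, h4, h2, finrank_euclideanSpace_fin, inv_pow, inv_inv, abs_of_pos (by positivity),
      Complex.real_smul]
  have hs : Summable fun k : Fin d → ℤ => ‖∫ t, ee (-(intVec k ⬝ᵥ t)) * f t‖ := by
    simp only [hcoef, norm_mul]
    exact (summable_fourier_lattice F hc.ne').mul_left _
  have h := (hasSum_poisson hfc hfd hs (c • y.ofLp)).mul_left (((c ^ d : ℝ) : ℂ)⁻¹)
  have hcd : ((c ^ d : ℝ) : ℂ) ≠ 0 := by exact_mod_cast (pow_pos hc d).ne'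
  have e1 : (fun k : Fin d → ℤ => (∫ t, ee (-(c * inner ℝ (cvec k) t)) * F t) *
      ee (c * inner ℝ (cvec k) y)) = fun k => ((c ^ d : ℝ) : ℂ)⁻¹ *
        ((∫ t, ee (-(intVec k ⬝ᵥ t)) * f t) * ee (intVec k ⬝ᵥ c • y.ofLp)) := by
    ext k
    rw [hcoef, inner_cvec, dotProduct_smul, smul_eq_mul]
    field_simp
  have e2 : ((c : ℂ) ^ d)⁻¹ * ∑' n : Fin d → ℤ, F (y + c⁻¹ • cvec n) =
      ((c ^ d : ℝ) : ℂ)⁻¹ * ∑' n : Fin d → ℤ, f (c • y.ofLp + intVec n) := by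
    push_cast
    congr 1
    refine tsum_congr fun n => ?_
    simp only [hf]
    congr 1
    ext j
    simp [cvec, inv_mul_cancel_left₀ hc.ne']
  rw [e1, e2]
  exact h

/-! ### The fundamental identity for the matrix coefficients -/

theorem pos_intVec (r : Fin d ⊕ Fin d → ℤ) : pos (intVec r) = cvec fun j => r (Sum.inl j) := rfl
theorem mom_intVec (r : Fin d ⊕ Fin d → ℤ) : mom (intVec r) = cvec fun j => r (Sum.inr j) := rfl

theorem summable_pair_transS_mul {N : ℕ} (hN : 0 < N) {a : ℝ} (ha : 0 < a) (f g h : 𝓢(Conf d, ℂ))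
    (y : Conf d) : Summable fun r : Fin d ⊕ Fin d → ℤ =>
      pair (transS (hbar N) (a • intVec r) f) g * transS (hbar N) (-(a • intVec r)) h y := by
  have h1 := ((rapidDecay_pair_transS hN f g).comp_smul ha.ne').summable_intVec
  refine Summable.of_norm_bounded (h1.mul_right (SchwartzMap.seminorm ℂ 0 0 h)) fun r => ?_
  rw [norm_mul, transS_apply, norm_mul, norm_ee, one_mul]
  gcongr
  exact SchwartzMap.norm_le_seminorm ℂ h _

/-- Expansion of the matrix coefficients along a lattice. -/
theorem tsum_pair_transS_mul {N : ℕ} (hN : 0 < N) {a : ℝ} (ha : 0 < a) (f g h : 𝓢(Conf d, ℂ))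
    (y : Conf d) :
    ∑' r : Fin d ⊕ Fin d → ℤ,
      pair (transS (hbar N) (a • intVec r) f) g * transS (hbar N) (-(a • intVec r)) h y =
    (((N * a : ℝ) : ℂ) ^ d)⁻¹ * ∑' q : Fin d → ℤ, ∑' n : Fin d → ℤ,
      h (y + a • cvec q) * f (y + (N * a)⁻¹ • cvec n) * g (y + a • cvec q + (N * a)⁻¹ • cvec n) := by
  have hNa : 0 < N * a := by have : (0 : ℝ) < N := by exact_mod_cast hN
                             positivity
  -- At fixed position `q`, the sum over momenta is a Poisson sum: it replaces the integration
  -- variable of the pairing by the points `y + a q + (N a)⁻¹ n`.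
  set e := (Equiv.sumArrowEquivProdArrow (Fin d) (Fin d) ℤ).symm
  have hs := summable_pair_transS_mul hN ha f g h y
  have hs' := (e.summable_iff).2 hs
  rw [← e.tsum_eq]
  refine (Summable.tsum_prod hs').trans ?_
  rw [← tsum_mul_left]
  refine tsum_congr fun q => ?_
  set F : 𝓢(Conf d, ℂ) := SchwartzMap.pairing (ContinuousLinearMap.mul ℂ ℂ)
    (f.compSubConstCLM ℂ (a • cvec q)) g with hF
  have hFa : ∀ t, F t = f (t - a • cvec q) * g t := fun t => rfl
  have hP := (hasSum_poisson_schwartz F hNa (y + a • cvec q)).mul_left (h (y + a • cvec q))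
  have hP' := (Equiv.neg (Fin d → ℤ)).hasSum_iff.2 hP
  have hterm : ∀ p : Fin d → ℤ,
      pair (transS (hbar N) (a • intVec (e (q, p))) f) g *
        transS (hbar N) (-(a • intVec (e (q, p)))) h y =
      h (y + a • cvec q) * ((∫ t, ee (-(N * a * inner ℝ (cvec (-p)) t)) * F t) *
        ee (N * a * inner ℝ (cvec (-p)) (y + a • cvec q))) := by
    intro p
    have hpos : pos (a • intVec (e (q, p))) = a • cvec q := by rw [pos_smul, pos_intVec]; rfl
    have hmom : mom (a • intVec (e (q, p))) = a • cvec p := by rw [mom_smul, mom_intVec]; rfl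
    have hneg : cvec (-p) = -cvec p := by ext j; simp [cvec, intVec]
    have h1 : pair (transS (hbar N) (a • intVec (e (q, p))) f) g =
        ee (-(N * (a ^ 2 * inner ℝ (cvec p) (cvec q) / 2))) *
          ∫ t, ee (-(N * a * inner ℝ (cvec (-p)) t)) * F t := by
      rw [pair, ← integral_const_mul]
      refine integral_congr_ae (Filter.Eventually.of_forall fun t => ?_)
      simp only
      rw [transS_apply, hpos, hmom, hFa, ← mul_assoc, ← mul_assoc, ← ee_add, hneg]
      congr 3
      simp only [inner_smul_left, inner_smul_right, inner_neg_left, conj_trivial]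
      ring
    rw [h1, transS_apply, pos_neg, mom_neg, hpos, hmom, hneg]
    have h2 : ee (N * (inner ℝ (-(a • cvec p)) y - inner ℝ (-(a • cvec p)) (-(a • cvec q)) / 2)) *
        ee (-(N * (a ^ 2 * inner ℝ (cvec p) (cvec q) / 2))) =
        ee (N * a * inner ℝ (-cvec p) (y + a • cvec q)) := by
      rw [← ee_add]; congr 1
      simp only [inner_smul_left, inner_smul_right, inner_neg_left, inner_neg_right, inner_add_right,
        conj_trivial]
      ring
    rw [← h2, sub_neg_eq_add]
    ring
  have hP2 : HasSum (fun p => pair (transS (hbar N) (a • intVec (e (q, p))) f) g *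
        transS (hbar N) (-(a • intVec (e (q, p)))) h y) _ := hP'.congr_fun hterm
  refine hP2.tsum_eq.trans ?_
  rw [mul_left_comm, ← tsum_mul_left]
  push_cast
  congr 1
  refine tsum_congr fun n => ?_
  rw [hFa, mul_assoc]
  congr 3
  abel

end

section

variable {d : ℕ}

/-- The rapid decay of the matrix coefficients beats the polynomial growth of the seminorms of the
translates. -/
theorem summable_seminorm_pair_transS {N : ℕ} (hN : 0 < N) {a : ℝ} (ha : 0 < a)
    (f g h : 𝓢(Conf d, ℂ)) (k n : ℕ) :
    Summable fun r : Fin d ⊕ Fin d → ℤ => SchwartzMap.seminorm ℂ k n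
      (pair (transS (hbar N) (a • intVec r) f) g • transS (hbar N) (-(a • intVec r)) h) := by
  obtain ⟨C, hC0, hC⟩ := exists_seminorm_transS_le (d := d) N k n
  set q := (Finset.Iic (k, n)).sup (schwartzSeminormFamily ℂ (Conf d) ℂ) h
  have hq : 0 ≤ q := apply_nonneg _ _
  have h1 : RapidDecay fun s : Phase d =>
      (1 + ‖s‖) ^ (k + n) * ‖pair (transS (hbar N) s f) g‖ := by
    intro M
    obtain ⟨D, hD⟩ := rapidDecay_pair_transS hN f g (M + (k + n))
    refine ⟨D, fun s => ?_⟩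
    rw [norm_mul, norm_norm, Real.norm_of_nonneg (by positivity), ← mul_assoc, ← pow_add]
    exact hD s
  have h2 := ((h1.comp_smul ha.ne').summable_intVec).mul_right (C * q)
  refine Summable.of_nonneg_of_le (fun _ => apply_nonneg _ _) (fun r => ?_) h2
  rw [map_smul_eq_mul]
  have h3 := hC (-(a • intVec r)) h
  rw [norm_neg] at h3
  calc _ ≤ ‖pair (transS (hbar N) (a • intVec r) f) g‖ *
        (C * (1 + ‖a • intVec r‖) ^ (k + n) * q) := by gcongr
    _ = _ := by
      rw [norm_mul, norm_norm, Real.norm_of_nonneg (by positivity : 0 ≤ (1 + ‖a • intVec r‖) ^ (k + n))]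
      ring

theorem hasSum_distribution (ψ : 𝓢'(Conf d, ℂ)) {I : Type*} (F : I → 𝓢(Conf d, ℂ))
    (hF : ∀ k n : ℕ, Summable fun i => SchwartzMap.seminorm ℂ k n (F i)) :
    HasSum (fun i => ψ (F i)) (ψ (schwartzTsum F hF)) :=
  (hasSum_schwartzTsum F hF).mapL ψ

theorem summable_pair_transS_distribution {N : ℕ} (hN : 0 < N) {a : ℝ} (ha : 0 < a)
    (ψ : 𝓢'(Conf d, ℂ)) (f g h : 𝓢(Conf d, ℂ)) :
    Summable fun r : Fin d ⊕ Fin d → ℤ =>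
      pair (transS (hbar N) (a • intVec r) f) g * ψ (transS (hbar N) (-(a • intVec r)) h) := by
  have := (hasSum_distribution ψ _ (summable_seminorm_pair_transS hN ha f g h)).summable
  simpa only [map_smul, smul_eq_mul] using this

/-- By `tsum_pair_transS_mul` with `a = 1` and with `a = N⁻¹`, both sides are sums of `h (y + q) f
(y + n/N) g (y + q + n/N)` over `q, n ∈ ℤ^d`. Exchanging the order of summation exchanges the two
lattices together with the roles of `f` and `h`. -/
theorem tsum_pair_transS_comm {N : ℕ} (hN : 0 < N) (f g h : 𝓢(Conf d, ℂ)) (y : Conf d) :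
    ∑' r : Fin d ⊕ Fin d → ℤ,
      pair (transS (hbar N) ((1 : ℝ) • intVec r) f) g *
        transS (hbar N) (-((1 : ℝ) • intVec r)) h y =
    ((N : ℂ) ^ d)⁻¹ * ∑' r : Fin d ⊕ Fin d → ℤ,
      pair (transS (hbar N) ((N : ℝ)⁻¹ • intVec r) h) g *
        transS (hbar N) (-((N : ℝ)⁻¹ • intVec r)) f y := by
  have hN0 : (0 : ℝ) < N := by exact_mod_cast hN
  rw [tsum_pair_transS_mul hN one_pos, tsum_pair_transS_mul hN (inv_pos.2 hN0)]
  simp only [mul_one, mul_inv_cancel₀ hN0.ne', Complex.ofReal_one, one_pow, inv_one, one_mul,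
    one_smul, Complex.ofReal_natCast]
  congr 1
  rw [Summable.tsum_comm]
  · refine tsum_congr fun q => tsum_congr fun n => ?_
    rw [show y + cvec n + (N : ℝ)⁻¹ • cvec q = y + (N : ℝ)⁻¹ • cvec q + cvec n by abel]
    ring
  · have h1 : Summable fun q : Fin d → ℤ => ‖h (y + cvec q)‖ := by
      simpa using summable_schwartz_lattice h y one_ne_zero
    have h2 := summable_schwartz_lattice f y (inv_ne_zero hN0.ne')
    have h3 := (h2.mul_of_nonneg h1 (fun _ => norm_nonneg _) (fun _ => norm_nonneg _)).mul_right
      (SchwartzMap.seminorm ℂ 0 0 g)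
    refine Summable.of_norm_bounded h3 fun p => ?_
    simp only [Function.uncurry]
    rw [norm_mul, norm_mul]
    have h4 := SchwartzMap.norm_le_seminorm ℂ g
    rw [mul_comm ‖f _‖]; gcongr; exact h4 _

/-- The duality between the matrix coefficients along the lattices `ℤ^{2d}` and `N⁻¹ ℤ^{2d}`. -/
theorem tsum_pair_transS_distribution {N : ℕ} (hN : 0 < N) (ψ : 𝓢'(Conf d, ℂ))
    (f g h : 𝓢(Conf d, ℂ)) :
    ∑' r : Fin d ⊕ Fin d → ℤ,
      pair (transS (hbar N) (intVec r) f) g * ψ (transS (hbar N) (-intVec r) h) =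
    ((N : ℂ) ^ d)⁻¹ * ∑' r : Fin d ⊕ Fin d → ℤ,
      pair (transS (hbar N) ((N : ℝ)⁻¹ • intVec r) h) g *
        ψ (transS (hbar N) (-((N : ℝ)⁻¹ • intVec r)) f) := by
  have hN0 : (0 : ℝ) < N := by exact_mod_cast hN
  have hs1 := summable_seminorm_pair_transS hN one_pos f g h
  have hs2 := summable_seminorm_pair_transS hN (inv_pos.2 hN0) h g f
  have heq : schwartzTsum _ hs1 = ((N : ℂ) ^ d)⁻¹ • schwartzTsum _ hs2 := by
    ext y
    exact tsum_pair_transS_comm hN f g h y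
  have h1 := (hasSum_distribution ψ _ hs1).tsum_eq
  have h2 := (hasSum_distribution ψ _ hs2).tsum_eq
  rw [heq, map_smul, ← h2] at h1
  simpa only [map_smul, smul_eq_mul, one_smul] using h1

/-! ### The phases of the quasi-periodicity conditions -/

/-- The reflection `(q, p) ↦ (-q, p)` of the lattice. -/
def flipZ (r : Fin d ⊕ Fin d → ℤ) : Fin d ⊕ Fin d → ℤ :=
  Sum.elim (fun j => -r (Sum.inl j)) (fun j => r (Sum.inr j))

@[simp] theorem flipZ_flipZ (r : Fin d ⊕ Fin d → ℤ) : flipZ (flipZ r) = r := by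
  ext (j | j) <;> simp [flipZ]

/-- The reflection `(x, ξ) ↦ (-x, ξ)` of phase space. -/
def flip (s : Phase d) : Phase d := mkPhase (-pos s) (mom s)

@[simp] theorem pos_flip (s : Phase d) : pos (flip s) = -pos s := pos_mkPhase _ _
@[simp] theorem mom_flip (s : Phase d) : mom (flip s) = mom s := mom_mkPhase _ _

@[simp] theorem flip_flip (s : Phase d) : flip (flip s) = s := phase_ext (by simp) (by simp)

theorem flip_neg (s : Phase d) : flip (-s) = -flip s :=
  phase_ext (by simp [pos_neg]) (by simp [mom_neg])

theorem flip_smul (c : ℝ) (s : Phase d) : flip (c • s) = c • flip s :=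
  phase_ext (by simp [pos_smul]) (by simp [mom_smul])

theorem flip_intVec (r : Fin d ⊕ Fin d → ℤ) : flip (intVec r) = intVec (flipZ r) := by
  ext (j | j) <;> simp [flip, flipZ, mkPhase, pos, mom, intVec]

theorem sigma_flip_flip (s t : Phase d) : sigma (flip s) (flip t) = -sigma s t := by
  simp [sigma_eq]; ring

theorem trans_apply (ħ : ℝ) (s : Phase d) (ψ : 𝓢'(Conf d, ℂ)) (φ : 𝓢(Conf d, ℂ)) :
    trans ħ s ψ φ = ψ (transS ħ (flip s) φ) := rfl

/-- The phase by which `U_ħ(r)`, acting on test functions, multiplies the states of `H_N(κ)`. -/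
def theta (N : ℕ) (κ : Phase d) (r : Fin d ⊕ Fin d → ℤ) : ℂ := quasiPhase (hbar N) κ (flipZ r)

/-- `U_ħ(r)` acts on distributions through the reflected vector, and the reflection permutes the
lattice; the conditions can therefore be tested directly on test functions. -/
theorem mem_torusSpace_iff {N : ℕ} {κ : Phase d} {ψ : 𝓢'(Conf d, ℂ)} :
    ψ ∈ torusSpace N κ ↔ ∀ (r : Fin d ⊕ Fin d → ℤ) (φ : 𝓢(Conf d, ℂ)),
      ψ (transS (hbar N) (intVec r) φ) = theta N κ r * ψ φ := by
  constructor
  · intro h r φ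
    have h1 := DFunLike.congr_fun (h (flipZ r)) φ
    rw [trans_apply] at h1
    change ψ (transS _ (flip (intVec (flipZ r))) φ) = _ * _ at h1
    rwa [flip_intVec, flipZ_flipZ] at h1
  · intro h r
    ext φ
    rw [trans_apply]
    change ψ (transS _ (flip (intVec r)) φ) = _ * _
    rw [flip_intVec, h, theta, flipZ_flipZ]
    rfl

theorem theta_eq {N : ℕ} (κ : Phase d) (r : Fin d ⊕ Fin d → ℤ) :
    theta N κ r = ee (-(N / 2 * inner ℝ (pos (intVec r)) (mom (intVec r)))) *
      ee ((2 * Real.pi)⁻¹ * (κ ⬝ᵥ intVec r)) := by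
  have hpi : (Real.pi : ℂ) ≠ 0 := by exact_mod_cast Real.pi_ne_zero
  rw [theta, quasiPhase]
  congr 1
  · have h1 : (∑ j, (flipZ r (Sum.inl j) : ℝ) * flipZ r (Sum.inr j)) =
      -inner ℝ (pos (intVec r)) (mom (intVec r)) := by
      simp [flipZ, PiLp.inner_apply, pos, mom, intVec, mul_comm]
    have h2 : (∑ j, (flipZ r (Sum.inl j) : ℝ) * flipZ r (Sum.inr j)) / (2 * hbar N) =
      (-inner ℝ (pos (intVec r)) (mom (intVec r)) / 2) / hbar N := by
      rw [h1, div_div]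
    rw [h2, exp_div_hbar]
    congr 1; ring
  · rw [ee]
    congr 1
    simp only [flipZ, Sum.elim_inl, Sum.elim_inr, dotProduct, Fintype.sum_sum_type, intVec]
    push_cast
    field_simp
    simp

theorem norm_theta {N : ℕ} (κ : Phase d) (r : Fin d ⊕ Fin d → ℤ) : ‖theta N κ r‖ = 1 := by
  rw [theta_eq, norm_mul, norm_ee, norm_ee, one_mul]

theorem theta_ne_zero {N : ℕ} (κ : Phase d) (r : Fin d ⊕ Fin d → ℤ) : theta N κ r ≠ 0 := by
  rw [← norm_ne_zero_iff, norm_theta]; exact one_ne_zero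

@[simp] theorem theta_zero {N : ℕ} (κ : Phase d) : theta N κ 0 = 1 := by simp [theta_eq]

/-- The quadratic phase contributes the symmetric form `N/2 (⟨q, p'⟩ + ⟨q', p⟩)`, which differs from
`N/2 σ` by the integer `N⟨q, p'⟩`, invisible to `ee`. Hence `theta` has the cocycle of the Weyl
relations on the lattice. -/
theorem theta_mul {N : ℕ} (κ : Phase d) (r s : Fin d ⊕ Fin d → ℤ) :
    theta N κ r * theta N κ s = ee (N / 2 * sigma (intVec r) (intVec s)) * theta N κ (r + s) := by
  have hk : ∃ k : ℤ, N * inner ℝ (pos (intVec r)) (mom (intVec s)) = (k : ℝ) := by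
    refine ⟨N * ∑ j, r (Sum.inl j) * s (Sum.inr j), ?_⟩
    simp [PiLp.inner_apply, pos, mom, intVec, mul_comm]
  obtain ⟨k, hk⟩ := hk
  have h1 : theta N κ r * theta N κ s = theta N κ r * theta N κ s * ee (-k : ℤ) := by
    rw [ee_intCast, mul_one]
  rw [h1, theta_eq, theta_eq, theta_eq]
  simp only [← ee_add]
  congr 1
  push_cast
  rw [← hk, sigma_eq, intVec_add, pos_add, mom_add, dotProduct_add]
  simp only [inner_add_left, inner_add_right]
  rw [real_inner_comm (pos (intVec s)) (mom (intVec r))]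
  ring

theorem theta_neg {N : ℕ} (κ : Phase d) (r : Fin d ⊕ Fin d → ℤ) :
    theta N κ (-r) = (theta N κ r)⁻¹ := by
  refine eq_inv_of_mul_eq_one_left ?_
  rw [theta_mul, intVec_neg, sigma_neg_left]
  simp

/-! ### Combs: the states obtained by quasi-periodization of Schwartz functions -/

theorem exists_tsum_norm_pair_transS_le {N : ℕ} (hN : 0 < N) (g : 𝓢(Conf d, ℂ)) :
    ∃ (s : Finset (ℕ × ℕ)) (C : ℝ), 0 ≤ C ∧ ∀ h : 𝓢(Conf d, ℂ),
      ∑' r : Fin d ⊕ Fin d → ℤ, ‖pair (transS (hbar N) (intVec r) h) g‖ ≤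
        C * s.sup (schwartzSeminormFamily ℂ (Conf d) ℂ) h := by
  set D := Fintype.card (Fin d ⊕ Fin d) + 1
  obtain ⟨q, hqc, hq⟩ := exists_pow_mul_norm_pair_transS_le hN D g
  obtain ⟨s, C, -, hC⟩ := Seminorm.bound_of_continuous (schwartz_withSeminorms ℂ (Conf d) ℂ) q hqc
  set S := ∑' n : Fin d ⊕ Fin d → ℤ, ((1 + ‖intVec n‖) ^ D)⁻¹
  have hS : 0 ≤ S := tsum_nonneg fun n => by positivity
  refine ⟨s, S * C, by positivity, fun h => ?_⟩
  have hsum := summable_inv_one_add_norm_intVec_pow (ι := Fin d ⊕ Fin d)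
  have hb : ∀ r : Fin d ⊕ Fin d → ℤ, ‖pair (transS (hbar N) (intVec r) h) g‖ ≤
      ((1 + ‖intVec r‖) ^ D)⁻¹ * q h := by
    intro r
    rw [inv_mul_eq_div, le_div_iff₀ (by positivity), mul_comm]
    exact hq _ h
  calc _ ≤ ∑' r : Fin d ⊕ Fin d → ℤ, ((1 + ‖intVec r‖) ^ D)⁻¹ * q h :=
        (Summable.of_nonneg_of_le (fun _ => norm_nonneg _) hb (hsum.mul_right _)).tsum_le_tsum hb
          (hsum.mul_right _)
    _ = S * q h := tsum_mul_right
    _ ≤ S * (C * s.sup (schwartzSeminormFamily ℂ (Conf d) ℂ) h) := by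
        gcongr; exact hC h
    _ = _ := by ring

theorem summable_norm_pair_transS {N : ℕ} (hN : 0 < N) (h g : 𝓢(Conf d, ℂ)) :
    Summable fun r : Fin d ⊕ Fin d → ℤ => ‖pair (transS (hbar N) (intVec r) h) g‖ :=
  (rapidDecay_pair_transS hN h g).summable_intVec

theorem summable_comb {N : ℕ} (hN : 0 < N) (κ : Phase d) (h g : 𝓢(Conf d, ℂ)) :
    Summable fun r : Fin d ⊕ Fin d → ℤ =>
      (theta N κ r)⁻¹ * pair (transS (hbar N) (intVec r) h) g := by
  refine Summable.of_norm ?_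
  simpa only [norm_mul, norm_inv, norm_theta, inv_one, one_mul] using
    summable_norm_pair_transS hN h g

/-- The state `h ↦ ∑_r θ(r)⁻¹ ∫ (U_ħ(r) h) g` of `H_N(κ)`. -/
def comb {N : ℕ} (hN : 0 < N) (κ : Phase d) (g : 𝓢(Conf d, ℂ)) : 𝓢'(Conf d, ℂ) :=
  ContinuousLinearMap.toPointwiseConvergenceCLM _ _ _ _ <|
    SchwartzMap.mkCLMtoNormedSpace (σ := RingHom.id ℂ)
      (fun h => ∑' r : Fin d ⊕ Fin d → ℤ, (theta N κ r)⁻¹ * pair (transS (hbar N) (intVec r) h) g)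
      (fun h h' => by
        rw [← (summable_comb hN κ h g).tsum_add (summable_comb hN κ h' g)]
        simp only [map_add, pair_add_left, mul_add])
      (fun c h => by
        rw [RingHom.id_apply, smul_eq_mul, ← tsum_mul_left]
        simp only [map_smul, pair_smul_left, mul_left_comm])
      (by
        obtain ⟨s, C, hC0, hC⟩ := exists_tsum_norm_pair_transS_le hN g
        refine ⟨s, C, hC0, fun h => le_trans ?_ (hC h)⟩
        refine (norm_tsum_le_tsum_norm (summable_comb hN κ h g).norm).trans (le_of_eq ?_)
        simp only [norm_mul, norm_inv, norm_theta, inv_one, one_mul])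

theorem comb_apply {N : ℕ} (hN : 0 < N) (κ : Phase d) (g h : 𝓢(Conf d, ℂ)) :
    comb hN κ g h =
      ∑' r : Fin d ⊕ Fin d → ℤ, (theta N κ r)⁻¹ * pair (transS (hbar N) (intVec r) h) g := rfl

/-- Translating `h` by `r₀` shifts the summation index, and the cocycle of `theta` cancels that of
the translations. -/
theorem comb_mem {N : ℕ} (hN : 0 < N) (κ : Phase d) (g : 𝓢(Conf d, ℂ)) :
    comb hN κ g ∈ torusSpace N κ := by
  rw [mem_torusSpace_iff]
  intro r₀ h
  rw [comb_apply, comb_apply, ← tsum_mul_left]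
  refine Eq.trans ?_ ((Equiv.addRight r₀).tsum_eq _)
  refine tsum_congr fun r => ?_
  rw [Equiv.coe_addRight, transS_transS, pair_smul_left, ← intVec_add, ← mul_assoc, ← mul_assoc]
  congr 1
  have h1 := theta_mul (N := N) κ r r₀
  have h2 := theta_ne_zero (N := N) κ r
  have h3 := theta_ne_zero (N := N) κ (r + r₀)
  field_simp
  rw [h1]; ring_nf

/-- The points `N⁻¹ s`, `s ∈ {0, …, N - 1}^{2d}`. -/
def fracVec (N : ℕ) (s : Fin d ⊕ Fin d → Fin N) : Phase d :=
  (N : ℝ)⁻¹ • intVec fun j => ((s j : ℕ) : ℤ)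

/-- Schur orthogonality for the Heisenberg translations, obtained from
`tsum_pair_transS_distribution`. On the `ℤ^{2d}` side quasi-periodicity lets `ψ h` factor out and
leaves a comb evaluated at `f`. On the `N⁻¹ ℤ^{2d}` side the sum splits into residues and integer
vectors, and the sum over integer vectors is again a comb. -/
theorem comb_mul_apply {N : ℕ} (hN : 0 < N) {κ : Phase d} {ψ : 𝓢'(Conf d, ℂ)}
    (hψ : ψ ∈ torusSpace N κ) (f g h : 𝓢(Conf d, ℂ)) :
    (N : ℂ) ^ d * (comb hN κ g f * ψ h) = ∑ s : Fin d ⊕ Fin d → Fin N,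
      ψ (transS (hbar N) (-fracVec N s) f) * comb hN κ g (transS (hbar N) (fracVec N s) h) := by
  have : NeZero N := ⟨hN.ne'⟩
  have hN0 : (N : ℝ) ≠ 0 := by exact_mod_cast hN.ne'
  rw [mem_torusSpace_iff] at hψ
  have h1 := tsum_pair_transS_distribution hN ψ f g h
  have h2 : ∀ r : Fin d ⊕ Fin d → ℤ,
      pair (transS (hbar N) (intVec r) f) g * ψ (transS (hbar N) (-intVec r) h) =
        ((theta N κ r)⁻¹ * pair (transS (hbar N) (intVec r) f) g) * ψ h := by
    intro r
    rw [← intVec_neg, hψ, theta_neg]; ring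
  simp only [h2] at h1
  rw [tsum_mul_right, ← comb_apply hN] at h1
  have hNd : (N : ℂ) ^ d ≠ 0 := pow_ne_zero _ (by exact_mod_cast hN.ne')
  rw [h1, mul_inv_cancel_left₀ hNd]
  -- Euclidean division by `N` in each coordinate.
  set e : (Fin d ⊕ Fin d → ℤ) ≃ (Fin d ⊕ Fin d → Fin N) × (Fin d ⊕ Fin d → ℤ) :=
    ((Equiv.arrowCongr (Equiv.refl _) (Int.divModEquiv N)).trans
      (Equiv.arrowProdEquivProdArrow _ _ _)).trans (Equiv.prodComm _ _)
  have he : ∀ s r, (N : ℝ)⁻¹ • intVec (e.symm (s, r)) = intVec r + fracVec N s := by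
    intro s r
    ext j
    simp [e, fracVec, intVec, Equiv.arrowProdEquivProdArrow, Int.divModEquiv]
    field_simp
  have hs := summable_pair_transS_distribution hN (a := (N : ℝ)⁻¹) (by positivity) ψ h g f
  have hs' := (e.symm.summable_iff).2 hs
  rw [← e.symm.tsum_eq]
  refine (Summable.tsum_prod hs').trans ?_
  rw [tsum_fintype]
  refine Finset.sum_congr rfl fun s _ => ?_
  rw [comb_apply, ← tsum_mul_left]
  refine tsum_congr fun r => ?_
  simp only [Function.comp]
  rw [he, transS_transS, pair_smul_left]
  obtain ⟨k, hk⟩ := exists_sigma_intVec_eq r fun j => ((s j : ℕ) : ℤ)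
  have h3 : N * sigma (intVec r) (fracVec N s) = k := by
    rw [fracVec, sigma_smul_right, hk, mul_inv_cancel_left₀ hN0]
  have h4 : ψ (transS (hbar N) (-(intVec r + fracVec N s)) f) =
      ee (-(N / 2 * sigma (intVec r) (fracVec N s))) * ((theta N κ r)⁻¹ *
        ψ (transS (hbar N) (-fracVec N s) f)) := by
    have h5 := transS_transS N (-intVec r) (-fracVec N s) f
    rw [sigma_neg_left, sigma_neg_right, neg_neg] at h5
    have h6 := congrArg ψ h5
    rw [map_smul, smul_eq_mul, ← intVec_neg, hψ, theta_neg, intVec_neg] at h6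
    rw [h6, ← mul_assoc, ← ee_add, neg_add_cancel, ee_zero, one_mul, neg_add]
  -- The symplectic product lies in `N⁻¹ ℤ`, so this phase is `±1` and equals its inverse.
  have h7 : ee (N / 2 * sigma (intVec r) (fracVec N s)) =
      ee (-(N / 2 * sigma (intVec r) (fracVec N s))) := by
    have h8 : N / 2 * sigma (intVec r) (fracVec N s) =
        -(N / 2 * sigma (intVec r) (fracVec N s)) + (k : ℤ) := by rw [← h3]; ring
    conv_lhs => rw [h8]
    rw [ee_add, ee_intCast, mul_one]
  rw [h4, h7]
  ring

end

/-! ### Combs exhaust the torus space; orthogonality relation and finite dimension -/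

section

variable {d : ℕ}

theorem pair_transS_left (N : ℕ) (u : Phase d) (f g : 𝓢(Conf d, ℂ)) :
    pair (transS (hbar N) u f) g = pair f (transS (hbar N) (flip u) g) := by
  rw [pair, pair, ← integral_add_right_eq_self _ (pos u)]
  congr 1; ext y
  rw [transS_apply, transS_apply, pos_flip, mom_flip, add_sub_cancel_right, sub_neg_eq_add,
    inner_add_right, inner_neg_right]
  rw [show N * (inner ℝ (mom u) y + inner ℝ (mom u) (pos u) - inner ℝ (mom u) (pos u) / 2) =
    N * (inner ℝ (mom u) y - -inner ℝ (mom u) (pos u) / 2) by ring]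
  ring

theorem transS_comm_of_intCast (N : ℕ) {s t : Phase d} {k : ℤ} (h : N * sigma s t = k)
    (u : 𝓢(Conf d, ℂ)) : transS (hbar N) s (transS (hbar N) t u) =
      transS (hbar N) t (transS (hbar N) s u) := by
  rw [transS_transS, transS_transS, add_comm t s]
  congr 1
  rw [show N / 2 * sigma s t = N / 2 * sigma t s + k by rw [← h, sigma_comm t s]; ring, ee_add,
    ee_intCast, mul_one]

theorem sigma_intVec_fracVec {N : ℕ} (hN : 0 < N) (r s : Fin d ⊕ Fin d → ℤ) :
    ∃ k : ℤ, N * sigma (intVec r) ((N : ℝ)⁻¹ • intVec s) = k := by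
  obtain ⟨k, hk⟩ := exists_sigma_intVec_eq r s
  have hN0 : (N : ℝ) ≠ 0 := by exact_mod_cast hN.ne'
  exact ⟨k, by rw [sigma_smul_right, hk, mul_inv_cancel_left₀ hN0]⟩

@[simp] theorem conjS_apply (f : 𝓢(Conf d, ℂ)) (y : Conf d) :
    conjS f y = (starRingEnd ℂ) (f y) := rfl

@[simp] theorem conjS_conjS (f : 𝓢(Conf d, ℂ)) : conjS (conjS f) = f := by ext y; simp

theorem conjS_smul (c : ℂ) (f : 𝓢(Conf d, ℂ)) :
    conjS (c • f) = (starRingEnd ℂ) c • conjS f := by ext y; simp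

theorem conjS_transS (N : ℕ) (u : Phase d) (f : 𝓢(Conf d, ℂ)) :
    conjS (transS (hbar N) u f) = transS (hbar N) (-flip u) (conjS f) := by
  ext y
  rw [conjS_apply, transS_apply, transS_apply, map_mul, conj_ee, conjS_apply, pos_neg, mom_neg,
    pos_flip, mom_flip, neg_neg]
  simp only [inner_neg_left]
  congr 2; ring

theorem conj_pair (f g : 𝓢(Conf d, ℂ)) :
    (starRingEnd ℂ) (pair f g) = pair (conjS f) (conjS g) := by
  rw [pair, pair, ← integral_conj]
  congr 1; ext y; simp

theorem pair_conjS_self (f : 𝓢(Conf d, ℂ)) : pair f (conjS f) = ((∫ y, ‖f y‖ ^ 2 : ℝ) : ℂ) := by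
  rw [pair, ← integral_complex_ofReal]
  congr 1; ext y
  rw [conjS_apply, Complex.mul_conj, Complex.normSq_eq_norm_sq]

theorem eq_zero_of_pair_conjS_self {f : 𝓢(Conf d, ℂ)} (h : pair f (conjS f) = 0) : f = 0 := by
  rw [pair_conjS_self, Complex.ofReal_eq_zero] at h
  have hc : Continuous fun y => ‖f y‖ ^ 2 := by fun_prop
  have hi : Integrable fun y => ‖f y‖ ^ 2 := by
    refine (integrable_mul_schwartz f (conjS f)).norm.congr (Filter.Eventually.of_forall fun y => ?_)
    simp [sq]
  have h0 := (integral_eq_zero_iff_of_nonneg (fun y => by positivity) hi).1 h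
  have h1 := hc.ae_eq_iff_eq volume (continuous_const (y := (0 : ℝ))) |>.1 h0
  ext y
  have := congrFun h1 y
  simpa using this

theorem exists_schwartz_ne_zero (d : ℕ) : ∃ f : 𝓢(Conf d, ℂ), f ≠ 0 := by
  let b : ContDiffBump (0 : Conf d) := ⟨1, 2, one_pos, one_lt_two⟩
  refine ⟨HasCompactSupport.toSchwartzMap (f := fun x => ((b x : ℝ) : ℂ))
    (b.hasCompactSupport.comp_left Complex.ofReal_zero)
    (Complex.ofRealCLM.contDiff.comp b.contDiff), fun h => ?_⟩
  have h1 := DFunLike.congr_fun h 0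
  have h2 : b 0 = 1 := b.one_of_mem_closedBall (by simp [b])
  change ((b 0 : ℝ) : ℂ) = 0 at h1
  rw [h2] at h1
  simp at h1

/-- Some comb is nonzero. -/
theorem exists_comb_apply_ne_zero {N : ℕ} (hN : 0 < N) (κ : Phase d) :
    ∃ f g : 𝓢(Conf d, ℂ), comb hN κ g f ≠ 0 := by
  by_contra! hcon
  have hN0 : (N : ℝ) ≠ 0 := by exact_mod_cast hN.ne'
  have key : ∀ f g : 𝓢(Conf d, ℂ), pair f g = 0 := by
    intro f g
    set c : (Fin d ⊕ Fin d → ℤ) → ℂ := fun r =>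
      (theta N κ r)⁻¹ * pair (transS (hbar N) (intVec r) f) g with hc
    have hcs : Summable fun r => ‖c r‖ := (summable_comb hN κ f g).norm
    -- Conjugation by `U_ħ(t)` multiplies the `r`-th term by a character of `r`, and every `x` is
    -- reached by some `t`. If all combs vanish, this absolutely convergent Fourier series is zero,
    -- and so is its constant coefficient `pair f g`.
    have h0 : ∀ x : Phase d, ∑' r, c r * ee (intVec r ⬝ᵥ x) = 0 := by
      intro x
      set t : Phase d := -((N : ℝ)⁻¹ • jmul x)
      have ht : ∀ r : Fin d ⊕ Fin d → ℤ, N * sigma (intVec r) t = intVec r ⬝ᵥ x := by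
        intro r
        rw [sigma_neg_right, sigma_smul_right, sigma_eq, pos_jmul, mom_jmul, dotProduct_eq_inner,
          inner_neg_right]
        field_simp
        ring
      rw [← hcon (transS (hbar N) t f) (transS (hbar N) (flip (-t)) g), comb_apply]
      refine tsum_congr fun r => ?_
      rw [← pair_transS_left, transS_transS, pair_smul_left, transS_transS, pair_smul_left,
        ← mul_assoc (ee _), ← ee_add, hc]
      rw [show N / 2 * sigma (-t) (intVec r) + N / 2 * sigma (-t + intVec r) t =
        intVec r ⬝ᵥ x by
          rw [← ht, sigma_add_left, sigma_neg_left t, sigma_neg_left t, sigma_self,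
            sigma_comm t (intVec r)]; ring]
      rw [show -t + intVec r + t = intVec r by abel]
      ring
    have h1 := integral_unitCube_tsum hcs
    simp only [h0, integral_zero] at h1
    simpa [hc] using h1.symm
  obtain ⟨f, hf⟩ := exists_schwartz_ne_zero d
  exact hf (eq_zero_of_pair_conjS_self (key _ _))

/-- Translations by `N⁻¹ ℤ^{2d}` commute with those by `ℤ^{2d}`, so they pass through the sum onto
`g`. -/
theorem comb_transS {N : ℕ} (hN : 0 < N) (κ : Phase d) (g h : 𝓢(Conf d, ℂ))
    (s : Fin d ⊕ Fin d → ℤ) :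
    comb hN κ g (transS (hbar N) ((N : ℝ)⁻¹ • intVec s) h) =
      comb hN κ (transS (hbar N) (flip ((N : ℝ)⁻¹ • intVec s)) g) h := by
  rw [comb_apply, comb_apply]
  refine tsum_congr fun r => ?_
  obtain ⟨k, hk⟩ := sigma_intVec_fracVec hN r s
  rw [transS_comm_of_intCast N hk, pair_transS_left N ((N : ℝ)⁻¹ • intVec s)]

theorem pair_sum_right {I : Type*} (S : Finset I) (f : 𝓢(Conf d, ℂ)) (g : I → 𝓢(Conf d, ℂ)) :
    pair f (∑ i ∈ S, g i) = ∑ i ∈ S, pair f (g i) := by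
  classical
  induction S using Finset.induction_on with
  | empty => simp [pair]
  | insert a S ha ih => rw [Finset.sum_insert ha, Finset.sum_insert ha, pair_add_right, ih]

theorem comb_sum_smul {N : ℕ} (hN : 0 < N) (κ : Phase d) {I : Type*} (S : Finset I) (c : I → ℂ)
    (g : I → 𝓢(Conf d, ℂ)) (h : 𝓢(Conf d, ℂ)) :
    comb hN κ (∑ i ∈ S, c i • g i) h = ∑ i ∈ S, c i * comb hN κ (g i) h := by
  simp only [comb_apply, pair_sum_right, pair_smul_right, Finset.mul_sum]
  rw [Summable.tsum_finsetSum]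
  · refine Finset.sum_congr rfl fun i _ => ?_
    rw [← tsum_mul_left]
    exact tsum_congr fun r => by ring
  · intro i _
    exact ((summable_comb hN κ h (g i)).mul_left (c i)).congr fun r => by ring

/-- Every state of `H_N(κ)` is a comb. -/
theorem exists_eq_comb {N : ℕ} (hN : 0 < N) {κ : Phase d} {ψ : 𝓢'(Conf d, ℂ)}
    (hψ : ψ ∈ torusSpace N κ) : ∃ g, ψ = comb hN κ g := by
  obtain ⟨f, g, hfg⟩ := exists_comb_apply_ne_zero hN κ
  have hNd : (N : ℂ) ^ d ≠ 0 := pow_ne_zero _ (by exact_mod_cast hN.ne')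
  -- The witness is `comb_mul_apply` divided by the nonzero number `N^d comb g f`, with the
  -- translations of `h` transferred to `g`.
  refine ⟨∑ s : Fin d ⊕ Fin d → Fin N,
    (((N : ℂ) ^ d * comb hN κ g f)⁻¹ * ψ (transS (hbar N) (-fracVec N s) f)) •
      transS (hbar N) (flip (fracVec N s)) g, ?_⟩
  ext h
  have h1 := comb_mul_apply hN hψ f g h
  rw [comb_sum_smul]
  simp only [fracVec] at h1 ⊢
  simp only [mul_assoc, ← comb_transS, ← Finset.mul_sum]
  rw [← h1]
  field_simp

/-- The resolution of identity in `H_N(κ)`. -/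
theorem apply_mul_apply_eq_sum {N : ℕ} (hN : 0 < N) {κ : Phase d} {a ψ : 𝓢'(Conf d, ℂ)}
    (ha : a ∈ torusSpace N κ) (hψ : ψ ∈ torusSpace N κ) (f h : 𝓢(Conf d, ℂ)) :
    (N : ℂ) ^ d * (a f * ψ h) = ∑ s : Fin d ⊕ Fin d → Fin N,
      ψ (transS (hbar N) (-fracVec N s) f) * a (transS (hbar N) (fracVec N s) h) := by
  obtain ⟨g, rfl⟩ := exists_eq_comb hN ha
  exact comb_mul_apply hN hψ f g h

theorem trans_mem {N : ℕ} (hN : 0 < N) {κ : Phase d} {ψ : 𝓢'(Conf d, ℂ)}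
    (hψ : ψ ∈ torusSpace N κ) (s : Fin d ⊕ Fin d → ℤ) :
    trans (hbar N) ((N : ℝ)⁻¹ • intVec s) ψ ∈ torusSpace N κ := by
  rw [mem_torusSpace_iff] at *
  intro r φ
  rw [trans_apply, trans_apply, flip_smul, flip_intVec]
  obtain ⟨k, hk⟩ := sigma_intVec_fracVec hN r (flipZ s)
  rw [← transS_comm_of_intCast N hk, hψ]

/-- Evaluation of the states at a test function. -/
def evalL (N : ℕ) (κ : Phase d) (h : 𝓢(Conf d, ℂ)) : torusSpace N κ →ₗ[ℂ] ℂ where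
  toFun ψ := (ψ : 𝓢'(Conf d, ℂ)) h
  map_add' _ _ := rfl
  map_smul' _ _ := rfl

theorem evalL_apply (N : ℕ) (κ : Phase d) (h : 𝓢(Conf d, ℂ)) (ψ : torusSpace N κ) :
    evalL N κ h ψ = (ψ : 𝓢'(Conf d, ℂ)) h := rfl

theorem torusSpace_ext {N : ℕ} {κ : Phase d} {ψ χ : torusSpace N κ}
    (h : ∀ f, evalL N κ f ψ = evalL N κ f χ) : ψ = χ :=
  Subtype.ext (DFunLike.ext _ _ h)

/-- The same formula spans every state by the `N^{2d}` combs of the translates of one fixed `g`. -/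
theorem finiteDimensional_torusSpace {N : ℕ} (hN : 0 < N) (κ : Phase d) :
    FiniteDimensional ℂ (torusSpace N κ) := by
  obtain ⟨f, g, hfg⟩ := exists_comb_apply_ne_zero hN κ
  have hNd : (N : ℂ) ^ d ≠ 0 := pow_ne_zero _ (by exact_mod_cast hN.ne')
  let v : (Fin d ⊕ Fin d → Fin N) → torusSpace N κ := fun s =>
    ⟨comb hN κ (transS (hbar N) (flip (fracVec N s)) g), comb_mem hN κ _⟩
  refine ⟨⟨(Set.finite_range v).toFinset, ?_⟩⟩
  rw [Set.Finite.coe_toFinset, eq_top_iff]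
  rintro ψ -
  rw [Submodule.mem_span_range_iff_exists_fun]
  refine ⟨fun s => ((N : ℂ) ^ d * comb hN κ g f)⁻¹ *
    (ψ : 𝓢'(Conf d, ℂ)) (transS (hbar N) (-fracVec N s) f), ?_⟩
  refine torusSpace_ext fun h => ?_
  have h1 := comb_mul_apply hN ψ.2 f g h
  simp only [map_sum, map_smul, smul_eq_mul]
  simp only [evalL_apply, v, fracVec] at h1 ⊢
  simp only [mul_assoc, ← comb_transS, ← Finset.mul_sum]
  rw [← h1]
  field_simp

end

/-! ### Shifts by `N⁻¹ ℤ^{2d}`, the Hilbert structure, unitarity of the propagator -/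

section

variable {d : ℕ}

theorem restrictH_apply {N : ℕ} {κ : Phase d} {T : 𝓢'(Conf d, ℂ) →ₗ[ℂ] 𝓢'(Conf d, ℂ)}
    (h : ∀ ψ ∈ torusSpace N κ, T ψ ∈ torusSpace N κ) (v : torusSpace N κ) :
    (restrictH N κ T v : 𝓢'(Conf d, ℂ)) = T v := by
  rw [restrictH, dif_pos h]; rfl

/-- The restriction of `U_ħ(s/N)` to `H_N(κ)`. -/
def shift (N : ℕ) (κ : Phase d) (s : Fin d ⊕ Fin d → ℤ) : torusSpace N κ →ₗ[ℂ] torusSpace N κ :=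
  restrictH N κ (trans (hbar N) ((N : ℝ)⁻¹ • intVec s))

theorem evalL_shift {N : ℕ} (hN : 0 < N) {κ : Phase d} (s : Fin d ⊕ Fin d → ℤ)
    (h : 𝓢(Conf d, ℂ)) (v : torusSpace N κ) :
    evalL N κ h (shift N κ s v) =
      evalL N κ (transS (hbar N) ((N : ℝ)⁻¹ • intVec (flipZ s)) h) v := by
  rw [evalL_apply, shift, restrictH_apply fun ψ hψ => trans_mem hN hψ s, trans_apply, flip_smul,
    flip_intVec]
  rfl

theorem flipZ_neg (s : Fin d ⊕ Fin d → ℤ) : flipZ (-s) = -flipZ s := by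
  ext (j | j) <;> simp [flipZ]

theorem flipZ_add (s t : Fin d ⊕ Fin d → ℤ) : flipZ (s + t) = flipZ s + flipZ t := by
  ext (j | j) <;> simp [flipZ]; ring

theorem shift_shift {N : ℕ} (hN : 0 < N) {κ : Phase d} (s t : Fin d ⊕ Fin d → ℤ)
    (v : torusSpace N κ) : shift N κ s (shift N κ t v) =
      ee ((2 * N : ℝ)⁻¹ * sigma (intVec s) (intVec t)) • shift N κ (s + t) v := by
  have hN0 : (N : ℝ) ≠ 0 := by exact_mod_cast hN.ne'
  refine torusSpace_ext fun h => ?_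
  rw [map_smul, evalL_shift hN, evalL_shift hN, evalL_shift hN, transS_transS, evalL_apply, map_smul,
    flipZ_add, intVec_add, smul_add, add_comm]
  congr 2
  rw [← flip_intVec, ← flip_intVec, sigma_smul_left, sigma_smul_right, sigma_flip_flip, sigma_comm]
  field_simp

theorem shift_zero {N : ℕ} (hN : 0 < N) {κ : Phase d} (v : torusSpace N κ) :
    shift N κ 0 v = v := by
  refine torusSpace_ext fun h => ?_
  rw [evalL_shift hN]
  have : flipZ (0 : Fin d ⊕ Fin d → ℤ) = 0 := by ext (j | j) <;> simp [flipZ]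
  rw [this]; simp

theorem shift_neg_shift {N : ℕ} (hN : 0 < N) {κ : Phase d} (s : Fin d ⊕ Fin d → ℤ)
    (v : torusSpace N κ) : shift N κ (-s) (shift N κ s v) = v := by
  rw [shift_shift hN, intVec_neg, sigma_neg_left, sigma_self]
  simp [shift_zero hN]

namespace TorusHilbert

variable {N : ℕ} {κ : Phase d} (H : TorusHilbert N κ)

/-- `H_N(κ)` as an inner product space. -/
def Space (_ : TorusHilbert N κ) : Type := torusSpace N κ

instance : NormedAddCommGroup H.Space :=
  @InnerProductSpace.Core.toNormedAddCommGroup ℂ (torusSpace N κ) _ _ _ H.core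

instance : InnerProductSpace ℂ H.Space :=
  @InnerProductSpace.ofCore ℂ (torusSpace N κ) _ _ _ H.core.toCore

instance : Inner ℂ H.Space := InnerProductSpace.toInner

/-- The identification of `H_N(κ)` with the inner product space `H.Space`. -/
def toS : torusSpace N κ ≃ₗ[ℂ] H.Space where
  toFun v := v
  invFun v := v
  map_add' _ _ := rfl
  map_smul' _ _ := rfl

/-- The inner product of `H_N(κ)`. -/
def ip (v w : torusSpace N κ) : ℂ := H.core.inner v w

theorem inner_toS (v w : torusSpace N κ) : inner ℂ (H.toS v) (H.toS w) = H.ip v w := rfl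

theorem norm_toS (v : torusSpace N κ) : ‖H.toS v‖ = H.norm v := rfl

theorem ip_smul_right (c : ℂ) (v w : torusSpace N κ) : H.ip v (c • w) = c * H.ip v w := by
  rw [← inner_toS, map_smul, inner_smul_right, inner_toS]

theorem ip_sum_right {I : Type*} (S : Finset I) (v : torusSpace N κ) (w : I → torusSpace N κ) :
    H.ip v (∑ i ∈ S, w i) = ∑ i ∈ S, H.ip v (w i) := by
  simp only [← inner_toS, map_sum, inner_sum]

theorem conj_ip (v w : torusSpace N κ) : (starRingEnd ℂ) (H.ip v w) = H.ip w v := by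
  rw [← inner_toS, inner_conj_symm, inner_toS]

theorem ip_zero_left (w : torusSpace N κ) : H.ip 0 w = 0 := by
  rw [← inner_toS, map_zero, inner_zero_left]

theorem ip_self_ne_zero {v : torusSpace N κ} (h : v ≠ 0) : H.ip v v ≠ 0 := by
  rw [← inner_toS, inner_self_ne_zero]
  simpa using h

theorem finiteDimensional (hN : 0 < N) : FiniteDimensional ℂ H.Space := by
  have := finiteDimensional_torusSpace hN κ
  exact Module.Finite.equiv H.toS

theorem ip_shift (s : Fin d ⊕ Fin d → ℤ) (v w : torusSpace N κ) :
    H.ip (shift N κ s v) (shift N κ s w) = H.ip v w :=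
  H.unitary s v w

theorem exists_riesz (hN : 0 < N) (g : 𝓢(Conf d, ℂ)) :
    ∃ t : torusSpace N κ, ∀ v, H.ip t v = evalL N κ g v := by
  have := H.finiteDimensional hN
  have : CompleteSpace H.Space := FiniteDimensional.complete ℂ _
  let L : H.Space →ₗ[ℂ] ℂ := evalL N κ g ∘ₗ H.toS.symm.toLinearMap
  refine ⟨H.toS.symm ((InnerProductSpace.toDual ℂ H.Space).symm (LinearMap.toContinuousLinearMap L)),
    fun v => ?_⟩
  rw [← inner_toS, LinearEquiv.apply_symm_apply, InnerProductSpace.toDual_symm_apply]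
  rfl

/-- The vector representing the evaluation at `g`. -/
def riesz (hN : 0 < N) (g : 𝓢(Conf d, ℂ)) : torusSpace N κ := (H.exists_riesz hN g).choose

theorem ip_riesz (hN : 0 < N) (g : 𝓢(Conf d, ℂ)) (v : torusSpace N κ) :
    H.ip (H.riesz hN g) v = evalL N κ g v := (H.exists_riesz hN g).choose_spec v

/-- The orthogonality relation with the Riesz vector of `g` as one of the states is an identity
between vectors. Pairing it with `χ` and moving the shifts onto `χ` by unitarity turns the Riesz
vector into evaluations. The inner product is thus determined, up to a scalar, by the values of
states on test functions. -/
theorem evalL_riesz_mul_ip (hN : 0 < N) (f g : 𝓢(Conf d, ℂ)) (χ ψ : torusSpace N κ) :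
    (N : ℂ) ^ d * (evalL N κ f (H.riesz hN g) * H.ip χ ψ) = ∑ s : Fin d ⊕ Fin d → Fin N,
      evalL N κ (transS (hbar N) (-fracVec N s) f) ψ *
        (starRingEnd ℂ) (evalL N κ (transS (hbar N) (-fracVec N s) g) χ) := by
  have h1 : ((N : ℂ) ^ d * evalL N κ f (H.riesz hN g)) • ψ =
      ∑ s : Fin d ⊕ Fin d → Fin N, evalL N κ (transS (hbar N) (-fracVec N s) f) ψ •
        shift N κ (flipZ fun j => ((s j : ℕ) : ℤ)) (H.riesz hN g) := by
    refine torusSpace_ext fun h => ?_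
    simp only [map_smul, map_sum, smul_eq_mul, evalL_shift hN, flipZ_flipZ, mul_assoc]
    exact apply_mul_apply_eq_sum hN (H.riesz hN g).2 ψ.2 f h
  have h2 := congrArg (fun w => H.ip χ w) h1
  simp only [ip_smul_right, ip_sum_right] at h2
  rw [← mul_assoc, h2]
  refine Finset.sum_congr rfl fun s _ => ?_
  congr 1
  rw [← H.ip_shift (-flipZ fun j => ((s j : ℕ) : ℤ)) χ, shift_neg_shift hN, ← conj_ip, ip_riesz,
    evalL_shift hN, flipZ_neg, flipZ_flipZ, intVec_neg, smul_neg, fracVec]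

end TorusHilbert

/-- Hermitian symmetry of the form sending `(h, k)` to the comb of `conjS k` at `h`; the
substitution `r ↦ -r` accounts for the conjugated phases. -/
theorem conj_comb {N : ℕ} (hN : 0 < N) (κ : Phase d) (k h : 𝓢(Conf d, ℂ)) :
    (starRingEnd ℂ) (comb hN κ k h) = comb hN κ (conjS h) (conjS k) := by
  rw [comb_apply, comb_apply, Complex.conj_tsum, ← (Equiv.neg _).tsum_eq]
  refine tsum_congr fun r => ?_
  rw [Equiv.neg_apply, map_mul, theta_neg, inv_inv, conj_pair, conjS_transS, intVec_neg, flip_neg,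
    neg_neg, pair_transS_left, flip_flip, pair_comm, ← Complex.inv_eq_conj (norm_theta κ r)]

namespace TorusHilbert

variable {N : ℕ} {κ : Phase d} (H : TorusHilbert N κ)

/-- For a comb `χ`, the sum in `evalL_riesz_mul_ip` is the one in `comb_mul_apply`. It follows that
the Riesz kernel is a constant multiple of the comb kernel. -/
theorem evalL_riesz_mul_ip_comb (hN : 0 < N) (f g k : 𝓢(Conf d, ℂ)) (ψ : torusSpace N κ) :
    evalL N κ f (H.riesz hN g) * H.ip ⟨comb hN κ k, comb_mem hN κ k⟩ ψ =
      comb hN κ (conjS g) f * evalL N κ (conjS k) ψ := by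
  have hNd : (N : ℂ) ^ d ≠ 0 := pow_ne_zero _ (by exact_mod_cast hN.ne')
  refine mul_left_cancel₀ hNd ?_
  rw [evalL_riesz_mul_ip]
  refine Eq.trans (Finset.sum_congr rfl fun s _ => ?_)
    (comb_mul_apply hN ψ.2 f (conjS g) (conjS k)).symm
  congr 1
  rw [evalL_apply, conj_comb, conjS_transS, flip_neg, neg_neg, fracVec, ← comb_transS]

end TorusHilbert

/-! ### The propagator -/

/-- Polarization of the isometry property, with the coefficients `1` and `i`. -/
theorem pair_conjS_propagator {A : Matrix.symplecticGroup (Fin d) ℤ} {ħ : ℝ}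
    {M : 𝓢(Conf d, ℂ) ≃L[ℂ] 𝓢(Conf d, ℂ)} (hM : IsQuantumPropagator ħ A M) (f g : 𝓢(Conf d, ℂ)) :
    pair (M f) (conjS (M g)) = pair f (conjS g) := by
  have h0 : ∀ u, pair (M u) (conjS (M u)) = pair u (conjS u) := fun u => by
    rw [pair_conjS_self, pair_conjS_self, hM.isometry]
  have h1 : ∀ c : ℂ, c * pair (M g) (conjS (M f)) + (starRingEnd ℂ) c * pair (M f) (conjS (M g)) =
      c * pair g (conjS f) + (starRingEnd ℂ) c * pair f (conjS g) := by
    intro c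
    have h2 := h0 (f + c • g)
    simp only [map_add, map_smul, conjS_smul, pair_add_left, pair_add_right, pair_smul_left,
      pair_smul_right, h0] at h2
    linear_combination h2
  have h2 := h1 1
  have h3 := h1 Complex.I
  simp only [map_one, Complex.conj_I] at h2 h3
  linear_combination (1 / 2 : ℂ) * h2 + (Complex.I / 2) * h3 +
    (1 / 2 : ℂ) * (pair (M f) (conjS (M g)) - pair f (conjS g) - pair (M g) (conjS (M f)) +
      pair g (conjS f)) * Complex.I_mul_I

theorem transposeS_apply (M : 𝓢(Conf d, ℂ) ≃L[ℂ] 𝓢(Conf d, ℂ)) (φ : 𝓢(Conf d, ℂ)) :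
    transposeS M φ = conjS (M.symm (conjS φ)) := rfl

theorem pair_transposeS {A : Matrix.symplecticGroup (Fin d) ℤ} {ħ : ℝ}
    {M : 𝓢(Conf d, ℂ) ≃L[ℂ] 𝓢(Conf d, ℂ)} (hM : IsQuantumPropagator ħ A M) (f k : 𝓢(Conf d, ℂ)) :
    pair (transposeS M f) k = pair f (M k) := by
  have h := pair_conjS_propagator hM k (M.symm (conjS f))
  rw [M.apply_symm_apply, conjS_conjS] at h
  rw [transposeS_apply, pair_comm, ← h, pair_comm]

theorem intVec_mulVec (A : Matrix.symplecticGroup (Fin d) ℤ) (r : Fin d ⊕ Fin d → ℤ) :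
    toReal A *ᵥ intVec r = intVec ((A : Matrix (Fin d ⊕ Fin d) (Fin d ⊕ Fin d) ℤ) *ᵥ r) := by
  ext j; simp [toReal, Matrix.mulVec, dotProduct, intVec]

theorem coe_mul_coe_inv (A : Matrix.symplecticGroup (Fin d) ℤ) :
    (A : Matrix (Fin d ⊕ Fin d) (Fin d ⊕ Fin d) ℤ) *
      ((A⁻¹ : Matrix.symplecticGroup (Fin d) ℤ) : Matrix (Fin d ⊕ Fin d) (Fin d ⊕ Fin d) ℤ) = 1 := by
  rw [← Submonoid.coe_mul, mul_inv_cancel, Submonoid.coe_one]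

/-- The automorphism of the lattice given by `A`. -/
def latticeEquiv (A : Matrix.symplecticGroup (Fin d) ℤ) :
    (Fin d ⊕ Fin d → ℤ) ≃+ (Fin d ⊕ Fin d → ℤ) where
  toFun r := (A : Matrix (Fin d ⊕ Fin d) (Fin d ⊕ Fin d) ℤ) *ᵥ r
  invFun r := ((A⁻¹ : Matrix.symplecticGroup (Fin d) ℤ) : Matrix (Fin d ⊕ Fin d) (Fin d ⊕ Fin d) ℤ) *ᵥ r
  left_inv r := by
    have h := coe_mul_coe_inv A⁻¹
    rw [inv_inv] at h
    simp only [Matrix.mulVec_mulVec, h, Matrix.one_mulVec]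
  right_inv r := by simp only [Matrix.mulVec_mulVec, coe_mul_coe_inv, Matrix.one_mulVec]
  map_add' := Matrix.mulVec_add _

/-- `flipZ` as an automorphism. -/
def flipEquiv (d : ℕ) : (Fin d ⊕ Fin d → ℤ) ≃+ (Fin d ⊕ Fin d → ℤ) where
  toFun := flipZ
  invFun := flipZ
  left_inv := flipZ_flipZ
  right_inv := flipZ_flipZ
  map_add' := flipZ_add

/-- The automorphism of the lattice by which `transposeS M` acts on the translations. -/
def transposeEquiv (A : Matrix.symplecticGroup (Fin d) ℤ) :
    (Fin d ⊕ Fin d → ℤ) ≃+ (Fin d ⊕ Fin d → ℤ) :=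
  ((flipEquiv d).trans (latticeEquiv A).symm).trans (flipEquiv d)

/-- Each `conjS` turns `s` into `-flip s` and `M.symm` contributes `A⁻¹`; the two minus signs
cancel, leaving `flip A⁻¹ flip`. -/
theorem transposeS_transS {A : Matrix.symplecticGroup (Fin d) ℤ} {N : ℕ}
    {M : 𝓢(Conf d, ℂ) ≃L[ℂ] 𝓢(Conf d, ℂ)} (hM : IsQuantumPropagator (hbar N) A M) (c : ℝ)
    (r : Fin d ⊕ Fin d → ℤ) (φ : 𝓢(Conf d, ℂ)) :
    transposeS M (transS (hbar N) (c • intVec r) φ) =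
      transS (hbar N) (c • intVec (transposeEquiv A r)) (transposeS M φ) := by
  have h1 : ∀ (s : Fin d ⊕ Fin d → ℤ) (u : 𝓢(Conf d, ℂ)), M.symm (transS (hbar N) (c • intVec s) u) =
      transS (hbar N) (c • intVec ((latticeEquiv A).symm s)) (M.symm u) := by
    intro s u
    rw [ContinuousLinearEquiv.symm_apply_eq, hM.intertwine, M.apply_symm_apply, Matrix.mulVec_smul,
      intVec_mulVec]
    congr 4
    exact ((latticeEquiv A).apply_symm_apply s).symm
  rw [transposeS_apply, conjS_transS, flip_smul, flip_intVec, ← smul_neg, ← intVec_neg, h1,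
    conjS_transS, flip_smul, flip_intVec, transposeS_apply, ← smul_neg, ← intVec_neg]
  congr 3
  rw [map_neg, flipZ_neg, neg_neg]
  rfl

/-- Sums over the residues modulo `N` are invariant under automorphisms of the lattice. -/
theorem sum_residues_comp {ι : Type*} [Fintype ι] [DecidableEq ι] {N : ℕ} (hN : 0 < N) (e : (ι → ℤ) ≃+ (ι → ℤ))
    (F : (ι → ℤ) → ℂ) (hF : ∀ s r, F (s + N • r) = F s) :
    ∑ s : ι → Fin N, F (e fun j => ((s j : ℕ) : ℤ)) =
      ∑ s : ι → Fin N, F fun j => ((s j : ℕ) : ℤ) := by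
  have : NeZero N := ⟨hN.ne'⟩
  have hNz : (0 : ℤ) < N := by exact_mod_cast hN
  let lift : (ι → Fin N) → ι → ℤ := fun s j => ((s j : ℕ) : ℤ)
  let red : (ι → ℤ) → ι → Fin N := fun v j => ⟨(v j % N).toNat, by
    have h1 := Int.emod_nonneg (v j) hNz.ne'
    have h2 := Int.emod_lt_of_pos (v j) hNz
    omega⟩
  have hred : ∀ v, v = lift (red v) + N • fun j => v j / N := by
    intro v; ext j
    have h1 := Int.emod_nonneg (v j) hNz.ne'
    simp only [lift, red, Pi.add_apply, nsmul_eq_mul, Int.toNat_of_nonneg h1]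
    exact (Int.emod_add_mul_ediv (v j) N).symm
  have hinj : ∀ (s t : ι → Fin N) (w : ι → ℤ), lift s = lift t + N • w → s = t := by
    intro s t w h
    ext j
    have h1 := congrFun h j
    simp only [lift, Pi.add_apply, nsmul_eq_mul] at h1
    change _ = _ + (N : ℤ) * w j at h1
    have h2 := (s j).2
    have h3 := (t j).2
    have h4 : w j = 0 := by
      by_contra h5
      rcases lt_or_gt_of_ne h5 with h6 | h6 <;> nlinarith
    rw [h4] at h1
    simp at h1
    omega
  -- The map induced on residues is injective because `e.symm` also preserves multiples of `N`;
  -- finiteness does the rest.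
  have hbij : Function.Bijective fun s => red (e (lift s)) := by
    refine Finite.injective_iff_bijective.1 fun s t hst => ?_
    have h1 := hred (e (lift s))
    have h2 := hred (e (lift t))
    rw [show red (e (lift s)) = red (e (lift t)) from hst] at h1
    have h3 : e (lift s) = e (lift t) + N • ((fun j => e (lift s) j / N) - fun j => e (lift t) j / N) := by
      rw [smul_sub]
      generalize (N • fun j => e (lift s) j / (N : ℤ)) = a at h1 ⊢
      generalize (N • fun j => e (lift t) j / (N : ℤ)) = b at h2 ⊢
      generalize lift (red (e (lift t))) = c at h1 h2
      rw [h1, h2]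
      abel
    have h4 := congrArg e.symm h3
    rw [map_add, map_nsmul, e.symm_apply_apply, e.symm_apply_apply] at h4
    exact hinj _ _ _ h4
  refine Fintype.sum_bijective _ hbij _ _ fun s => ?_
  conv_lhs => rw [hred (e fun j => ((s j : ℕ) : ℤ)), hF]

theorem propagator_apply (M : 𝓢(Conf d, ℂ) ≃L[ℂ] 𝓢(Conf d, ℂ)) (ψ : 𝓢'(Conf d, ℂ))
    (φ : 𝓢(Conf d, ℂ)) : propagator M ψ φ = ψ (transposeS M φ) := rfl

theorem transposeS_surjective (M : 𝓢(Conf d, ℂ) ≃L[ℂ] 𝓢(Conf d, ℂ)) :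
    Function.Surjective (transposeS M) := fun φ =>
  ⟨conjS (M (conjS φ)), by rw [transposeS_apply]; simp⟩

theorem evalL_opM {N : ℕ} {κ : Phase d} {M : 𝓢(Conf d, ℂ) ≃L[ℂ] 𝓢(Conf d, ℂ)}
    (hMκ : (torusSpace N κ).map (propagator M) = torusSpace N κ) (φ : 𝓢(Conf d, ℂ))
    (v : torusSpace N κ) : evalL N κ φ (opM N κ M v) = evalL N κ (transposeS M φ) v := by
  rw [evalL_apply, opM, restrictH_apply fun ψ hψ => hMκ ▸ Submodule.mem_map_of_mem hψ]
  rfl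

/-- Invariance of the space under the propagator forces invariance of its phases: a comb and its
image obey the same quasi-periodicity, and the two are compared at a test function where the value
is nonzero. -/
theorem theta_transposeEquiv {A : Matrix.symplecticGroup (Fin d) ℤ} {N : ℕ} (hN : 0 < N) {κ : Phase d}
    {M : 𝓢(Conf d, ℂ) ≃L[ℂ] 𝓢(Conf d, ℂ)} (hM : IsQuantumPropagator (hbar N) A M)
    (hMκ : (torusSpace N κ).map (propagator M) = torusSpace N κ) (r : Fin d ⊕ Fin d → ℤ) :
    theta N κ (transposeEquiv A r) = theta N κ r := by
  obtain ⟨f, g, hfg⟩ := exists_comb_apply_ne_zero hN κ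
  have h1 := comb_mem hN κ g
  have h2 : propagator M (comb hN κ g) ∈ torusSpace N κ := hMκ ▸ Submodule.mem_map_of_mem h1
  obtain ⟨φ, rfl⟩ := transposeS_surjective M f
  rw [mem_torusSpace_iff] at h1 h2
  have h3 := h2 r φ
  have h4 := transposeS_transS hM 1 r φ
  rw [one_smul, one_smul] at h4
  rw [propagator_apply, propagator_apply, h4, h1] at h3
  exact mul_right_cancel₀ hfg h3

/-- Reindexing the lattice by the automorphism: the phases are invariant by `theta_transposeEquiv`,
and the pairings by unitarity on `ℝ^d`. -/
theorem comb_transposeS {A : Matrix.symplecticGroup (Fin d) ℤ} {N : ℕ} (hN : 0 < N) {κ : Phase d}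
    {M : 𝓢(Conf d, ℂ) ≃L[ℂ] 𝓢(Conf d, ℂ)} (hM : IsQuantumPropagator (hbar N) A M)
    (hMκ : (torusSpace N κ).map (propagator M) = torusSpace N κ) (f g : 𝓢(Conf d, ℂ)) :
    comb hN κ (conjS (transposeS M g)) (transposeS M f) = comb hN κ (conjS g) f := by
  rw [comb_apply, comb_apply, ← (transposeEquiv A).toEquiv.tsum_eq]
  refine tsum_congr fun r => ?_
  have h4 := transposeS_transS hM 1 r f
  rw [one_smul, one_smul] at h4
  rw [AddEquiv.toEquiv_eq_coe, AddEquiv.coe_toEquiv, theta_transposeEquiv hN hM hMκ, ← h4,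
    transposeS_apply M g, conjS_conjS, pair_transposeS hM, M.apply_symm_apply]

/-- The phase depends neither on `f` nor on `ψ`, so it cancels in a value times a conjugate value,
and such products are functions of the residue modulo `N`. -/
theorem evalL_transS_neg_add {N : ℕ} (hN : 0 < N) {κ : Phase d} (s r : Fin d ⊕ Fin d → ℤ) :
    ∃ u : ℂ, ‖u‖ = 1 ∧ ∀ (f : 𝓢(Conf d, ℂ)) (ψ : torusSpace N κ),
      evalL N κ (transS (hbar N) (-((N : ℝ)⁻¹ • intVec (s + N • r))) f) ψ =
        u * evalL N κ (transS (hbar N) (-((N : ℝ)⁻¹ • intVec s)) f) ψ := by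
  have hN0 : (N : ℝ) ≠ 0 := by exact_mod_cast hN.ne'
  refine ⟨ee (-(N / 2 * sigma (intVec (-r)) (-((N : ℝ)⁻¹ • intVec s)))) * theta N κ (-r),
    by rw [norm_mul, norm_ee, norm_theta, one_mul], fun f ψ => ?_⟩
  have h1 : -((N : ℝ)⁻¹ • intVec (s + N • r)) = intVec (-r) + -((N : ℝ)⁻¹ • intVec s) := by
    ext j
    simp [intVec]
    field_simp
    ring
  have h2 := transS_transS N (intVec (-r)) (-((N : ℝ)⁻¹ • intVec s)) f
  have h3 := congrArg (ψ : 𝓢'(Conf d, ℂ)) h2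
  rw [mem_torusSpace_iff.1 ψ.2, map_smul, smul_eq_mul] at h3
  rw [h1, evalL_apply, evalL_apply, mul_assoc, h3, ← mul_assoc, ← ee_add, neg_add_cancel, ee_zero,
    one_mul]

namespace TorusHilbert

variable {N : ℕ} {κ : Phase d} (H : TorusHilbert N κ)

/-- The quantum propagator is unitary on `H_N(κ)`. -/
theorem ip_opM {A : Matrix.symplecticGroup (Fin d) ℤ} (hN : 0 < N)
    {M : 𝓢(Conf d, ℂ) ≃L[ℂ] 𝓢(Conf d, ℂ)} (hM : IsQuantumPropagator (hbar N) A M)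
    (hMκ : (torusSpace N κ).map (propagator M) = torusSpace N κ) (χ ψ : torusSpace N κ) :
    H.ip (opM N κ M χ) (opM N κ M ψ) = H.ip χ ψ := by
  have hNd : (N : ℂ) ^ d ≠ 0 := pow_ne_zero _ (by exact_mod_cast hN.ne')
  -- Inserting the propagator in `evalL_riesz_mul_ip` replaces `f` and `g` by their transposed
  -- images and permutes the residues, so the sum keeps its form.
  have h1 : ∀ f g : 𝓢(Conf d, ℂ), evalL N κ f (H.riesz hN g) *
      H.ip (opM N κ M χ) (opM N κ M ψ) =
      evalL N κ (transposeS M f) (H.riesz hN (transposeS M g)) * H.ip χ ψ := by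
    intro f g
    refine mul_left_cancel₀ hNd ?_
    rw [evalL_riesz_mul_ip, evalL_riesz_mul_ip]
    set F : (Fin d ⊕ Fin d → ℤ) → ℂ := fun s =>
      evalL N κ (transS (hbar N) (-((N : ℝ)⁻¹ • intVec s)) (transposeS M f)) ψ *
        (starRingEnd ℂ) (evalL N κ (transS (hbar N) (-((N : ℝ)⁻¹ • intVec s)) (transposeS M g)) χ)
    have hF : ∀ s r, F (s + N • r) = F s := by
      intro s r
      obtain ⟨u, hu, h⟩ := evalL_transS_neg_add hN (κ := κ) s r
      simp only [F, h, map_mul]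
      have hu2 : u * (starRingEnd ℂ) u = 1 := by
        rw [Complex.mul_conj, Complex.normSq_eq_norm_sq, hu]; simp
      linear_combination (evalL N κ (transS (hbar N) (-((N : ℝ)⁻¹ • intVec s)) (transposeS M f)) ψ *
        (starRingEnd ℂ) (evalL N κ (transS (hbar N) (-((N : ℝ)⁻¹ • intVec s)) (transposeS M g)) χ))
        * hu2
    refine Eq.trans ?_ (sum_residues_comp hN (transposeEquiv A) F hF)
    refine Finset.sum_congr rfl fun s _ => ?_
    have h2 : ∀ f, transposeS M (transS (hbar N) (-fracVec N s) f) =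
        transS (hbar N) (-((N : ℝ)⁻¹ • intVec (transposeEquiv A fun j => ((s j : ℕ) : ℤ))))
          (transposeS M f) := by
      intro f
      rw [fracVec, ← neg_smul, transposeS_transS hM, neg_smul]
    rw [evalL_opM hMκ, evalL_opM hMκ, h2, h2]
  obtain ⟨f₀, k, hk⟩ := exists_comb_apply_ne_zero hN κ
  set a : torusSpace N κ := ⟨comb hN κ k, comb_mem hN κ k⟩
  have ha : H.ip a a ≠ 0 := by
    refine H.ip_self_ne_zero fun h => hk ?_
    have := congrArg (evalL N κ f₀) h
    rwa [map_zero] at this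
  -- The Riesz kernel is proportional to the comb kernel, whose invariance is `comb_transposeS`.
  -- This excludes a scaling factor in the isometry.
  have h2 : ∀ f g : 𝓢(Conf d, ℂ), evalL N κ (transposeS M f) (H.riesz hN (transposeS M g)) =
      evalL N κ f (H.riesz hN g) := by
    intro f g
    refine mul_right_cancel₀ ha ?_
    have h3 := H.evalL_riesz_mul_ip_comb hN f g k a
    have h4 := H.evalL_riesz_mul_ip_comb hN (transposeS M f) (transposeS M g) k a
    rw [comb_transposeS hN hM hMκ] at h4
    exact h4.trans h3.symm
  have h3 : ∃ f g, evalL N κ f (H.riesz hN g) ≠ 0 := by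
    by_contra! h
    refine hk ?_
    have h5 : H.riesz hN f₀ = 0 := torusSpace_ext fun f => (h f f₀).trans (map_zero _).symm
    have h6 := H.ip_riesz hN f₀ a
    rw [h5, ip_zero_left] at h6
    exact h6.symm
  obtain ⟨f, g, hfg⟩ := h3
  have h4 := h1 f g
  rw [h2] at h4
  exact mul_left_cancel₀ hfg h4

end TorusHilbert

end

/-! ### Weyl quantization of Fourier series -/

section

variable {d : ℕ}

theorem fourier_schwartz_apply (u : 𝓢(Conf d, ℂ)) (η : Conf d) :
    FourierTransform.fourier u η = ∫ y, ee (-(inner ℝ y η)) * u y := by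
  rw [SchwartzMap.fourier_coe, Real.fourier_eq]
  refine integral_congr_ae (Filter.Eventually.of_forall fun t => ?_)
  simp only
  rw [Circle.smul_def, Real.fourierChar_apply, ee, smul_eq_mul]
  congr 2
  push_cast; ring

theorem integral_ee_mul_fourier (u : 𝓢(Conf d, ℂ)) (x : Conf d) :
    ∫ η, ee (inner ℝ x η) * FourierTransform.fourier u η = u x := by
  rw [← FourierTransform.fourierInv_fourier_eq (F := 𝓢(Conf d, ℂ)) u]
  conv_lhs => rw [FourierTransform.fourierInv_fourier_eq (F := 𝓢(Conf d, ℂ)) u]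
  rw [SchwartzMap.fourierInv_coe, Real.fourierInv_eq]
  refine integral_congr_ae (Filter.Eventually.of_forall fun t => ?_)
  simp only
  rw [Circle.smul_def, Real.fourierChar_apply, ee, smul_eq_mul, real_inner_comm]
  congr 2
  push_cast; ring

theorem integral_comp_smul_sub {F : Type*} [NormedAddCommGroup F] [NormedSpace ℝ F]
    (f : Conf d → F) {c : ℝ} (hc : 0 < c) (p : Conf d) :
    ∫ x, f (c • x - p) = (c ^ d)⁻¹ • ∫ x, f x := by
  rw [Measure.integral_comp_smul volume (fun x => f (x - p)) c, integral_sub_right_eq_self f p,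
    finrank_euclideanSpace_fin, abs_of_pos (by positivity)]

/-- The point `J k` of the lattice. -/
def jZ (k : Fin d ⊕ Fin d → ℤ) : Fin d ⊕ Fin d → ℤ :=
  Sum.elim (fun j => -k (Sum.inr j)) fun j => k (Sum.inl j)

theorem intVec_jZ (k : Fin d ⊕ Fin d → ℤ) : intVec (jZ k) = jmul (intVec k) := by
  refine phase_ext ?_ ?_
  · rw [pos_jmul]; ext j; simp [pos, mom, jZ, intVec]
  · rw [mom_jmul]; ext j; simp [pos, mom, jZ, intVec]

theorem jZ_add (k l : Fin d ⊕ Fin d → ℤ) : jZ (k + l) = jZ k + jZ l := by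
  ext (j | j) <;> simp [jZ]; ring

theorem jZ_neg (k : Fin d ⊕ Fin d → ℤ) : jZ (-k) = -jZ k := by
  ext (j | j) <;> simp [jZ]

/-- Coefficients decaying faster than any polynomial. -/
def RapidCoeff {ι : Type*} [Fintype ι] (c : (ι → ℤ) → ℂ) : Prop :=
  ∀ M : ℕ, Summable fun k => (1 + ‖intVec k‖) ^ M * ‖c k‖

theorem RapidCoeff.summable_norm {ι : Type*} [Fintype ι] {c : (ι → ℤ) → ℂ} (hc : RapidCoeff c) :
    Summable fun k => ‖c k‖ := by simpa using hc 0

theorem RapidDecay.rapidCoeff {ι : Type*} [Fintype ι] {f : (ι → ℝ) → ℂ} (hf : RapidDecay f) :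
    RapidCoeff fun k => f (intVec k) := by
  intro M
  have h : RapidDecay fun x => (1 + ‖x‖) ^ M * ‖f x‖ := by
    intro L
    obtain ⟨C, hC⟩ := hf (L + M)
    refine ⟨C, fun x => ?_⟩
    rw [norm_mul, norm_norm, Real.norm_of_nonneg (by positivity), ← mul_assoc, ← pow_add]
    exact hC x
  refine h.summable_intVec.congr fun k => ?_
  rw [norm_mul, norm_norm, Real.norm_of_nonneg (by positivity)]

theorem integrable_ee_mul {E : Type*} [TopologicalSpace E] [MeasurableSpace E]
    [OpensMeasurableSpace E] {μ : Measure E} {f : E → ℂ} (hf : Integrable f μ) {t : E → ℝ} (ht : Continuous t) :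
    Integrable (fun y => ee (t y) * f y) μ :=
  hf.bdd_mul (c := 1) (continuous_ee.comp ht).aestronglyMeasurable
    (Filter.Eventually.of_forall fun y => by simp)

/-- For a single character, the `y`-integral is the Fourier transform of `u` at an affine function
of `ξ`, and the `ξ`-integral is Fourier inversion; the outcome is a translation. Absolute
summability of `c` permits exchanging the series with each of the two iterated integrals. The symbol
is reflected in `ξ` because `weyl` is defined by transposition. -/
theorem weylIntegral_eq_tsum {N : ℕ} (hN : 0 < N) {c : (Fin d ⊕ Fin d → ℤ) → ℂ} (hc : RapidCoeff c)
    {a : Phase d → ℂ} (ha : ∀ ρ, HasSum (fun k => c k * ee (intVec k ⬝ᵥ ρ)) (a ρ))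
    (u : 𝓢(Conf d, ℂ)) (x : Conf d) :
    weylIntegral (hbar N) (fun ρ => a (mkPhase (pos ρ) (-mom ρ))) u x =
      ∑' k, c k * transS (hbar N) (flip ((N : ℝ)⁻¹ • intVec (jZ k))) u x := by
  have hN0 : (0 : ℝ) < N := by exact_mod_cast hN
  set p : (Fin d ⊕ Fin d → ℤ) → Conf d := fun k => pos (intVec k)
  set q : (Fin d ⊕ Fin d → ℤ) → Conf d := fun k => mom (intVec k)
  set uh := FourierTransform.fourier u
  have h1 : ∀ ξ : Conf d, ∫ y : Conf d, Complex.exp (Complex.I * ((inner ℝ (x - y) ξ / hbar N : ℝ) : ℂ)) *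
      a (mkPhase (pos (mkPhase ((1 / 2 : ℝ) • (x + y)) ξ)) (-mom (mkPhase ((1 / 2 : ℝ) • (x + y)) ξ))) *
        u y = ∑' k, c k * (ee (N * inner ℝ x ξ + inner ℝ (p k) x / 2 - inner ℝ (q k) ξ) *
          uh ((N : ℝ) • ξ - (1 / 2 : ℝ) • p k)) := by
    intro ξ
    set F : (Fin d ⊕ Fin d → ℤ) → Conf d → ℂ := fun k y => c k *
        ee (N * inner ℝ x ξ + inner ℝ (p k) x / 2 - inner ℝ (q k) ξ) *
          (ee (-(inner ℝ y ((N : ℝ) • ξ - (1 / 2 : ℝ) • p k))) * u y) with hF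
    have e1 : ∀ y : Conf d, HasSum (fun k => F k y)
        (Complex.exp (Complex.I * ((inner ℝ (x - y) ξ / hbar N : ℝ) : ℂ)) *
          a (mkPhase (pos (mkPhase ((1 / 2 : ℝ) • (x + y)) ξ))
            (-mom (mkPhase ((1 / 2 : ℝ) • (x + y)) ξ))) * u y) := by
      intro y
      rw [exp_div_hbar, pos_mkPhase, mom_mkPhase]
      have h := ((ha (mkPhase ((1 / 2 : ℝ) • (x + y)) (-ξ))).mul_left
        (ee (N * inner ℝ (x - y) ξ))).mul_right (u y)
      have e2 : (fun k => F k y) = fun k => ee (N * inner ℝ (x - y) ξ) *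
          (c k * ee (intVec k ⬝ᵥ mkPhase ((1 / 2 : ℝ) • (x + y)) (-ξ))) * u y := by
        ext k
        have e3 : ee (N * inner ℝ x ξ + inner ℝ (p k) x / 2 - inner ℝ (q k) ξ) *
            ee (-(inner ℝ y ((N : ℝ) • ξ - (1 / 2 : ℝ) • p k))) = ee (N * inner ℝ (x - y) ξ) *
            ee (intVec k ⬝ᵥ mkPhase ((1 / 2 : ℝ) • (x + y)) (-ξ)) := by
          rw [← ee_add, ← ee_add, dotProduct_eq_inner, pos_mkPhase, mom_mkPhase, inner_sub_right,
            inner_smul_right, inner_smul_right, inner_smul_right, inner_add_right, inner_neg_right,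
            inner_sub_left, real_inner_comm (p k) y]
          congr 1
          simp only [p, q]
          ring
        simp only [hF]
        linear_combination (c k * u y) * e3
      rw [e2]
      exact h
    have e4 := hasSum_integral_of_summable_integral_norm (μ := volume) (F := F)
      (fun k => (integrable_ee_mul u.integrable (by fun_prop)).const_mul _) (by
        simp only [hF, norm_mul, norm_ee, mul_one, one_mul, integral_const_mul]
        exact hc.summable_norm.mul_right _)
    have e5 : ∀ k, ∫ y, F k y = c k * (ee (N * inner ℝ x ξ + inner ℝ (p k) x / 2 -
        inner ℝ (q k) ξ) * uh ((N : ℝ) • ξ - (1 / 2 : ℝ) • p k)) := by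
      intro k
      simp only [hF, uh]
      rw [integral_const_mul, ← fourier_schwartz_apply, mul_assoc]
    simp only [e5] at e4
    rw [e4.tsum_eq]
    exact integral_congr_ae (Filter.Eventually.of_forall fun y => (e1 y).tsum_eq.symm)
  set G : (Fin d ⊕ Fin d → ℤ) → Conf d → ℂ := fun k η => c k *
    (ee (inner ℝ (x - (N : ℝ)⁻¹ • q k) η + (inner ℝ (p k) x -
      (2 * N : ℝ)⁻¹ * inner ℝ (p k) (q k))) * uh η) with hG
  have h2 : ∀ k ξ, c k * (ee (N * inner ℝ x ξ + inner ℝ (p k) x / 2 - inner ℝ (q k) ξ) *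
      uh ((N : ℝ) • ξ - (1 / 2 : ℝ) • p k)) = G k ((N : ℝ) • ξ - (1 / 2 : ℝ) • p k) := by
    intro k ξ
    simp only [hG]
    congr 3
    simp only [inner_sub_left, inner_sub_right, real_inner_smul_left, inner_smul_right,
      real_inner_comm (p k)]
    field_simp
    ring
  have hGi : ∀ k, Integrable (G k) := fun k =>
    (integrable_ee_mul (SchwartzMap.integrable uh) (by fun_prop)).const_mul _
  rw [weylIntegral]
  simp only [h1, h2]
  have h3 := hasSum_integral_of_summable_integral_norm (μ := volume)
    (F := fun k ξ => G k ((N : ℝ) • ξ - (1 / 2 : ℝ) • p k))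
    (fun k => ((hGi k).comp_sub_right ((1 / 2 : ℝ) • p k)).comp_smul hN0.ne') (by
      have h : ∀ k, ∫ ξ, ‖G k ((N : ℝ) • ξ - (1 / 2 : ℝ) • p k)‖ =
          ‖c k‖ * (((N : ℝ) ^ d)⁻¹ * ∫ η, ‖uh η‖) := by
        intro k
        rw [integral_comp_smul_sub (fun η => ‖G k η‖) hN0, smul_eq_mul]
        simp only [hG, norm_mul, norm_ee, one_mul, integral_const_mul]
        ring
      simp only [h]
      exact hc.summable_norm.mul_right _)
  -- This prefactor cancels the Jacobian of the dilation `ξ ↦ N ξ`.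
  have h4 : ((((2 * Real.pi * hbar N) ^ d)⁻¹ : ℝ) : ℂ) = (N : ℂ) ^ d := by
    have : 2 * Real.pi * hbar N = (N : ℝ)⁻¹ := by
      rw [hbar]; field_simp
    rw [this, inv_pow, inv_inv]; push_cast; rfl
  rw [h4, ← h3.tsum_eq, ← tsum_mul_left]
  refine tsum_congr fun k => ?_
  rw [integral_comp_smul_sub (G k) hN0]
  simp only [hG]
  rw [integral_const_mul]
  have h5 : ∫ η, ee (inner ℝ (x - (N : ℝ)⁻¹ • q k) η + (inner ℝ (p k) x -
      (2 * N : ℝ)⁻¹ * inner ℝ (p k) (q k))) * uh η = ee (inner ℝ (p k) x -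
      (2 * N : ℝ)⁻¹ * inner ℝ (p k) (q k)) * u (x - (N : ℝ)⁻¹ • q k) := by
    rw [← integral_ee_mul_fourier u, ← integral_const_mul]
    congr 1; ext η
    rw [ee_add]; ring
  rw [h5, transS_apply, intVec_jZ, pos_flip, mom_flip, pos_smul, mom_smul, pos_jmul, mom_jmul,
    smul_neg, neg_neg, Complex.real_smul]
  have h6 : (N : ℝ) * (inner ℝ ((N : ℝ)⁻¹ • pos (intVec k)) x -
      inner ℝ ((N : ℝ)⁻¹ • pos (intVec k)) ((N : ℝ)⁻¹ • mom (intVec k)) / 2) =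
      inner ℝ (p k) x - (2 * N : ℝ)⁻¹ * inner ℝ (p k) (q k) := by
    simp only [real_inner_smul_left, real_inner_smul_right, p, q]
    field_simp
  rw [h6]
  have hN1 : (N : ℂ) ^ d ≠ 0 := pow_ne_zero _ (by exact_mod_cast hN.ne')
  push_cast
  field_simp
  rfl

theorem norm_jmul (s : Phase d) : ‖jmul s‖ ≤ ‖s‖ := by
  refine (pi_norm_le_iff_of_nonneg (norm_nonneg _)).2 ?_
  rintro (j | j)
  · have : jmul s (Sum.inl j) = -s (Sum.inr j) := by
      have := congrArg (fun v : Conf d => v j) (pos_jmul s); simpa [pos, mom] using this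
    rw [this, norm_neg]; exact norm_le_pi_norm s _
  · have : jmul s (Sum.inr j) = s (Sum.inl j) := by
      have := congrArg (fun v : Conf d => v j) (mom_jmul s); simpa [pos, mom] using this
    rw [this]; exact norm_le_pi_norm s _

theorem norm_flip (s : Phase d) : ‖flip s‖ ≤ ‖s‖ := by
  refine (pi_norm_le_iff_of_nonneg (norm_nonneg _)).2 ?_
  rintro (j | j)
  · have : flip s (Sum.inl j) = -s (Sum.inl j) := by simp [flip, mkPhase, pos]
    rw [this, norm_neg]; exact norm_le_pi_norm s _
  · have : flip s (Sum.inr j) = s (Sum.inr j) := by simp [flip, mkPhase, mom]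
    rw [this]; exact norm_le_pi_norm s _

section
variable {N : ℕ} {c : (Fin d ⊕ Fin d → ℤ) → ℂ}

theorem exists_seminorm_weylTerm_le (hN : 0 < N) (k n : ℕ) :
    ∃ C : ℝ, 0 ≤ C ∧ ∀ (u : 𝓢(Conf d, ℂ)) (c : ℂ) (l : Fin d ⊕ Fin d → ℤ), SchwartzMap.seminorm ℂ k n
      (c • transS (hbar N) (flip ((N : ℝ)⁻¹ • intVec (jZ l))) u) ≤
        ((1 + ‖intVec l‖) ^ (k + n) * ‖c‖) *
          (C * (Finset.Iic (k, n)).sup (schwartzSeminormFamily ℂ (Conf d) ℂ) u) := by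
  obtain ⟨C, hC0, hC⟩ := exists_seminorm_transS_le (d := d) N k n
  refine ⟨C, hC0, fun u c l => ?_⟩
  rw [map_smul_eq_mul]
  have h1 : ‖flip ((N : ℝ)⁻¹ • intVec (jZ l))‖ ≤ ‖intVec l‖ := by
    refine (norm_flip _).trans ?_
    rw [norm_smul, norm_inv, Real.norm_natCast, intVec_jZ]
    have h2 : (1 : ℝ) ≤ N := by exact_mod_cast hN
    calc _ ≤ 1 * ‖intVec l‖ := by
          gcongr
          · exact inv_le_one_of_one_le₀ h2
          · exact norm_jmul _
      _ = _ := one_mul _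
  have hq : 0 ≤ (Finset.Iic (k, n)).sup (schwartzSeminormFamily ℂ (Conf d) ℂ) u := apply_nonneg _ _
  calc _ ≤ ‖c‖ * (C * (1 + ‖flip ((N : ℝ)⁻¹ • intVec (jZ l))‖) ^ (k + n) *
        (Finset.Iic (k, n)).sup (schwartzSeminormFamily ℂ (Conf d) ℂ) u) := by
        gcongr; exact hC _ _
    _ ≤ ‖c‖ * (C * (1 + ‖intVec l‖) ^ (k + n) *
        (Finset.Iic (k, n)).sup (schwartzSeminormFamily ℂ (Conf d) ℂ) u) := by gcongr
    _ = _ := by ring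

theorem summable_seminorm_weylTerm (hN : 0 < N) (hc : RapidCoeff c) (u : 𝓢(Conf d, ℂ)) (k n : ℕ) :
    Summable fun l => SchwartzMap.seminorm ℂ k n
      (c l • transS (hbar N) (flip ((N : ℝ)⁻¹ • intVec (jZ l))) u) := by
  obtain ⟨C, hC0, hC⟩ := exists_seminorm_weylTerm_le (d := d) hN k n
  exact Summable.of_nonneg_of_le (fun _ => apply_nonneg _ _) (fun l => hC u _ l)
    ((hc (k + n)).mul_right _)

/-- The operator `∑ c_k U_ħ(J k / N)` (up to a reflection) on Schwartz functions. -/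
def weylSumL (hN : 0 < N) (hc : RapidCoeff c) : 𝓢(Conf d, ℂ) →ₗ[ℂ] 𝓢(Conf d, ℂ) where
  toFun u := schwartzTsum _ (summable_seminorm_weylTerm hN hc u)
  map_add' u v := by
    refine HasSum.unique (hasSum_schwartzTsum _ _) ?_
    simp only [map_add, smul_add]
    exact (hasSum_schwartzTsum _ (summable_seminorm_weylTerm hN hc u)).add
      (hasSum_schwartzTsum _ (summable_seminorm_weylTerm hN hc v))
  map_smul' b u := by
    refine HasSum.unique (hasSum_schwartzTsum _ _) ?_
    simp only [map_smul, RingHom.id_apply, smul_comm _ b]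
    exact (hasSum_schwartzTsum _ (summable_seminorm_weylTerm hN hc u)).const_smul b

/-- The operator `weylSumL` as a continuous operator. -/
def weylSum (hN : 0 < N) (hc : RapidCoeff c) : 𝓢(Conf d, ℂ) →L[ℂ] 𝓢(Conf d, ℂ) where
  toLinearMap := weylSumL hN hc
  cont := by
    refine (schwartz_withSeminorms ℂ (Conf d) ℂ).continuous_of_isBounded
      (schwartz_withSeminorms ℂ (Conf d) ℂ) (weylSumL hN hc) ?_
    rintro ⟨k, n⟩
    obtain ⟨C, hC0, hC⟩ := exists_seminorm_weylTerm_le (d := d) hN k n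
    refine ⟨Finset.Iic (k, n), Real.toNNReal ((∑' l, (1 + ‖intVec l‖) ^ (k + n) * ‖c l‖) * C),
      fun u => ?_⟩
    have hS : 0 ≤ ∑' l, (1 + ‖intVec l‖) ^ (k + n) * ‖c l‖ := tsum_nonneg fun l => by positivity
    rw [Seminorm.comp_apply, smul_apply, NNReal.smul_def, Real.coe_toNNReal _ (by positivity),
      smul_eq_mul, mul_assoc, ← tsum_mul_right]
    refine (seminorm_schwartzTsum_le _ (summable_seminorm_weylTerm hN hc u) k n).trans ?_
    exact (summable_seminorm_weylTerm hN hc u k n).tsum_le_tsum (fun l => hC u _ l)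
      ((hc (k + n)).mul_right _)

theorem weylSum_apply (hN : 0 < N) (hc : RapidCoeff c) (u : 𝓢(Conf d, ℂ)) (x : Conf d) :
    weylSum hN hc u x =
      ∑' l, c l * transS (hbar N) (flip ((N : ℝ)⁻¹ • intVec (jZ l))) u x := rfl

/-- The series of translations is the continuous operator whose existence `weylS` asks for, so the
default value `0` is not taken. -/
theorem weylS_eq (hN : 0 < N) (hc : RapidCoeff c) {a : Phase d → ℂ}
    (ha : ∀ ρ, HasSum (fun k => c k * ee (intVec k ⬝ᵥ ρ)) (a ρ)) :
    weylS (hbar N) (fun ρ => a (mkPhase (pos ρ) (-mom ρ))) = weylSum hN hc := by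
  have h : ∃ T : 𝓢(Conf d, ℂ) →L[ℂ] 𝓢(Conf d, ℂ), ∀ u x,
      T u x = weylIntegral (hbar N) (fun ρ => a (mkPhase (pos ρ) (-mom ρ))) u x :=
    ⟨weylSum hN hc, fun u x => by rw [weylIntegral_eq_tsum hN hc ha, weylSum_apply]⟩
  rw [weylS, dif_pos h]
  ext u x
  rw [h.choose_spec, weylIntegral_eq_tsum hN hc ha, weylSum_apply]

/-- Each translation in the series commutes with the integer ones, so the operator preserves
`torusSpace` and its restriction is genuine. -/
theorem hasSum_evalL_opW (hN : 0 < N) {κ : Phase d} (hc : RapidCoeff c) {a : Phase d → ℂ}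
    (ha : ∀ ρ, HasSum (fun k => c k * ee (intVec k ⬝ᵥ ρ)) (a ρ)) (φ : 𝓢(Conf d, ℂ))
    (v : torusSpace N κ) :
    HasSum (fun k => c k * evalL N κ φ (shift N κ (jZ k) v)) (evalL N κ φ (opW N κ a v)) := by
  have h1 : ∀ (ψ : 𝓢'(Conf d, ℂ)) φ, HasSum (fun k => c k *
      ψ (transS (hbar N) (flip ((N : ℝ)⁻¹ • intVec (jZ k))) φ)) (weyl (hbar N) a ψ φ) := by
    intro ψ φ
    have h2 : HasSum (fun k => ψ (c k • transS (hbar N) (flip ((N : ℝ)⁻¹ • intVec (jZ k))) φ))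
        (ψ (weylSum hN hc φ)) := hasSum_distribution ψ _ (summable_seminorm_weylTerm hN hc φ)
    rw [← weylS_eq hN hc ha] at h2
    simp only [map_smul, smul_eq_mul] at h2
    exact h2
  have h3 : ∀ ψ ∈ torusSpace N κ, weyl (hbar N) a ψ ∈ torusSpace N κ := by
    intro ψ hψ
    rw [mem_torusSpace_iff]
    intro r φ
    refine HasSum.unique (h1 ψ _) ?_
    have h4 := (h1 ψ φ).mul_left (theta N κ r)
    have h5 : (fun k => c k * ψ (transS (hbar N) (flip ((N : ℝ)⁻¹ • intVec (jZ k)))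
        (transS (hbar N) (intVec r) φ))) = fun k => theta N κ r *
          (c k * ψ (transS (hbar N) (flip ((N : ℝ)⁻¹ • intVec (jZ k))) φ)) := by
      ext k
      rw [flip_smul, flip_intVec]
      obtain ⟨m, hm⟩ := sigma_intVec_fracVec hN r (flipZ (jZ k))
      rw [← transS_comm_of_intCast N hm, mem_torusSpace_iff.1 hψ]
      ring
    rw [h5]
    exact h4
  rw [evalL_apply, opW, restrictH_apply h3]
  have h5 := h1 v φ
  simp only [evalL_shift hN]
  simp only [flip_smul, flip_intVec] at h5
  exact h5

theorem TorusHilbert.norm_toS_shift {κ : Phase d} (H : TorusHilbert N κ) (s : Fin d ⊕ Fin d → ℤ)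
    (v : torusSpace N κ) : ‖H.toS (shift N κ s v)‖ = ‖H.toS v‖ := by
  rw [norm_eq_sqrt_re_inner (𝕜 := ℂ), norm_eq_sqrt_re_inner (𝕜 := ℂ) (H.toS v), H.inner_toS,
    H.inner_toS, H.ip_shift]

/-- The Weyl quantization of a Fourier series on `H_N(κ)`. -/
theorem hasSum_toS_opW (hN : 0 < N) {κ : Phase d} (H : TorusHilbert N κ) (hc : RapidCoeff c)
    {a : Phase d → ℂ} (ha : ∀ ρ, HasSum (fun k => c k * ee (intVec k ⬝ᵥ ρ)) (a ρ))
    (v : torusSpace N κ) :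
    HasSum (fun k => c k • H.toS (shift N κ (jZ k) v)) (H.toS (opW N κ a v)) := by
  have := H.finiteDimensional hN
  have : CompleteSpace H.Space := FiniteDimensional.complete ℂ _
  have hnorm : ∀ k, ‖c k • H.toS (shift N κ (jZ k) v)‖ = ‖c k‖ * ‖H.toS v‖ := by
    intro k
    rw [norm_smul, H.norm_toS_shift]
  have hs : Summable fun k => c k • H.toS (shift N κ (jZ k) v) := by
    refine Summable.of_norm ?_
    simp only [hnorm]
    exact hc.summable_norm.mul_right _
  -- The series converges in norm; its sum is identified through evaluations, which are continuous
  -- in finite dimension and separate states.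
  have h1 : ∑' k, c k • H.toS (shift N κ (jZ k) v) = H.toS (opW N κ a v) := by
    rw [← LinearEquiv.symm_apply_eq]
    refine torusSpace_ext fun φ => ?_
    let L : H.Space →L[ℂ] ℂ :=
      LinearMap.toContinuousLinearMap (evalL N κ φ ∘ₗ H.toS.symm.toLinearMap)
    have h2 := hs.hasSum.mapL L
    have h3 : ∀ w : H.Space, L w = evalL N κ φ (H.toS.symm w) := fun _ => rfl
    simp only [h3, map_smul, LinearEquiv.symm_apply_apply, smul_eq_mul] at h2
    exact h2.unique (hasSum_evalL_opW hN hc ha φ v)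
  rw [← h1]
  exact hs.hasSum

end

end

/-! ### Gaussians and windows -/

section

section gaussian

variable {ι : Type*} [Fintype ι] [DecidableEq ι]

theorem integral_comp_mulVec {F : Type*} [NormedAddCommGroup F] [NormedSpace ℝ F]
    {B : Matrix ι ι ℝ} (hB : B.det ≠ 0) (f : (ι → ℝ) → F) :
    ∫ x, f (B *ᵥ x) = |B.det|⁻¹ • ∫ x, f x := by
  have h1 := Real.map_matrix_volume_pi_eq_smul_volume_pi hB
  have hB' : IsUnit B.det := isUnit_iff_ne_zero.2 hB
  have he : MeasurableEmbedding (Matrix.toLin' B) := by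
    have hinj : Function.Injective (Matrix.toLin' B) :=
      Matrix.mulVec_injective_iff_isUnit.2 ((Matrix.isUnit_iff_isUnit_det B).2 hB')
    have hc : Continuous (Matrix.toLin' B) := (Matrix.toLin' B).continuous_of_finiteDimensional
    exact hc.measurableEmbedding hinj
  have h3 := he.integral_map (μ := volume) f
  simp only [Matrix.toLin'_apply] at h3
  rw [← h3, h1, integral_smul_measure, ENNReal.toReal_ofReal (abs_nonneg _), abs_inv]

theorem integral_ee_mul_exp_neg_dotProduct (η : ι → ℝ) :
    ∫ x : ι → ℝ, ee (-(η ⬝ᵥ x)) * (Real.exp (-Real.pi * (x ⬝ᵥ x)) : ℂ) =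
      (Real.exp (-Real.pi * (η ⬝ᵥ η)) : ℂ) := by
  have hpi : (Real.pi : ℂ) ≠ 0 := by exact_mod_cast Real.pi_ne_zero
  have h := GaussianFourier.integral_cexp_neg_mul_sum_add (ι := ι) (b := Real.pi)
    (by simpa using Real.pi_pos) fun i => -(2 * Real.pi * Complex.I * η i)
  rw [div_self hpi, Complex.one_cpow, one_mul] at h
  have e1 : ∀ x : ι → ℝ, ee (-(η ⬝ᵥ x)) * (Real.exp (-Real.pi * (x ⬝ᵥ x)) : ℂ) =
      Complex.exp (-Real.pi * ∑ i, (x i : ℂ) ^ 2 + ∑ i, -(2 * Real.pi * Complex.I * η i) * x i) := by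
    intro x
    rw [ee, Complex.ofReal_exp, ← Complex.exp_add]
    congr 1
    simp only [dotProduct, Complex.ofReal_neg, Complex.ofReal_sum, Complex.ofReal_mul, Finset.mul_sum,
      mul_neg, neg_mul, Finset.sum_neg_distrib]
    rw [add_comm]
    congr 2
    · exact Finset.sum_congr rfl fun i _ => by ring
    · exact Finset.sum_congr rfl fun i _ => by ring
  simp only [e1, h]
  rw [Complex.ofReal_exp]
  congr 1
  simp only [dotProduct, Complex.ofReal_neg, Complex.ofReal_sum, Complex.ofReal_mul, Finset.mul_sum,
    Finset.sum_div]
  refine Finset.sum_congr rfl fun i _ => ?_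
  field_simp
  rw [Complex.I_sq]; ring

/-- The Gaussian `exp(-π ‖B x‖²)`. -/
def gaussM (B : Matrix ι ι ℝ) (x : ι → ℝ) : ℝ := Real.exp (-Real.pi * ((B *ᵥ x) ⬝ᵥ (B *ᵥ x)))

theorem continuous_gaussM (B : Matrix ι ι ℝ) : Continuous (gaussM B) := by
  unfold gaussM
  have : Continuous fun x : ι → ℝ => B *ᵥ x := (Matrix.mulVecLin B).continuous_of_finiteDimensional
  simp only [dotProduct]
  fun_prop

theorem gaussM_neg (B : Matrix ι ι ℝ) (x : ι → ℝ) : gaussM B (-x) = gaussM B x := by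
  simp [gaussM, Matrix.mulVec_neg]

theorem fourier_gaussM {B : Matrix ι ι ℝ} (hB : B.det ≠ 0) (η : ι → ℝ) :
    ∫ x : ι → ℝ, ee (-(η ⬝ᵥ x)) * (gaussM B x : ℂ) =
      ((|B.det|⁻¹ * gaussM (B⁻¹)ᵀ η : ℝ) : ℂ) := by
  have hB' : IsUnit B.det := isUnit_iff_ne_zero.2 hB
  have h1 : ∀ x, ee (-(η ⬝ᵥ x)) * (gaussM B x : ℂ) =
      (fun y => ee (-(((B⁻¹)ᵀ *ᵥ η) ⬝ᵥ y)) * (Real.exp (-Real.pi * (y ⬝ᵥ y)) : ℂ)) (B *ᵥ x) := by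
    intro x
    simp only [gaussM]
    congr 3
    rw [Matrix.mulVec_transpose, ← Matrix.dotProduct_mulVec, Matrix.mulVec_mulVec,
      Matrix.nonsing_inv_mul B hB', Matrix.one_mulVec]
  simp only [h1]
  rw [integral_comp_mulVec hB (fun y => ee (-(((B⁻¹)ᵀ *ᵥ η) ⬝ᵥ y)) *
    (Real.exp (-Real.pi * (y ⬝ᵥ y)) : ℂ)), integral_ee_mul_exp_neg_dotProduct, gaussM]
  simp

/-- The constant comes from `exp s ≥ s ^ M / M!` at `s = c (1 + r²)`, together with `1 + r ≤ 2 (1 +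
r²)`. -/
theorem exp_neg_sq_le (M : ℕ) {c : ℝ} (hc : 0 < c) :
    ∃ C : ℝ, ∀ r : ℝ, 0 ≤ r → (1 + r) ^ M * Real.exp (-(c * r ^ 2)) ≤ C := by
  refine ⟨2 ^ M * Real.exp c * (M.factorial / c ^ M), fun r hr => ?_⟩
  have h1 := Real.pow_div_factorial_le_exp (c * (1 + r ^ 2)) (by positivity) M
  have h2 : (1 + r) ^ M ≤ 2 ^ M * (1 + r ^ 2) ^ M := by
    rw [← mul_pow]
    exact pow_le_pow_left₀ (by positivity) (by nlinarith [sq_nonneg (r - 1), sq_nonneg r]) M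
  have h3 : Real.exp (-(c * r ^ 2)) = Real.exp c * (Real.exp (c * (1 + r ^ 2)))⁻¹ := by
    rw [← Real.exp_neg, ← Real.exp_add]; congr 1; ring
  have h4 : (Real.exp (c * (1 + r ^ 2)))⁻¹ ≤ M.factorial / (c ^ M * (1 + r ^ 2) ^ M) := by
    rw [← mul_pow, ← inv_div]
    exact inv_anti₀ (by positivity) h1
  calc _ ≤ (2 ^ M * (1 + r ^ 2) ^ M) * (Real.exp c * (M.factorial / (c ^ M * (1 + r ^ 2) ^ M))) := by
        rw [h3]; gcongr
    _ = _ := by field_simp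

theorem rapidDecay_gaussM {B : Matrix ι ι ℝ} (hB : B.det ≠ 0) :
    RapidDecay fun x => (gaussM B x : ℂ) := by
  have hB' : IsUnit B.det := isUnit_iff_ne_zero.2 hB
  set L : (ι → ℝ) →L[ℝ] (ι → ℝ) := LinearMap.toContinuousLinearMap (Matrix.mulVecLin B⁻¹)
  have h1 : ∀ x, ‖x‖ ≤ ‖L‖ * ‖B *ᵥ x‖ := by
    intro x
    have h2 := L.le_opNorm (B *ᵥ x)
    have h3 : L (B *ᵥ x) = x := by
      change B⁻¹ *ᵥ (B *ᵥ x) = x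
      rw [Matrix.mulVec_mulVec, Matrix.nonsing_inv_mul B hB', Matrix.one_mulVec]
    rwa [h3] at h2
  have h2 : ∀ y : ι → ℝ, ‖y‖ ^ 2 ≤ y ⬝ᵥ y := by
    intro y
    have h0 : 0 ≤ y ⬝ᵥ y := Finset.sum_nonneg fun i _ => mul_self_nonneg _
    rw [← Real.le_sqrt (norm_nonneg _) h0, pi_norm_le_iff_of_nonneg (Real.sqrt_nonneg _)]
    intro i
    rw [Real.norm_eq_abs]
    refine Real.abs_le_sqrt ?_
    rw [sq]
    exact Finset.single_le_sum (f := fun i => y i * y i) (fun i _ => mul_self_nonneg _)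
      (Finset.mem_univ i)
  -- The `+ 1` keeps the denominator positive when `ι` is empty and `L` vanishes.
  set c : ℝ := Real.pi / (‖L‖ + 1) ^ 2
  have hc : 0 < c := by have := Real.pi_pos; positivity
  intro M
  obtain ⟨C, hC⟩ := exp_neg_sq_le M hc
  refine ⟨C, fun x => le_trans ?_ (hC ‖x‖ (norm_nonneg _))⟩
  rw [Complex.norm_real, gaussM, Real.norm_of_nonneg (Real.exp_pos _).le]
  gcongr
  have h3 : ‖x‖ ^ 2 ≤ (‖L‖ + 1) ^ 2 * ((B *ᵥ x) ⬝ᵥ (B *ᵥ x)) := by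
    calc ‖x‖ ^ 2 ≤ ((‖L‖ + 1) * ‖B *ᵥ x‖) ^ 2 := by
          gcongr
          exact (h1 x).trans (by gcongr; linarith)
      _ ≤ _ := by rw [mul_pow]; gcongr; exact h2 _
  have h4 : c * ‖x‖ ^ 2 ≤ Real.pi * ((B *ᵥ x) ⬝ᵥ (B *ᵥ x)) := by
    rw [div_mul_eq_mul_div, div_le_iff₀ (by positivity)]
    nlinarith [Real.pi_pos]
  linarith

/-- The square is the Gaussian of `√2 B`, and its integral is a Fourier transform at `0`. -/
theorem integral_gaussM_sq {B : Matrix ι ι ℝ} (hB : B.det ≠ 0) :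
    ∫ x : ι → ℝ, (gaussM B x : ℂ) * gaussM B x =
      (((Real.sqrt 2 ^ Fintype.card ι * |B.det|)⁻¹ : ℝ) : ℂ) := by
  have hs : Real.sqrt 2 ≠ 0 := by positivity
  have h1 : ∀ x, (gaussM B x : ℂ) * gaussM B x =
      ee (-((0 : ι → ℝ) ⬝ᵥ x)) * (gaussM (Real.sqrt 2 • B) x : ℂ) := by
    intro x
    rw [zero_dotProduct, neg_zero, ee_zero, one_mul, ← Complex.ofReal_mul, gaussM, gaussM,
      ← Real.exp_add, Matrix.smul_mulVec, smul_dotProduct, dotProduct_smul, smul_eq_mul, smul_eq_mul,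
      ← mul_assoc (Real.sqrt 2), Real.mul_self_sqrt zero_le_two]
    congr 2; ring
  have h2 : (Real.sqrt 2 • B).det = Real.sqrt 2 ^ Fintype.card ι * B.det := by
    rw [Matrix.det_smul]
  simp only [h1]
  rw [fourier_gaussM (by rw [h2]; positivity), h2]
  simp [gaussM, abs_mul, abs_of_nonneg]

end gaussian

variable {d : ℕ}

/-- A pair consisting of an observable and its Fourier transform, with the properties on which the
positive quantization rests. -/
structure IsWindow (G Gh : Phase d → ℂ) : Prop where
  continuous : Continuous G
  continuous_fourier : Continuous Gh
  rapidDecay : RapidDecay G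
  rapidDecay_fourier : RapidDecay Gh
  fourier : ∀ η, ∫ t, ee (-(η ⬝ᵥ t)) * G t = Gh η
  conj : ∀ η, (starRingEnd ℂ) (Gh η) = Gh η
  even : ∀ η, Gh (-η) = Gh η
  integral_sq : ∫ η, Gh η * Gh η = 1

/-- The Fourier transform is a Gaussian attached to `(B⁻¹)ᵀ`, and the prefactor `2^{d/2} |det
B|^{1/2}` is exactly the one that gives it unit `L²` norm. `B` is invertible because `Q` is
symplectic and the weights are positive. -/
theorem isWindow_gauss {A : Matrix.symplecticGroup (Fin d) ℤ} (R : Reduction A) (ε₀ : ℝ) {ħ : ℝ}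
    (hħ : 0 < ħ) : ∃ Gh, IsWindow (R.gauss ε₀ ħ) Gh := by
  set B := R.B ε₀ ħ with hB
  have hQ : (R.Q : Matrix (Fin d ⊕ Fin d) (Fin d ⊕ Fin d) ℝ).det ≠ 0 :=
    (SymplecticGroup.symplectic_det R.Q.2).ne_zero
  have hdet : B.det ≠ 0 := by
    rw [hB, Reduction.B, Matrix.det_mul, Matrix.det_mul, Matrix.det_nonsing_inv, Matrix.det_diagonal]
    refine mul_ne_zero (mul_ne_zero hQ ?_) (by simpa using hQ)
    refine Finset.prod_ne_zero_iff.2 ?_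
    rintro (j | j) - <;> exact (Real.rpow_pos_of_pos hħ _).ne'
  have hdet' : ((B⁻¹)ᵀ).det ≠ 0 := by simpa using hdet
  set c : ℝ := (2 : ℝ) ^ ((d : ℝ) / 2) * |B.det| ^ (1 / 2 : ℝ) with hc
  have hG : R.gauss ε₀ ħ = fun x => (c : ℂ) * (gaussM B x : ℂ) := by
    ext x; rw [Reduction.gauss, gaussM, ← Complex.ofReal_mul]
  have hc2 : c * c = 2 ^ d * |B.det| := by
    rw [hc, mul_mul_mul_comm, ← Real.rpow_add two_pos, ← Real.rpow_add (abs_pos.2 hdet), add_halves]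
    norm_num
  have hsqrt : Real.sqrt 2 ^ Fintype.card (Fin d ⊕ Fin d) = 2 ^ d := by
    rw [Fintype.card_sum, Fintype.card_fin, ← two_mul, pow_mul, Real.sq_sqrt zero_le_two]
  set b : ℝ := c * |B.det|⁻¹ with hb
  have hsmul : ∀ (c : ℝ) (B : Matrix (Fin d ⊕ Fin d) (Fin d ⊕ Fin d) ℝ), B.det ≠ 0 →
      RapidDecay fun x => (c : ℂ) * (gaussM B x : ℂ) := fun c B hB =>
    (rapidDecay_gaussM hB).of_norm_le ‖(c : ℂ)‖ fun x => (norm_mul _ _).le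
  refine ⟨fun η => (b : ℂ) * (gaussM (B⁻¹)ᵀ η : ℂ), ?_, ?_, ?_, hsmul _ _ hdet', ?_, ?_, ?_, ?_⟩
  · rw [hG]; have := continuous_gaussM B; fun_prop
  · have := continuous_gaussM (B⁻¹)ᵀ; fun_prop
  · rw [hG]; exact hsmul _ _ hdet
  · intro η
    simp only [hG, mul_left_comm _ (c : ℂ)]
    rw [integral_const_mul, fourier_gaussM hdet, hb]
    push_cast; ring
  · intro η; rw [map_mul, Complex.conj_ofReal, Complex.conj_ofReal]
  · intro η; rw [gaussM_neg]
  · have h1 : ∀ η, (b : ℂ) * (gaussM (B⁻¹)ᵀ η : ℂ) * ((b : ℂ) * (gaussM (B⁻¹)ᵀ η : ℂ)) =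
        ((b * b : ℝ) : ℂ) * ((gaussM (B⁻¹)ᵀ η : ℂ) * (gaussM (B⁻¹)ᵀ η : ℂ)) := by
      intro η; push_cast; ring
    simp only [h1]
    rw [integral_const_mul, integral_gaussM_sq hdet', ← Complex.ofReal_mul, hsqrt,
      Matrix.det_transpose, Matrix.det_nonsing_inv, Ring.inverse_eq_inv', abs_inv, hb,
      mul_mul_mul_comm, hc2]
    have := abs_pos.2 hdet
    norm_cast
    field_simp

end

/-! ### The Moyal square of a window and the symbols of the positive quantization -/

section

section decay

variable {E : Type*} [NormedAddCommGroup E] {f g : E → ℂ}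

/-- Of the `L + M` powers of decay of `f`, `M` are spent on moving the decay of `g` from `ρ + T η`
to `ρ`. -/
theorem RapidDecay.exists_mul_le (hf : RapidDecay f) (hg : RapidDecay g) {T : E → E}
    (hT : ∀ η, ‖T η‖ ≤ ‖η‖) (L M : ℕ) : ∃ C, 0 ≤ C ∧ ∀ ρ η,
      ‖f η‖ * ‖g (ρ + T η)‖ ≤ C * (((1 + ‖ρ‖) ^ M)⁻¹ * ((1 + ‖η‖) ^ L)⁻¹) := by
  obtain ⟨C₁, hC₁, h₁⟩ := hf.exists_le (L + M)
  obtain ⟨C₂, hC₂, h₂⟩ := hg.exists_le M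
  refine ⟨C₁ * C₂, by positivity, fun ρ η => ?_⟩
  have h3 : 1 + ‖ρ‖ ≤ (1 + ‖ρ + T η‖) * (1 + ‖η‖) := by
    calc 1 + ‖ρ‖ = 1 + ‖(ρ + T η) + -T η‖ := by rw [add_neg_cancel_right]
      _ ≤ (1 + ‖ρ + T η‖) * (1 + ‖-T η‖) := one_add_norm_add_le _ _
      _ ≤ _ := by rw [norm_neg]; gcongr; exact hT η
  have h4 : ((1 + ‖ρ + T η‖) ^ M)⁻¹ ≤ ((1 + ‖ρ‖) ^ M)⁻¹ * (1 + ‖η‖) ^ M := by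
    rw [inv_mul_eq_div, le_div_iff₀ (by positivity), inv_mul_le_iff₀ (by positivity), ← mul_pow]
    gcongr
  calc _ ≤ (C₁ * ((1 + ‖η‖) ^ (L + M))⁻¹) * (C₂ * (((1 + ‖ρ‖) ^ M)⁻¹ * (1 + ‖η‖) ^ M)) := by
        gcongr
        · exact h₁ η
        · exact (h₂ _).trans (by gcongr)
    _ = _ := by rw [pow_add]; field_simp

theorem RapidDecay.rapidDecay_integral_mul [NormedSpace ℝ E] [FiniteDimensional ℝ E]
    [MeasurableSpace E] [BorelSpace E] {μ : Measure E} [μ.IsAddHaarMeasure] (hf : RapidDecay f)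
    (hg : RapidDecay g) {T : E → E} (hT : ∀ η, ‖T η‖ ≤ ‖η‖) {u : E → E → ℂ}
    (hu : ∀ ρ η, ‖u ρ η‖ ≤ 1) : RapidDecay fun ρ => ∫ η, u ρ η * (f η * g (ρ + T η)) ∂μ := by
  intro M
  obtain ⟨C, hC0, hC⟩ := hf.exists_mul_le hg hT (Module.finrank ℝ E + 1) M
  have hi := integrable_inv_one_add_norm_pow μ
  refine ⟨C * ∫ η, ((1 + ‖η‖) ^ (Module.finrank ℝ E + 1))⁻¹ ∂μ, fun ρ => ?_⟩
  rw [mul_comm, ← le_div_iff₀ (by positivity)]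
  have h : ‖∫ η, u ρ η * (f η * g (ρ + T η)) ∂μ‖ ≤
      ∫ η, C * ((1 + ‖ρ‖) ^ M)⁻¹ * ((1 + ‖η‖) ^ (Module.finrank ℝ E + 1))⁻¹ ∂μ := by
    refine norm_integral_le_of_norm_le (hi.const_mul _) (Filter.Eventually.of_forall fun η => ?_)
    rw [norm_mul, norm_mul, mul_assoc]
    exact (mul_le_of_le_one_left (by positivity) (hu ρ η)).trans (hC ρ η)
  rw [integral_const_mul] at h
  refine h.trans (le_of_eq ?_)
  rw [div_eq_mul_inv]; ring

end decay

variable {d : ℕ}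

theorem jmul_dotProduct (s t : Phase d) : jmul s ⬝ᵥ t = -sigma s t := by
  rw [dotProduct_eq_inner, pos_jmul, mom_jmul, sigma_eq, inner_neg_left]; ring

theorem jmul_smul (c : ℝ) (s : Phase d) : jmul (c • s) = c • jmul s := Matrix.mulVec_smul _ _ _

theorem jmul_jmul (s : Phase d) : jmul (jmul s) = -s :=
  phase_ext (by rw [pos_jmul, mom_jmul, pos_neg]) (by rw [mom_jmul, pos_jmul, mom_neg])

theorem continuous_jmul : Continuous (jmul : Phase d → Phase d) :=
  (Matrix.mulVecLin (Matrix.J (Fin d) ℝ)).continuous_of_finiteDimensional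

theorem continuous_sigma_right (t : Phase d) : Continuous fun s : Phase d => sigma t s := by
  simp only [sigma_eq]; fun_prop

theorem abs_det_J (d : ℕ) : |(Matrix.J (Fin d) ℝ).det| = 1 := by
  have h := Matrix.J_det_mul_J_det (Fin d) ℝ
  have h2 : |(Matrix.J (Fin d) ℝ).det| ^ 2 = 1 := by rw [sq_abs, sq, h]
  exact (pow_eq_one_iff_of_nonneg (abs_nonneg _) two_ne_zero).1 h2

/-- The `j`-th Fourier coefficient of the Moyal square of the window. -/
def moyalCoeff (N : ℕ) (Gh : Phase d → ℂ) (k : Phase d) : ℂ :=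
  ∫ η, ee ((2 * N : ℝ)⁻¹ * sigma k η) * (Gh η * Gh (k + -η))

theorem norm_smul_jmul_le {N : ℕ} (hN : 0 < N) (s : Phase d) : ‖(2 * N : ℝ)⁻¹ • jmul s‖ ≤ ‖s‖ := by
  have h2 : (1 : ℝ) ≤ N := by exact_mod_cast hN
  rw [norm_smul]
  calc _ ≤ 1 * ‖s‖ := by
        gcongr
        · rw [Real.norm_of_nonneg (by positivity)]
          exact inv_le_one_of_one_le₀ (by linarith)
        · exact norm_jmul s
    _ = _ := one_mul _

namespace IsWindow

variable {G Gh : Phase d → ℂ} (hG : IsWindow G Gh) {N : ℕ} (hN : 0 < N)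
include hG hN

/-- The `w₂`-integral is, up to a phase, the Fourier transform of `G` at `η = -2N J w₁`. Since `πħ =
(2N)⁻¹`, the Jacobian of this change of variables cancels the prefactor. -/
theorem moyal_eq (ρ : Phase d) : moyal (hbar N) G G ρ =
    ∫ η, ee (η ⬝ᵥ ρ) * (Gh η * G (ρ + (2 * N : ℝ)⁻¹ • jmul η)) := by
  have hN0 : (N : ℝ) ≠ 0 := by exact_mod_cast hN.ne'
  set K : Phase d → ℂ := fun η => ee (η ⬝ᵥ ρ) * (Gh η * G (ρ + (2 * N : ℝ)⁻¹ • jmul η)) with hK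
  have h1 : ∀ w₁ : Phase d, ∫ w₂ : Phase d,
      Complex.exp (-Complex.I * ((2 / hbar N * sigma w₁ w₂ : ℝ) : ℂ)) * G (ρ + w₁) * G (ρ + w₂) =
      K ((-(2 * N : ℝ) • Matrix.J (Fin d) ℝ) *ᵥ w₁) := by
    intro w
    set ζ : Phase d := (-(2 * N : ℝ) • Matrix.J (Fin d) ℝ) *ᵥ w with hζ
    have hζ' : ζ = -(2 * N : ℝ) • jmul w := by rw [hζ, Matrix.smul_mulVec]; rfl
    have hζs : ∀ y, ζ ⬝ᵥ y = 2 * N * sigma w y := by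
      intro y; rw [hζ', smul_dotProduct, jmul_dotProduct, smul_eq_mul]; ring
    have e1 : ∀ w₂ : Phase d,
        Complex.exp (-Complex.I * ((2 / hbar N * sigma w w₂ : ℝ) : ℂ)) * G (ρ + w) * G (ρ + w₂) =
        (fun y => (G (ρ + w) * ee (ζ ⬝ᵥ ρ)) * (ee (-(ζ ⬝ᵥ y)) * G y)) (ρ + w₂) := by
      intro w₂
      have e2 : Complex.exp (-Complex.I * ((2 / hbar N * sigma w w₂ : ℝ) : ℂ)) =
          ee (-(2 * N * sigma w w₂)) := by
        rw [ee, hbar]; congr 1; push_cast; field_simp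
      simp only
      rw [e2, dotProduct_add, neg_add, ee_add, ← hζs]
      have e3 : ee (ζ ⬝ᵥ ρ) * ee (-(ζ ⬝ᵥ ρ)) = 1 := by rw [← ee_add, add_neg_cancel, ee_zero]
      linear_combination (-G (ρ + w) * ee (-(ζ ⬝ᵥ w₂)) * G (ρ + w₂)) * e3
    simp only [e1]
    rw [integral_add_left_eq_self (fun y => (G (ρ + w) * ee (ζ ⬝ᵥ ρ)) * (ee (-(ζ ⬝ᵥ y)) * G y)) ρ,
      integral_const_mul, hG.fourier]
    simp only [hK]
    have e4 : (2 * N : ℝ)⁻¹ • jmul ζ = w := by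
      rw [hζ', jmul_smul, jmul_jmul, smul_smul, smul_neg, mul_neg, inv_mul_cancel₀ (by positivity)]
      simp
    rw [e4]; ring
  rw [moyal]
  simp only [h1]
  have hdet : (-(2 * N : ℝ) • Matrix.J (Fin d) ℝ).det ≠ 0 := by
    rw [Matrix.det_smul]
    refine mul_ne_zero (pow_ne_zero _ (by simpa using hN0)) ?_
    rw [← abs_ne_zero, abs_det_J]; exact one_ne_zero
  rw [integral_comp_mulVec hdet, Matrix.det_smul, abs_mul, abs_det_J, mul_one, abs_pow, abs_neg,
    abs_of_pos (by positivity), Fintype.card_sum, Fintype.card_fin, ← two_mul, Complex.real_smul,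
    ← mul_assoc, ← Complex.ofReal_mul]
  have h2 : Real.pi * hbar N = (2 * N : ℝ)⁻¹ := by rw [hbar]; field_simp
  rw [h2, inv_pow, inv_inv, mul_inv_cancel₀ (by positivity), Complex.ofReal_one, one_mul]

theorem rapidDecay_moyal : RapidDecay (moyal (hbar N) G G) := by
  have h : moyal (hbar N) G G = fun ρ =>
      ∫ η, ee (η ⬝ᵥ ρ) * (Gh η * G (ρ + (2 * N : ℝ)⁻¹ • jmul η)) := funext (hG.moyal_eq hN)
  rw [h]
  exact hG.rapidDecay_fourier.rapidDecay_integral_mul hG.rapidDecay (norm_smul_jmul_le hN)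
    (u := fun ρ η => ee (η ⬝ᵥ ρ)) fun _ _ => (norm_ee _).le

theorem continuous_moyal : Continuous (moyal (hbar N) G G) := by
  have h : moyal (hbar N) G G = fun ρ =>
      ∫ η, ee (η ⬝ᵥ ρ) * (Gh η * G (ρ + (2 * N : ℝ)⁻¹ • jmul η)) := funext (hG.moyal_eq hN)
  rw [h]
  obtain ⟨C, hC0, hC⟩ := hG.rapidDecay.exists_le 0
  have hi := hG.rapidDecay_fourier.integrable (μ := volume) hG.continuous_fourier.aestronglyMeasurable
  have c1 := hG.continuous
  have c2 := hG.continuous_fourier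
  have c3 := continuous_jmul (d := d)
  refine continuous_of_dominated (bound := fun η => ‖Gh η‖ * C) (fun ρ => ?_) (fun ρ => ?_)
    (hi.norm.mul_const _) (Filter.Eventually.of_forall fun η => ?_)
  · refine Continuous.aestronglyMeasurable ?_
    simp only [dotProduct]; fun_prop
  · refine Filter.Eventually.of_forall fun η => ?_
    rw [norm_mul, norm_ee, one_mul, norm_mul]
    gcongr
    simpa using hC (ρ + (2 * N : ℝ)⁻¹ • jmul η)
  · simp only [dotProduct]; fun_prop

/-- A convolution of `Gh` with itself, twisted: translating `G` by `-(2N)⁻¹ J η` gives the phase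
`(2N)⁻¹ ⟨k - η, J η⟩ = (2N)⁻¹ σ(k, η)`. -/
theorem fourier_moyal (k : Phase d) :
    ∫ ρ, ee (-(k ⬝ᵥ ρ)) * moyal (hbar N) G G ρ = moyalCoeff N Gh k := by
  have c1 := hG.continuous
  have c2 := hG.continuous_fourier
  have c3 := continuous_jmul (d := d)
  simp only [hG.moyal_eq hN, ← integral_const_mul]
  rw [integral_integral_swap]
  · rw [moyalCoeff]
    congr 1; ext η
    have h1 : ∀ ρ, ee (-(k ⬝ᵥ ρ)) * (ee (η ⬝ᵥ ρ) * (Gh η * G (ρ + (2 * N : ℝ)⁻¹ • jmul η))) =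
        (fun y => (Gh η * ee ((2 * N : ℝ)⁻¹ * sigma k η)) * (ee (-((k + -η) ⬝ᵥ y)) * G y))
          (ρ + (2 * N : ℝ)⁻¹ • jmul η) := by
      intro ρ
      have e1 : ee (-(k ⬝ᵥ ρ)) * ee (η ⬝ᵥ ρ) = ee ((2 * N : ℝ)⁻¹ * sigma k η) *
          ee (-((k + -η) ⬝ᵥ (ρ + (2 * N : ℝ)⁻¹ • jmul η))) := by
        rw [← ee_add, ← ee_add]
        congr 1
        have e2 : ∀ s : Phase d, s ⬝ᵥ jmul η = sigma s η := fun s => rfl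
        rw [dotProduct_add, dotProduct_smul, e2, add_dotProduct, neg_dotProduct, sigma_add_left,
          sigma_neg_left, sigma_self, smul_eq_mul]
        ring
      simp only
      linear_combination (Gh η * G (ρ + (2 * N : ℝ)⁻¹ • jmul η)) * e1
    simp only [h1]
    rw [integral_add_right_eq_self (fun y => (Gh η * ee ((2 * N : ℝ)⁻¹ * sigma k η)) *
      (ee (-((k + -η) ⬝ᵥ y)) * G y)), integral_const_mul, hG.fourier]
    ring
  · set D := Module.finrank ℝ (Phase d) + 1
    obtain ⟨C, hC0, hC⟩ := hG.rapidDecay_fourier.exists_mul_le hG.rapidDecay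
      (norm_smul_jmul_le hN) D D
    have hi := integrable_inv_one_add_norm_pow (volume : Measure (Phase d))
    refine ((hi.mul_prod hi).const_mul C).mono' ?_ (Filter.Eventually.of_forall fun p => ?_)
    · refine Continuous.aestronglyMeasurable ?_
      simp only [dotProduct]; fun_prop
    · simp only [Function.uncurry]
      rw [norm_mul, norm_mul, norm_ee, norm_ee, one_mul, one_mul, norm_mul]
      exact hC _ _

omit hN in
theorem rapidDecay_moyalCoeff (N : ℕ) : RapidDecay (moyalCoeff N Gh) :=
  hG.rapidDecay_fourier.rapidDecay_integral_mul hG.rapidDecay_fourier (T := fun η => -η)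
    (fun η => (norm_neg η).le) (u := fun k η => ee ((2 * N : ℝ)⁻¹ * sigma k η))
    fun _ _ => (norm_ee _).le

-- At `k = 0` the twist disappears and evenness leaves the normalization integral of the window.
-- This is the source of `Op⁺(1) = Id`.
omit hN in
theorem moyalCoeff_zero (N : ℕ) : moyalCoeff N Gh 0 = 1 := by
  rw [moyalCoeff, ← hG.integral_sq]
  congr 1; ext η
  rw [zero_add, hG.even, sigma_comm]
  have : sigma η 0 = 0 := by simp [sigma_eq]
  simp [this]

end IsWindow

theorem integral_unitCube_tsum_translate {ι : Type*} [Fintype ι] {f : (ι → ℝ) → ℂ}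
    (hf : Integrable f) : ∫ x in unitCube ι, ∑' n : ι → ℤ, f (x + intVec n) = ∫ x, f x := by
  rw [← (hasSum_integral_unitCube hf).tsum_eq]
  refine (integral_tsum_of_summable_integral_norm (fun n => ?_) ?_).symm
  · exact (hf.comp_add_right _).integrableOn
  · exact (hasSum_integral_unitCube hf.norm).summable

/-- The Fourier coefficients of a periodic function. -/
def fourierCoeffZ (a : Phase d → ℝ) (k : Fin d ⊕ Fin d → ℤ) : ℂ :=
  ∫ x in unitCube (Fin d ⊕ Fin d), (a x : ℂ) * ee (-(intVec k ⬝ᵥ x))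

theorem isFiniteMeasure_unitCube {ι : Type*} [Fintype ι] :
    IsProbabilityMeasure (volume.restrict (unitCube ι : Set (ι → ℝ))) :=
  ⟨by simp [volume_unitCube]⟩

theorem norm_fourierCoeffZ_le {a : Phase d → ℝ} {C : ℝ} (hC : ∀ x, |a x| ≤ C)
    (k : Fin d ⊕ Fin d → ℤ) : ‖fourierCoeffZ a k‖ ≤ C := by
  have := isFiniteMeasure_unitCube (ι := Fin d ⊕ Fin d)
  have h := norm_integral_le_of_norm_le_const (μ := volume.restrict (unitCube (Fin d ⊕ Fin d)))
    (f := fun x => (a x : ℂ) * ee (-(intVec k ⬝ᵥ x))) (C := C)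
    (Filter.Eventually.of_forall fun x => by
      rw [norm_mul, norm_ee, mul_one, Complex.norm_real]; exact hC x)
  simpa [fourierCoeffZ] using h

/-- The coefficients of `a` need only be bounded; all the decay comes from the window. -/
theorem IsWindow.rapidCoeff_mul {G Gh : Phase d → ℂ} (hG : IsWindow G Gh) (N : ℕ)
    {a : Phase d → ℝ} {C : ℝ} (hC : ∀ x, |a x| ≤ C) :
    RapidCoeff fun k => fourierCoeffZ a k * moyalCoeff N Gh (intVec k) := by
  intro M
  refine Summable.of_nonneg_of_le (fun k => by positivity) (fun k => ?_)
    (((hG.rapidDecay_moyalCoeff N).rapidCoeff M).mul_left C)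
  rw [norm_mul, mul_left_comm C]
  gcongr
  exact norm_fourierCoeffZ_le hC k

/-- Periodicity of `a` folds the convolution into an integral over the cube against the periodized
Moyal square; Poisson summation and termwise integration then multiply the Fourier coefficients. -/
theorem IsWindow.hasSum_conv_moyal {G Gh : Phase d → ℂ} (hG : IsWindow G Gh) {N : ℕ} (hN : 0 < N)
    {a : Phase d → ℝ} (hac : Continuous a) {C : ℝ} (hC : ∀ x, |a x| ≤ C)
    (hap : ∀ r x, a (x + intVec r) = a x) (ρ : Phase d) :
    HasSum (fun k => (fourierCoeffZ a k * moyalCoeff N Gh (intVec k)) * ee (intVec k ⬝ᵥ ρ))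
      (conv a (moyal (hbar N) G G) ρ) := by
  have := isFiniteMeasure_unitCube (ι := Fin d ⊕ Fin d)
  set Φ := moyal (hbar N) G G with hΦ
  have hΦc : Continuous Φ := hG.continuous_moyal hN
  have hΦd : RapidDecay Φ := hG.rapidDecay_moyal hN
  have hΦi : Integrable Φ := hΦd.integrable hΦc.aestronglyMeasurable
  have hm : Summable fun k : Fin d ⊕ Fin d → ℤ => ‖moyalCoeff N Gh (intVec k)‖ :=
    (hG.rapidDecay_moyalCoeff N).summable_intVec
  have hC' : ∀ x, ‖(a x : ℂ)‖ ≤ C := fun x => by rw [Complex.norm_real]; exact hC x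
  have hi : Integrable fun ρ₀ => (a ρ₀ : ℂ) * Φ (ρ - ρ₀) :=
    (hΦi.comp_sub_left ρ).bdd_mul (c := C) (by fun_prop) (Filter.Eventually.of_forall hC')
  have h1 : ∀ y, ∑' n, Φ (y + intVec n) = ∑' k, moyalCoeff N Gh (intVec k) * ee (intVec k ⬝ᵥ y) := by
    intro y
    have h2 := hasSum_poisson hΦc hΦd (by simpa only [hΦ, hG.fourier_moyal hN] using hm) y
    simp only [hΦ, hG.fourier_moyal hN] at h2
    exact h2.tsum_eq.symm
  set F : (Fin d ⊕ Fin d → ℤ) → Phase d → ℂ := fun k x =>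
    (moyalCoeff N Gh (intVec k) * ee (intVec k ⬝ᵥ ρ)) * ((a x : ℂ) * ee (-(intVec k ⬝ᵥ x))) with hF
  have h3 : ∀ x, ∑' n, (a (x + intVec n) : ℂ) * Φ (ρ - (x + intVec n)) = ∑' k, F k x := by
    intro x
    simp only [hap]
    rw [tsum_mul_left, ← (Equiv.neg _).tsum_eq]
    have e1 : ∀ n : Fin d ⊕ Fin d → ℤ, ρ - (x + intVec (Equiv.neg _ n)) = (ρ - x) + intVec n := by
      intro n; rw [Equiv.neg_apply, intVec_neg]; abel
    simp only [e1]
    rw [h1, ← tsum_mul_left]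
    refine tsum_congr fun k => ?_
    rw [dotProduct_sub, sub_eq_add_neg, ee_add]
    simp only [hF]
    ring
  rw [conv, ← integral_unitCube_tsum_translate hi]
  simp only [h3]
  have hFi : ∀ k, IntegrableOn (F k) (unitCube (Fin d ⊕ Fin d)) := by
    intro k
    refine Integrable.const_mul ?_ _
    refine Integrable.of_bound (C := C) ?_ (Filter.Eventually.of_forall fun x => ?_)
    · refine Continuous.aestronglyMeasurable ?_
      simp only [dotProduct]; fun_prop
    · rw [norm_mul, norm_ee, mul_one]; exact hC' x
  have h4 := hasSum_integral_of_summable_integral_norm hFi (by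
    refine Summable.of_nonneg_of_le (fun k => integral_nonneg fun x => norm_nonneg _) (fun k => ?_)
      (hm.mul_right C)
    have : ∀ x, ‖F k x‖ ≤ ‖moyalCoeff N Gh (intVec k)‖ * C := fun x => by
      simp only [hF]
      rw [norm_mul, norm_mul, norm_mul, norm_ee, norm_ee, mul_one, mul_one]
      gcongr; exact hC' x
    have h5 := integral_mono_of_nonneg (μ := volume.restrict (unitCube (Fin d ⊕ Fin d)))
      (Filter.Eventually.of_forall fun x => norm_nonneg (F k x)) (integrable_const _)
      (Filter.Eventually.of_forall this)
    simpa using h5)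
  refine Eq.mp ?_ h4
  congr 1
  ext k
  simp only [hF]
  rw [integral_const_mul, fourierCoeffZ]
  ring

end

/-! ### Localized operators and the decomposition of `Op⁺` -/

section

variable {d : ℕ}

/-- The Fourier coefficients of `T_ρ(G^{ρ₀})`. -/
def locCoeff (N : ℕ) (Gh : Phase d → ℂ) (ρ ρ₀ : Phase d) (k : Fin d ⊕ Fin d → ℤ) : ℂ :=
  ee (-((2 * N : ℝ)⁻¹ * sigma (intVec k) ρ)) * ee (-((intVec k + -ρ) ⬝ᵥ ρ₀)) * Gh (intVec k + -ρ)

/-- The uniform bound on the torus for the Fourier coefficients of `T_ρ(G^{ρ₀})`. -/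
theorem IsWindow.exists_norm_locCoeff_le {G Gh : Phase d → ℂ} (hG : IsWindow G Gh) (N : ℕ) :
    ∃ b : (Fin d ⊕ Fin d → ℤ) → ℝ, Summable b ∧ (∀ k, 0 ≤ b k) ∧
      ∀ ρ ∈ unitCube (Fin d ⊕ Fin d), ∀ ρ₀ k, ‖locCoeff N Gh ρ ρ₀ k‖ ≤ b k := by
  obtain ⟨C, hC0, hC⟩ := hG.rapidDecay_fourier.exists_translate_le
    (Fintype.card (Fin d ⊕ Fin d) + 1) 1
  refine ⟨_, summable_inv_one_add_norm_intVec_pow.mul_left C, fun k => by positivity,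
    fun ρ hρ ρ₀ k => ?_⟩
  rw [locCoeff, norm_mul, norm_mul, norm_ee, norm_ee, one_mul, one_mul]
  exact hC _ _ (by rw [norm_neg]; exact norm_le_one_of_mem_unitCube hρ)

theorem IsWindow.rapidCoeff_locCoeff {G Gh : Phase d → ℂ} (hG : IsWindow G Gh) (N : ℕ)
    (ρ ρ₀ : Phase d) : RapidCoeff (locCoeff N Gh ρ ρ₀) := by
  intro M
  refine ((hG.rapidDecay_fourier.comp_add (-ρ)).rapidCoeff M).congr fun k => ?_
  rw [locCoeff, norm_mul, norm_mul, norm_ee, norm_ee, one_mul, one_mul]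

/-- Poisson summation for `f y = ee (y · ρ) G (y - v)` with `v = (2N)⁻¹ J ρ + ρ₀`: the modulation
shifts `Gh` by `ρ`, and the translation by `v` gives the two phases of `locCoeff`. -/
theorem IsWindow.hasSum_periodize {G Gh : Phase d → ℂ} (hG : IsWindow G Gh) (N : ℕ)
    (ρ ρ₀ x : Phase d) :
    HasSum (fun k => locCoeff N Gh ρ ρ₀ k * ee (intVec k ⬝ᵥ x))
      (periodize N ρ (fun ρ' => G (ρ' - ρ₀)) x) := by
  have c1 := hG.continuous
  set v : Phase d := (2 * N : ℝ)⁻¹ • jmul ρ + ρ₀ with hv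
  set f : Phase d → ℂ := fun y => ee (y ⬝ᵥ ρ) * G (y + -v) with hf
  have hfc : Continuous f := by
    simp only [hf, dotProduct]; fun_prop
  have hfd : RapidDecay f :=
    (hG.rapidDecay.comp_add (-v)).of_norm_le 1 fun y => by rw [norm_mul, norm_ee]
  have hcoef : ∀ k : Fin d ⊕ Fin d → ℤ, ∫ t, ee (-(intVec k ⬝ᵥ t)) * f t = locCoeff N Gh ρ ρ₀ k := by
    intro k
    have h1 : ∀ t, ee (-(intVec k ⬝ᵥ t)) * f t = (fun y => ee (-((intVec k + -ρ) ⬝ᵥ v)) *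
        (ee (-((intVec k + -ρ) ⬝ᵥ y)) * G y)) (t + -v) := by
      intro t
      simp only [hf]
      rw [← mul_assoc, ← mul_assoc, ← ee_add, ← ee_add]
      congr 2
      rw [dotProduct_add _ t (-v), dotProduct_neg _ v, add_dotProduct _ _ t, neg_dotProduct,
        dotProduct_comm t ρ]
      ring
    simp only [h1]
    rw [integral_add_right_eq_self (fun y => ee (-((intVec k + -ρ) ⬝ᵥ v)) *
        (ee (-((intVec k + -ρ) ⬝ᵥ y)) * G y)), integral_const_mul, hG.fourier, locCoeff, ← ee_add]
    congr 2
    have e2 : ∀ s : Phase d, s ⬝ᵥ jmul ρ = sigma s ρ := fun s => rfl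
    rw [hv, dotProduct_add, dotProduct_smul, e2, sigma_add_left, sigma_neg_left, sigma_self,
      smul_eq_mul]
    ring
  have h := hasSum_poisson hfc hfd (by
    simp only [hcoef]
    exact (hG.rapidCoeff_locCoeff N ρ ρ₀).summable_norm) x
  simp only [hcoef] at h
  have h2 : periodize N ρ (fun ρ' => G (ρ' - ρ₀)) x = ∑' n : Fin d ⊕ Fin d → ℤ, f (x + intVec n) := by
    rw [periodize]
    refine tsum_congr fun r => ?_
    simp only [hf, hv]
    rw [mul_comm]
    congr 1
    · rw [ee, add_comm x]; rfl
    · congr 1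
      rw [one_div]
      change x + intVec r - _ • jmul ρ - ρ₀ = _
      abel
  rw [h2]; exact h

section
variable {N : ℕ} {κ : Phase d} (H : TorusHilbert N κ) {G Gh : Phase d → ℂ}

theorem IsWindow.hasSum_opLoc (hG : IsWindow G Gh) (hN : 0 < N) (ρ ρ₀ : Phase d)
    (u : torusSpace N κ) :
    HasSum (fun k => locCoeff N Gh ρ ρ₀ k • H.toS (shift N κ (jZ k) u))
      (H.toS (opLoc N κ G ρ ρ₀ u)) :=
  hasSum_toS_opW hN H (hG.rapidCoeff_locCoeff N ρ ρ₀) (hG.hasSum_periodize N ρ ρ₀) u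

theorem TorusHilbert.ip_shift_jZ (hN : 0 < N) (k l : Fin d ⊕ Fin d → ℤ) (u : torusSpace N κ) :
    H.ip (shift N κ (jZ k) u) (shift N κ (jZ l) u) =
      ee (-((2 * N : ℝ)⁻¹ * sigma (intVec k) (intVec l))) * H.ip u (shift N κ (jZ (l - k)) u) := by
  rw [← H.ip_shift (-jZ k), shift_neg_shift hN, shift_shift hN, H.ip_smul_right, intVec_neg,
    intVec_jZ, intVec_jZ, sigma_neg_left, sigma_jmul_jmul, ← jZ_neg, ← jZ_add, mul_neg]
  rw [neg_add_eq_sub]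

/-- The probability measure on `𝕋^{2d} × 𝕋^{2d}`. -/
def torusMeasure (d : ℕ) : Measure (Phase d × Phase d) :=
  (volume.restrict (unitCube (Fin d ⊕ Fin d))).prod (volume.restrict (unitCube (Fin d ⊕ Fin d)))

instance : IsProbabilityMeasure (torusMeasure d) := by
  have := isFiniteMeasure_unitCube (ι := Fin d ⊕ Fin d)
  unfold torusMeasure; infer_instance

theorem ae_torusMeasure (d : ℕ) : ∀ᵐ p ∂torusMeasure d,
    p ∈ unitCube (Fin d ⊕ Fin d) ×ˢ unitCube (Fin d ⊕ Fin d) := by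
  rw [torusMeasure, Measure.prod_restrict]
  exact ae_restrict_mem (measurableSet_unitCube.prod measurableSet_unitCube)

theorem IsWindow.continuous_locCoeff (hG : IsWindow G Gh) (N : ℕ) (k : Fin d ⊕ Fin d → ℤ) :
    Continuous fun p : Phase d × Phase d => locCoeff N Gh p.1 p.2 k := by
  have c2 := hG.continuous_fourier
  simp only [locCoeff, sigma_eq, dotProduct]; fun_prop

/-- The decomposition of the positive quantization over the localized operators. -/
theorem IsWindow.integral_ip_opLoc (hG : IsWindow G Gh) (hN : 0 < N)
    {a : Phase d → ℝ} (hac : Continuous a) {C : ℝ} (hC : ∀ x, |a x| ≤ C)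
    (hap : ∀ r x, a (x + intVec r) = a x) (u : torusSpace N κ) :
    ∫ p, (a p.2 : ℂ) * H.ip (opLoc N κ G p.1 p.2 u) (opLoc N κ G p.1 p.2 u) ∂torusMeasure d =
      H.ip u (opPlus N κ G a u) := by
  have := isFiniteMeasure_unitCube (ι := Fin d ⊕ Fin d)
  set vv : (Fin d ⊕ Fin d → ℤ) → torusSpace N κ := fun k => shift N κ (jZ k) u with hvv
  obtain ⟨b, hbs, hb0, hb⟩ := hG.exists_norm_locCoeff_le N
  have hC0 : 0 ≤ C := (abs_nonneg _).trans (hC 0)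
  set T : (Fin d ⊕ Fin d → ℤ) × (Fin d ⊕ Fin d → ℤ) → Phase d × Phase d → ℂ := fun q p =>
    (a p.2 : ℂ) * ((starRingEnd ℂ) (locCoeff N Gh p.1 p.2 q.1) * locCoeff N Gh p.1 p.2 q.2 *
      H.ip (vv q.1) (vv q.2)) with hT
  have hip : ∀ k l, ‖H.ip (vv k) (vv l)‖ ≤ ‖H.toS u‖ * ‖H.toS u‖ := by
    intro k l
    rw [← H.inner_toS]
    refine (norm_inner_le_norm _ _).trans (le_of_eq ?_)
    rw [hvv, H.norm_toS_shift, H.norm_toS_shift]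
  set S := unitCube (Fin d ⊕ Fin d) ×ˢ unitCube (Fin d ⊕ Fin d)
  have hTb : ∀ q, ∀ p ∈ S, ‖T q p‖ ≤ (C * (‖H.toS u‖ * ‖H.toS u‖)) * (b q.1 * b q.2) := by
    intro q p hp
    simp only [hT, norm_mul, RCLike.norm_conj, Complex.norm_real]
    calc _ ≤ C * (b q.1 * b q.2 * (‖H.toS u‖ * ‖H.toS u‖)) := by
          have h1 := mul_le_mul (hb _ hp.1 p.2 q.1) (hb _ hp.1 p.2 q.2) (norm_nonneg _) (hb0 q.1)
          exact mul_le_mul (hC _) (mul_le_mul h1 (hip _ _) (norm_nonneg _)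
            (mul_nonneg (hb0 _) (hb0 _))) (by positivity) hC0
      _ = _ := by ring
  have hbb : Summable fun q : (Fin d ⊕ Fin d → ℤ) × (Fin d ⊕ Fin d → ℤ) =>
      (C * (‖H.toS u‖ * ‖H.toS u‖)) * (b q.1 * b q.2) :=
    (hbs.mul_of_nonneg hbs hb0 hb0).mul_left _
  have hpt : ∀ p ∈ S, (a p.2 : ℂ) * H.ip (opLoc N κ G p.1 p.2 u) (opLoc N κ G p.1 p.2 u) =
      ∑' q, T q p := by
    intro p hp
    have hs : Summable fun q => T q p := Summable.of_norm_bounded hbb fun q => hTb q p hp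
    rw [hs.tsum_prod, ← H.inner_toS]
    have h1 := hG.hasSum_opLoc H hN p.1 p.2 u
    have h2 : ∀ w : H.Space, HasSum (fun l => locCoeff N Gh p.1 p.2 l *
        inner ℂ w (H.toS (vv l))) (inner ℂ w (H.toS (opLoc N κ G p.1 p.2 u))) := by
      intro w
      have := h1.mapL (innerSL ℂ w)
      simpa only [map_smul, smul_eq_mul, innerSL_apply_apply] using this
    have h3 : HasSum (fun k => (starRingEnd ℂ) (locCoeff N Gh p.1 p.2 k) *
        inner ℂ (H.toS (vv k)) (H.toS (opLoc N κ G p.1 p.2 u)))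
        (inner ℂ (H.toS (opLoc N κ G p.1 p.2 u)) (H.toS (opLoc N κ G p.1 p.2 u))) := by
      have h4 := (h2 (H.toS (opLoc N κ G p.1 p.2 u))).map (starRingEnd ℂ) Complex.continuous_conj
      simp only [Function.comp_def, map_mul, inner_conj_symm] at h4
      exact h4
    rw [← h3.tsum_eq, ← tsum_mul_left]
    refine tsum_congr fun k => ?_
    rw [← (h2 (H.toS (vv k))).tsum_eq, ← tsum_mul_left, ← tsum_mul_left]
    refine tsum_congr fun l => ?_
    simp only [hT, H.inner_toS]
    ring
  have hTm : ∀ q, AEStronglyMeasurable (T q) (torusMeasure d) := by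
    intro q
    have c1 := hG.continuous_locCoeff N q.1
    have c2 := hG.continuous_locCoeff N q.2
    refine Continuous.aestronglyMeasurable ?_
    simp only [hT]
    have c3 : Continuous fun p : Phase d × Phase d =>
      (starRingEnd ℂ) (locCoeff N Gh p.1 p.2 q.1) := Complex.continuous_conj.comp c1
    fun_prop
  have hTi : ∀ q, Integrable (T q) (torusMeasure d) := fun q =>
    Integrable.of_bound (hTm q) _ ((ae_torusMeasure d).mono fun p hp => hTb q p hp)
  have hTn : Summable fun q => ∫ p, ‖T q p‖ ∂torusMeasure d := by
    refine Summable.of_nonneg_of_le (fun q => integral_nonneg fun p => norm_nonneg _) (fun q => ?_) hbb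
    have h := integral_mono_ae (hTi q).norm (integrable_const _)
      ((ae_torusMeasure d).mono fun p hp => hTb q p hp)
    simpa using h
  rw [integral_congr_ae ((ae_torusMeasure d).mono fun p hp => hpt p hp),
    ← integral_tsum_of_summable_integral_norm hTi hTn]
  -- For a pair `(k, l)` of frequencies the new indices are `j = l - k` and `n = -l`. Up to a phase
  -- the inner product of the shifted vectors depends on `j` only, and the sum over `n` unfolds the
  -- cube of `ρ` into all of `ℝ^{2d}`.
  set e : (Fin d ⊕ Fin d → ℤ) × (Fin d ⊕ Fin d → ℤ) ≃ (Fin d ⊕ Fin d → ℤ) × (Fin d ⊕ Fin d → ℤ) :=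
    { toFun := fun q => (-q.2 - q.1, -q.2)
      invFun := fun q => (q.2 - q.1, -q.2)
      left_inv := fun q => by ext <;> simp
      right_inv := fun q => by ext <;> simp } with he
  set h : (Fin d ⊕ Fin d → ℤ) → Phase d → ℂ := fun j η =>
    ee ((2 * N : ℝ)⁻¹ * sigma (intVec j) η) * (Gh η * Gh (intVec j + -η)) with hh
  have hTe : ∀ j n p, T (e (j, n)) p = H.ip u (vv j) *
      (h j (-(p.1 + intVec n)) * ((a p.2 : ℂ) * ee (-(intVec j ⬝ᵥ p.2)))) := by
    intro j n p
    have e0 : (e (j, n)).1 = -n - j := rfl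
    have e1 : (e (j, n)).2 = -n := rfl
    simp only [hT, e0, e1, hvv, hh]
    rw [H.ip_shift_jZ hN, show -n - (-n - j) = j by abel]
    simp only [locCoeff, map_mul, conj_ee, hG.conj]
    have e2 : intVec j + - -(p.1 + intVec n) =
        -(intVec (-n - j) + -p.1) := by rw [intVec_sub, intVec_neg]; abel
    have e3 : -(p.1 + intVec n) = intVec (-n) + -p.1 := by rw [intVec_neg]; abel
    rw [e2, hG.even (intVec (-n - j) + -p.1), e3]
    -- All phases collapse to the Moyal twist at `η = -(ρ + n)` times the character of frequency
    -- `-j` in `ρ₀`, whose integral against `a` is a Fourier coefficient.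
    have e4 : ee (- -((2 * N : ℝ)⁻¹ * sigma (intVec (-n - j)) p.1)) *
        ee (- -((intVec (-n - j) + -p.1) ⬝ᵥ p.2)) *
        (ee (-((2 * N : ℝ)⁻¹ * sigma (intVec (-n)) p.1)) * ee (-((intVec (-n) + -p.1) ⬝ᵥ p.2))) *
        ee (-((2 * N : ℝ)⁻¹ * sigma (intVec (-n - j)) (intVec (-n)))) =
        ee ((2 * N : ℝ)⁻¹ * sigma (intVec j) (intVec (-n) + -p.1)) * ee (-(intVec j ⬝ᵥ p.2)) := by
      simp only [← ee_add]
      congr 1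
      simp only [sub_eq_add_neg, intVec_add, intVec_neg, sigma_add_left, sigma_neg_left, sigma_add_right,
        sigma_neg_right, add_dotProduct, neg_dotProduct, sigma_self]
      ring
    linear_combination (a p.2 * Gh (intVec (-n) + -p.1) * Gh (intVec (-n - j) + -p.1) *
      H.ip u (shift N κ (jZ j) u)) * e4
  have hhi : ∀ j, Integrable (h j) := by
    intro j
    obtain ⟨D, hD0, hD⟩ := hG.rapidDecay_fourier.exists_le 0
    have hi := hG.rapidDecay_fourier.integrable (μ := volume)
      hG.continuous_fourier.aestronglyMeasurable
    have c2 := hG.continuous_fourier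
    refine integrable_ee_mul (Integrable.mul_bdd (c := D) hi (by fun_prop)
      (Filter.Eventually.of_forall fun η => by simpa using hD (intVec j + -η))) ?_
    exact (continuous_sigma_right _).const_mul _
  have hInt : ∀ j n, ∫ p, T (e (j, n)) p ∂torusMeasure d = (H.ip u (vv j) * fourierCoeffZ a j) *
      ∫ x in unitCube (Fin d ⊕ Fin d), h j (-(x + intVec n)) := by
    intro j n
    simp only [hTe]
    rw [integral_const_mul, torusMeasure, integral_prod_mul (fun x => h j (-(x + intVec n)))
      (fun x => (a x : ℂ) * ee (-(intVec j ⬝ᵥ x))), fourierCoeffZ]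
    ring
  have hsum : Summable fun q => ∫ p, T q p ∂torusMeasure d :=
    (hasSum_integral_of_summable_integral_norm hTi hTn).summable
  have hsum' := e.summable_iff.2 hsum
  rw [← e.tsum_eq]
  refine (Summable.tsum_prod hsum').trans ?_
  simp only [Function.comp_def]
  have hP : HasSum (fun k => fourierCoeffZ a k * moyalCoeff N Gh (intVec k) * H.ip u (vv k))
      (H.ip u (opPlus N κ G a u)) := by
    have h1 := hasSum_toS_opW hN H (hG.rapidCoeff_mul N hC) (hG.hasSum_conv_moyal hN hac hC hap) u
    have h2 := h1.mapL (innerSL ℂ (H.toS u))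
    simp only [map_smul, smul_eq_mul, innerSL_apply_apply] at h2
    exact h2
  rw [← hP.tsum_eq]
  refine tsum_congr fun j => ?_
  simp only [hInt]
  rw [tsum_mul_left]
  have h1 := hasSum_integral_unitCube (hhi j).comp_neg
  have h2 : ∫ x, h j (-x) = moyalCoeff N Gh (intVec j) := integral_neg_eq_self (h j) volume
  rw [h1.tsum_eq, h2]
  ring

end

end

/-! ### An entropic uncertainty principle by complex interpolation -/

section

section Entropic

variable {X : Type*} [MeasurableSpace X] {μ : Measure X}
  {E : Type*} [NormedAddCommGroup E] [InnerProductSpace ℂ E] [FiniteDimensional ℂ E]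

/-- The integral of `e^{z g} h` is an entire function of `z` when `g` and `h` are bounded. -/
theorem differentiable_integral_cexp_mul [IsProbabilityMeasure μ] {g : X → ℝ} {h : X → ℂ} {C Γ : ℝ}
    (hg : AEStronglyMeasurable g μ) (hh : AEStronglyMeasurable h μ)
    (hgb : ∀ x, |g x| ≤ Γ) (hhb : ∀ x, ‖h x‖ ≤ C) :
    Differentiable ℂ fun z : ℂ => ∫ x, Complex.exp (z * g x) * h x ∂μ := by
  intro z₀
  have hm : ∀ z : ℂ, AEStronglyMeasurable (fun x => Complex.exp (z * g x) * h x) μ := fun z =>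
    (Complex.continuous_exp.comp_aestronglyMeasurable
      ((Complex.continuous_ofReal.comp_aestronglyMeasurable hg).const_mul z)).mul hh
  have hexp : ∀ z : ℂ, ∀ x, ‖Complex.exp (z * g x)‖ ≤ Real.exp (‖z‖ * Γ) := fun z x => by
    rw [Complex.norm_exp]
    refine Real.exp_le_exp.2 ((Complex.re_le_norm _).trans ?_)
    rw [norm_mul, Complex.norm_real, Real.norm_eq_abs]
    exact mul_le_mul_of_nonneg_left (hgb x) (norm_nonneg _)
  have hb : ∀ z : ℂ, ∀ x, ‖Complex.exp (z * g x) * h x‖ ≤ Real.exp (‖z‖ * Γ) * C := fun z x => by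
    rw [norm_mul]
    exact mul_le_mul (hexp z x) (hhb x) (norm_nonneg _) (Real.exp_pos _).le
  refine (hasDerivAt_integral_of_dominated_loc_of_deriv_le
    (F := fun (z : ℂ) x => Complex.exp (z * g x) * h x)
    (F' := fun z x => Complex.exp (z * g x) * h x * g x)
    (bound := fun _ => Real.exp ((‖z₀‖ + 1) * Γ) * C * Γ)
    (Metric.ball_mem_nhds z₀ one_pos) (Filter.Eventually.of_forall hm)
    (Integrable.of_bound (hm z₀) _ (Filter.Eventually.of_forall (hb z₀)))
    ((hm z₀).mul (Complex.continuous_ofReal.comp_aestronglyMeasurable hg))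
    (Filter.Eventually.of_forall fun x z hz => ?_) (integrable_const _)
    (Filter.Eventually.of_forall fun x z _ => ?_)).2.differentiableAt
  · have hΓ : 0 ≤ Γ := (abs_nonneg _).trans (hgb x)
    have hC : 0 ≤ C := (norm_nonneg _).trans (hhb x)
    have hz' : ‖z‖ ≤ ‖z₀‖ + 1 := by
      have h1 : ‖z - z₀‖ < 1 := by simpa [dist_eq_norm] using hz
      have h2 := norm_add_le z₀ (z - z₀)
      rw [add_sub_cancel] at h2
      linarith
    rw [norm_mul, Complex.norm_real, Real.norm_eq_abs]
    refine mul_le_mul ((hb z x).trans ?_) (hgb x) (abs_nonneg _) (by positivity)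
    refine mul_le_mul_of_nonneg_right (Real.exp_le_exp.2 ?_) hC
    exact mul_le_mul_of_nonneg_right hz' hΓ
  · have h1 : HasDerivAt (fun z : ℂ => z * (g x : ℂ)) (g x : ℂ) z := by
      simpa using (hasDerivAt_id z).mul_const (g x : ℂ)
    exact (h1.cexp.mul_const (h x)).congr_deriv (by ring)

/-- A bounded measurable family of operators with `∫ W(x)* W(x) dμ(x) = 1`. -/
structure IsTightFamily (μ : Measure X) (W : X → E →L[ℂ] E) (B : ℝ) : Prop where
  aesm : AEStronglyMeasurable W μ
  norm_le : ∀ x, ‖W x‖ ≤ B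
  integral_norm_sq : ∀ u, ∫ x, ‖W x u‖ ^ 2 ∂μ = ‖u‖ ^ 2

namespace IsTightFamily

variable {W : X → E →L[ℂ] E} {B : ℝ}

theorem aesm_apply (hW : IsTightFamily μ W B) (u : E) : AEStronglyMeasurable (fun x => W x u) μ :=
  (ContinuousLinearMap.apply ℂ E u).continuous.comp_aestronglyMeasurable hW.aesm

theorem norm_apply_le (hW : IsTightFamily μ W B) (u : E) (x : X) : ‖W x u‖ ≤ B * ‖u‖ :=
  (W x).le_of_opNorm_le (hW.norm_le x) u

/-- The vector `W(x)* W(x) u`. -/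
def frame (W : X → E →L[ℂ] E) (u : E) (x : X) : E :=
  ContinuousLinearMap.adjoint (W x) (W x u)

theorem inner_frame (W : X → E →L[ℂ] E) (u v : E) (x : X) :
    inner ℂ v (frame W u x) = inner ℂ (W x v) (W x u) :=
  ContinuousLinearMap.adjoint_inner_right _ _ _

theorem aesm_adjoint_comp (hW : IsTightFamily μ W B) :
    AEStronglyMeasurable (fun x => ContinuousLinearMap.adjoint (W x) ∘L W x) μ := by
  have h : Continuous fun T : E →L[ℂ] E => ContinuousLinearMap.adjoint T ∘L T :=
    (ContinuousLinearMap.adjoint (𝕜 := ℂ) (E := E) (F := E)).continuous.clm_comp continuous_id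
  exact h.comp_aestronglyMeasurable hW.aesm

theorem aesm_frame (hW : IsTightFamily μ W B) (u : E) : AEStronglyMeasurable (frame W u) μ :=
  (ContinuousLinearMap.apply ℂ E u).continuous.comp_aestronglyMeasurable hW.aesm_adjoint_comp

theorem norm_frame_le (hW : IsTightFamily μ W B) (u : E) (x : X) :
    ‖frame W u x‖ ≤ B ^ 2 * ‖u‖ := by
  have hB : 0 ≤ B := (norm_nonneg _).trans (hW.norm_le x)
  refine (ContinuousLinearMap.le_opNorm _ _).trans ?_
  rw [LinearIsometryEquiv.norm_map, sq, mul_assoc]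
  exact mul_le_mul (hW.norm_le x) (hW.norm_apply_le u x) (norm_nonneg _) hB

theorem integrable_smul_frame [IsFiniteMeasure μ] (hW : IsTightFamily μ W B) (u : E) {φ : X → ℂ}
    {C : ℝ} (hφ : AEStronglyMeasurable φ μ) (hC : ∀ x, ‖φ x‖ ≤ C) :
    Integrable (fun x => φ x • frame W u x) μ := by
  refine Integrable.of_bound (hφ.smul (hW.aesm_frame u)) (C * (B ^ 2 * ‖u‖))
    (Filter.Eventually.of_forall fun x => ?_)
  rw [norm_smul]
  exact mul_le_mul (hC x) (hW.norm_frame_le u x) (norm_nonneg _) ((norm_nonneg _).trans (hC x))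

theorem integrable_norm_sq [IsFiniteMeasure μ] (hW : IsTightFamily μ W B) (u : E) :
    Integrable (fun x => ‖W x u‖ ^ 2) μ := by
  refine Integrable.of_bound ((hW.aesm_apply u).norm.pow 2) ((B * ‖u‖) ^ 2)
    (Filter.Eventually.of_forall fun x => ?_)
  rw [Real.norm_of_nonneg (by positivity)]
  exact pow_le_pow_left₀ (norm_nonneg _) (hW.norm_apply_le u x) 2

/-- The operator `∫ W* W` has the quadratic form of the identity, and over `ℂ` a quadratic form
determines its operator. -/
theorem integral_frame [IsFiniteMeasure μ] (hW : IsTightFamily μ W B) (u : E) :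
    ∫ x, frame W u x ∂μ = u := by
  set S : X → E →L[ℂ] E := fun x => ContinuousLinearMap.adjoint (W x) ∘L W x
  have hSi : Integrable S μ := by
    refine Integrable.of_bound hW.aesm_adjoint_comp (B * B) (Filter.Eventually.of_forall fun x => ?_)
    refine (ContinuousLinearMap.opNorm_comp_le _ _).trans ?_
    rw [LinearIsometryEquiv.norm_map]
    exact mul_le_mul (hW.norm_le x) (hW.norm_le x) (norm_nonneg _)
      ((norm_nonneg _).trans (hW.norm_le x))
  have h1 : ∀ v, (∫ x, S x ∂μ) v = ∫ x, frame W v x ∂μ := fun v =>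
    ContinuousLinearMap.integral_apply hSi v
  have h2 : ((∫ x, S x ∂μ : E →L[ℂ] E) : E →ₗ[ℂ] E) = LinearMap.id := by
    refine (ext_inner_map _ _).1 fun v => ?_
    rw [ContinuousLinearMap.coe_coe, h1, LinearMap.id_apply, ← inner_conj_symm, ← integral_inner]
    · simp only [inner_frame, inner_self_eq_norm_sq_to_K]
      have h3 := congrArg (Complex.ofReal) (hW.integral_norm_sq v)
      rw [← integral_complex_ofReal] at h3
      push_cast at h3
      exact (congrArg (starRingEnd ℂ) h3).trans (by simp)
    · have h4 := hW.integrable_smul_frame v (φ := fun _ => 1) (C := 1)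
        aestronglyMeasurable_const (by simp)
      simpa using h4
  rw [← h1 u, ← ContinuousLinearMap.coe_coe, h2, LinearMap.id_apply]

/-- With `v` the integral, `‖v‖² = ∫ φ ⟨W v, W u⟩ ≤ (‖v‖² + ‖u‖²)/2` by Cauchy–Schwarz, the
inequality of means and tightness. -/
theorem norm_integral_smul_frame_le [IsFiniteMeasure μ] (hW : IsTightFamily μ W B) (u : E)
    {φ : X → ℂ} (hφ : AEStronglyMeasurable φ μ) (hC : ∀ x, ‖φ x‖ ≤ 1) :
    ‖∫ x, φ x • frame W u x ∂μ‖ ≤ ‖u‖ := by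
  set v := ∫ x, φ x • frame W u x ∂μ with hv
  have hi := hW.integrable_smul_frame u hφ hC
  have h1 : ((‖v‖ ^ 2 : ℝ) : ℂ) = ∫ x, φ x * inner ℂ (W x v) (W x u) ∂μ := by
    have := inner_self_eq_norm_sq_to_K (𝕜 := ℂ) v
    push_cast
    rw [show ((‖v‖ : ℝ) : ℂ) ^ 2 = inner ℂ v v from this.symm]
    nth_rewrite 2 [hv]
    rw [← integral_inner hi]
    simp only [inner_smul_right, inner_frame]
  have h2 : ‖v‖ ^ 2 ≤ ∫ x, (1 / 2) * (‖W x v‖ ^ 2 + ‖W x u‖ ^ 2) ∂μ := by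
    have h3 : ‖((‖v‖ ^ 2 : ℝ) : ℂ)‖ = ‖v‖ ^ 2 := by
      rw [Complex.norm_real, Real.norm_of_nonneg (by positivity)]
    rw [← h3, h1]
    refine norm_integral_le_of_norm_le
      (((hW.integrable_norm_sq v).add (hW.integrable_norm_sq u)).const_mul _)
      (Filter.Eventually.of_forall fun x => ?_)
    rw [norm_mul]
    have h4 := norm_inner_le_norm (𝕜 := ℂ) (W x v) (W x u)
    have h5 := mul_le_mul (hC x) h4 (norm_nonneg _) zero_le_one
    rw [one_mul] at h5
    refine h5.trans ?_
    have h6 := two_mul_le_add_sq ‖W x v‖ ‖W x u‖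
    linarith
  rw [integral_const_mul, integral_add (hW.integrable_norm_sq v) (hW.integrable_norm_sq u),
    hW.integral_norm_sq, hW.integral_norm_sq] at h2
  exact le_of_sq_le_sq (by linarith) (norm_nonneg _)

end IsTightFamily

/-- A first order comparison at `t = 0`. -/
theorem le_of_one_add_le_exp {a l C t₀ : ℝ} (ht₀ : 0 < t₀)
    (h : ∀ t, 0 < t → t ≤ t₀ → 1 + 2 * t * a - t ^ 2 * C ≤ Real.exp (2 * t * l)) : a ≤ l := by
  by_contra hal
  push Not at hal
  have hC := abs_nonneg C
  have hl := abs_nonneg l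
  set D := |C| + 4 * l ^ 2 + 1 with hD
  have hD0 : 0 < D := by positivity
  -- The second entry gives `|2tl| ≤ 1`, so that `e^s ≤ 1 + s + s²` applies at `s = 2tl`; the third
  -- makes the quadratic errors at most `t (a - l)`, against a first order gap `2t (a - l)`.
  set t := min t₀ (min (1 / (2 * (|l| + 1))) ((a - l) / D)) with ht
  have htpos : 0 < t := by
    refine lt_min ht₀ (lt_min (by positivity) (div_pos (by linarith) hD0))
  have ht1 : t ≤ 1 / (2 * (|l| + 1)) := (min_le_right _ _).trans (min_le_left _ _)
  have ht2 : t ≤ (a - l) / D := (min_le_right _ _).trans (min_le_right _ _)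
  rw [le_div_iff₀ (by positivity)] at ht1
  rw [le_div_iff₀ hD0] at ht2
  have hs : |2 * t * l| ≤ 1 := by
    rw [abs_mul, abs_of_pos (by linarith : (0:ℝ) < 2 * t)]
    nlinarith
  have h1 := h t htpos (min_le_left _ _)
  have h2 := (abs_le.1 (Real.abs_exp_sub_one_sub_id_le hs)).2
  have h3 : t * (2 * (a - l)) ≤ t * (t * (C + 4 * l ^ 2)) := by nlinarith
  have h4 := le_of_mul_le_mul_left h3 htpos
  have h5 := le_abs_self C
  nlinarith

namespace IsTightFamily

variable [IsProbabilityMeasure μ] {W : X → E →L[ℂ] E} {B : ℝ} {U : E →L[ℂ] E} {ψ : E} {z₀ : ℂ} {c : ℝ}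

/-- The frame vectors of `u` averaged against `e^{z g}`. -/
def average (μ : Measure X) (W : X → E →L[ℂ] E) (u : E) (g : X → ℝ) (z : ℂ) : E :=
  ∫ x, Complex.exp (z * g x) • frame W u x ∂μ

theorem aesm_cexp {g : X → ℝ} (hg : AEStronglyMeasurable g μ) (z : ℂ) :
    AEStronglyMeasurable (fun x => Complex.exp (z * g x)) μ :=
  Complex.continuous_exp.comp_aestronglyMeasurable
    ((Complex.continuous_ofReal.comp_aestronglyMeasurable hg).const_mul z)

theorem norm_cexp_le {g : X → ℝ} {Γ : ℝ} (hgb : ∀ x, |g x| ≤ Γ) (z : ℂ) (x : X) :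
    ‖Complex.exp (z * g x)‖ ≤ Real.exp (|z.re| * Γ) := by
  rw [Complex.norm_exp]
  refine Real.exp_le_exp.2 ?_
  rw [Complex.re_mul_ofReal]
  refine (le_abs_self _).trans ?_
  rw [abs_mul]
  exact mul_le_mul_of_nonneg_left (hgb x) (abs_nonneg _)

/-- Fubini. The parameter is conjugated in the conjugate-linear slot, which keeps the expression
holomorphic in `z`. -/
theorem integral_prod_eq_inner_average (hW : IsTightFamily μ W B) {g : X → ℝ} {Γ : ℝ}
    (hg : AEStronglyMeasurable g μ) (hgb : ∀ x, |g x| ≤ Γ) (U : E →L[ℂ] E) (u : E) (z : ℂ)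
    (hint : Integrable (fun p : X × X => Complex.exp (z * (g p.1 + g p.2 : ℝ)) *
      inner ℂ (frame W u p.1) (U (frame W u p.2))) (μ.prod μ)) :
    ∫ p : X × X, Complex.exp (z * (g p.1 + g p.2 : ℝ)) *
        inner ℂ (frame W u p.1) (U (frame W u p.2)) ∂(μ.prod μ) =
      inner ℂ (average μ W u g (starRingEnd ℂ z)) (U (average μ W u g z)) := by
  have hi : ∀ z, Integrable (fun x => Complex.exp (z * g x) • frame W u x) μ := fun z =>
    hW.integrable_smul_frame u (aesm_cexp hg z) (norm_cexp_le hgb z)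
  have h1 : ∀ v : E, inner ℂ v (U (average μ W u g z)) =
      ∫ y, Complex.exp (z * g y) * inner ℂ v (U (frame W u y)) ∂μ := by
    intro v
    rw [average, ← ContinuousLinearMap.integral_comp_comm U (hi z),
      ← integral_inner (U.integrable_comp (hi z))]
    simp only [map_smul, inner_smul_right]
  have h2 : ∀ v : E, inner ℂ (average μ W u g (starRingEnd ℂ z)) v =
      ∫ x, Complex.exp (z * g x) * inner ℂ (frame W u x) v ∂μ := by
    intro v
    rw [← inner_conj_symm, average, ← integral_inner (hi _), ← integral_conj]
    simp only [inner_smul_right, map_mul, inner_conj_symm, ← Complex.exp_conj, Complex.conj_conj,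
      Complex.conj_ofReal]
  rw [integral_prod _ hint, h2]
  refine integral_congr_ae (Filter.Eventually.of_forall fun x => ?_)
  simp only [h1]
  rw [← integral_const_mul]
  refine integral_congr_ae (Filter.Eventually.of_forall fun y => ?_)
  simp only
  rw [← mul_assoc, ← Complex.exp_add]
  push_cast
  rw [mul_add]

/-- The phase-adjusted correlation of a small perturbation of an eigenvector. -/
theorem le_norm_inner_of_eigenvector (hU : ∀ v, ‖U v‖ = ‖v‖) (hψ : ‖ψ‖ = 1) (heig : U ψ = z₀ • ψ)
    (δ : E) : 1 + 2 * (inner ℂ ψ δ).re - ‖δ‖ ^ 2 ≤ ‖inner ℂ (ψ + δ) (U (ψ + δ))‖ := by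
  have hz : ‖z₀‖ = 1 := by
    have := hU ψ
    rwa [heig, norm_smul, hψ, mul_one] at this
  have hzz : starRingEnd ℂ z₀ * z₀ = 1 := by
    rw [mul_comm, Complex.mul_conj, Complex.normSq_eq_norm_sq, hz]; simp
  have hUU : ∀ v w, inner ℂ (U v) (U w) = inner ℂ v w := fun v w =>
    (LinearMap.norm_map_iff_inner_map_map U).1 hU v w
  have h1 : starRingEnd ℂ z₀ * inner ℂ ψ (U δ) = inner ℂ ψ δ := by
    rw [← inner_smul_left, ← heig, hUU]
  have h2 : inner ℂ ψ ψ = (1 : ℂ) := by rw [inner_self_eq_norm_sq_to_K, hψ]; simp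
  -- Removing the eigenvalue makes the two first order terms conjugate to each other, so their real
  -- parts add up to `2 Re ⟨ψ, δ⟩`.
  have h3 : starRingEnd ℂ z₀ * inner ℂ (ψ + δ) (U (ψ + δ)) =
      1 + inner ℂ ψ δ + inner ℂ δ ψ + starRingEnd ℂ z₀ * inner ℂ δ (U δ) := by
    rw [map_add, heig, inner_add_left, inner_add_right, inner_add_right, inner_smul_right,
      inner_smul_right, h2]
    linear_combination h1 + (1 + inner ℂ δ ψ) * hzz
  have h4 : ‖starRingEnd ℂ z₀ * inner ℂ (ψ + δ) (U (ψ + δ))‖ = ‖inner ℂ (ψ + δ) (U (ψ + δ))‖ := by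
    rw [norm_mul, RCLike.norm_conj, hz, one_mul]
  have h5 : ‖starRingEnd ℂ z₀ * inner ℂ δ (U δ)‖ ≤ ‖δ‖ ^ 2 := by
    rw [norm_mul, RCLike.norm_conj, hz, one_mul, sq]
    refine (norm_inner_le_norm _ _).trans ?_
    rw [hU]
  have h6 : (inner ℂ δ ψ).re = (inner ℂ ψ δ).re := by
    rw [← inner_conj_symm, Complex.conj_re]
  rw [← h4]
  refine le_trans ?_ (Complex.re_le_norm _)
  rw [h3]
  have h7 := (abs_le.1 ((Complex.abs_re_le_norm _).trans h5)).1
  simp only [Complex.add_re, Complex.one_re]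
  rw [h6]
  linarith

/-- The interpolation argument. Adding `ε` keeps `g = log (f + ε)` bounded even where `f` vanishes,
so `F` is entire and bounded on the strip `0 ≤ Re z ≤ 1/2`. The factor `1 + ε` on the right is the
integral of `f + ε`, and occurs once for each of the two variables. -/
theorem integral_mul_log_add_le (hW : IsTightFamily μ W B) (hU : ∀ v, ‖U v‖ = ‖v‖)
    (hψ : ‖ψ‖ = 1) (heig : U ψ = z₀ • ψ) (hc : 0 < c)
    (hcorr : ∀ x y, ‖W x ∘L U ∘L ContinuousLinearMap.adjoint (W y)‖ ≤ c) {ε : ℝ} (hε : 0 < ε) :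
    ∫ x, ‖W x ψ‖ ^ 2 * Real.log (‖W x ψ‖ ^ 2 + ε) ∂μ ≤ Real.log (c * (1 + ε) ^ 2) := by
  set f : X → ℝ := fun x => ‖W x ψ‖ ^ 2 with hf
  set g : X → ℝ := fun x => Real.log (f x + ε) with hg
  have hf0 : ∀ x, 0 ≤ f x := fun x => by positivity
  have hfε : ∀ x, 0 < f x + ε := fun x => by have := hf0 x; linarith
  have hexp : ∀ x, Real.exp (g x) = f x + ε := fun x => Real.exp_log (hfε x)
  have hfm : AEStronglyMeasurable f μ := (hW.aesm_apply ψ).norm.pow 2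
  have hfi : Integrable f μ := hW.integrable_norm_sq ψ
  have hgm : AEStronglyMeasurable g μ :=
    (Real.measurable_log.comp_aemeasurable (hfm.aemeasurable.add_const ε)).aestronglyMeasurable
  have hfB : ∀ x, f x ≤ B ^ 2 := fun x => by
    have := hW.norm_apply_le ψ x
    rw [hψ, mul_one] at this
    exact pow_le_pow_left₀ (norm_nonneg _) this 2
  set Γ := |Real.log ε| + |Real.log (B ^ 2 + ε)| with hΓ
  have hΓ0 : 0 ≤ Γ := by positivity
  have hgb : ∀ x, |g x| ≤ Γ := by
    intro x
    have h1 : Real.log ε ≤ g x := Real.log_le_log hε (by have := hf0 x; linarith)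
    have h2 : g x ≤ Real.log (B ^ 2 + ε) := Real.log_le_log (hfε x) (by have := hfB x; linarith)
    have h3 := neg_abs_le (Real.log ε)
    have h4 := le_abs_self (Real.log (B ^ 2 + ε))
    have h5 := abs_nonneg (Real.log ε)
    have h6 := abs_nonneg (Real.log (B ^ 2 + ε))
    rw [abs_le]; constructor <;> linarith
  set hh : X × X → ℂ := fun p => inner ℂ (frame W ψ p.1) (U (frame W ψ p.2)) with hhh
  set G : X × X → ℝ := fun p => g p.1 + g p.2 with hG
  have hGm : AEStronglyMeasurable G (μ.prod μ) := hgm.comp_fst.add hgm.comp_snd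
  have hhm : AEStronglyMeasurable hh (μ.prod μ) :=
    (hW.aesm_frame ψ).comp_fst.inner (U.continuous.comp_aestronglyMeasurable (hW.aesm_frame ψ).comp_snd)
  have hGb : ∀ p, |G p| ≤ Γ + Γ := fun p =>
    (abs_add_le _ _).trans (add_le_add (hgb _) (hgb _))
  have hwb : ∀ x, ‖frame W ψ x‖ ≤ B ^ 2 := fun x => by
    have := hW.norm_frame_le ψ x
    rwa [hψ, mul_one] at this
  have hhb : ∀ p, ‖hh p‖ ≤ B ^ 2 * B ^ 2 := fun p => by
    refine (norm_inner_le_norm _ _).trans ?_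
    rw [hU]
    exact mul_le_mul (hwb _) (hwb _) (norm_nonneg _) (by positivity)
  set F : ℂ → ℂ := fun z => ∫ p, Complex.exp (z * G p) * hh p ∂(μ.prod μ) with hF
  have hFd : Differentiable ℂ F := differentiable_integral_cexp_mul hGm hhm hGb hhb
  have hIb : ∀ z : ℂ, ∀ p, ‖Complex.exp (z * G p) * hh p‖ ≤
      Real.exp (|z.re| * (Γ + Γ)) * (B ^ 2 * B ^ 2) := fun z p => by
    rw [norm_mul]
    exact mul_le_mul (norm_cexp_le hGb z p) (hhb p) (norm_nonneg _) (Real.exp_pos _).le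
  have hFi : ∀ z : ℂ, Integrable (fun p => Complex.exp (z * G p) * hh p) (μ.prod μ) := fun z =>
    Integrable.of_bound ((aesm_cexp hGm z).mul hhm) _ (Filter.Eventually.of_forall (hIb z))
  have hFv : ∀ z, F z = inner ℂ (average μ W ψ g (starRingEnd ℂ z)) (U (average μ W ψ g z)) :=
    fun z => hW.integral_prod_eq_inner_average hgm hgb U ψ z (hFi z)
  -- the boundary `Re z = 0`
  have hF0 : ∀ z : ℂ, z.re = 0 → ‖F z‖ ≤ 1 := by
    intro z hz
    have hv : ∀ z : ℂ, z.re = 0 → ‖average μ W ψ g z‖ ≤ 1 := fun z hz => by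
      rw [← hψ]
      refine hW.norm_integral_smul_frame_le ψ (aesm_cexp hgm z) fun x => ?_
      have := norm_cexp_le hgb z x
      rwa [hz, abs_zero, zero_mul, Real.exp_zero] at this
    rw [hFv]
    refine (norm_inner_le_norm _ _).trans ?_
    rw [hU]
    exact mul_le_one₀ (hv _ (by rw [Complex.conj_re, hz])) (norm_nonneg _) (hv z hz)
  -- the boundary `Re z = 1 / 2`
  have hsqrt : ∀ x, ‖W x ψ‖ ≤ Real.exp (g x / 2) := fun x => by
    refine le_of_sq_le_sq ?_ (Real.exp_pos _).le
    rw [← Real.exp_nat_mul, show ((2 : ℕ) : ℝ) * (g x / 2) = g x by push_cast; ring, hexp]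
    change f x ≤ f x + ε
    linarith
  have hint_exp : ∫ p : X × X, c * ((f p.1 + ε) * (f p.2 + ε)) ∂(μ.prod μ) = c * (1 + ε) ^ 2 := by
    have h1 : ∫ x, (f x + ε) ∂μ = 1 + ε := by
      rw [integral_add hfi (integrable_const _), hW.integral_norm_sq, hψ]
      simp
    rw [integral_const_mul, integral_prod_mul (fun x => f x + ε) (fun x => f x + ε), h1, sq]
  -- The exponential contributes `√(f + ε)` in each variable and the correlation bound contributes
  -- another, so the integrand is dominated by `c` times a product of densities.
  have hF1 : ∀ z : ℂ, z.re = 1 / 2 → ‖F z‖ ≤ c * (1 + ε) ^ 2 := by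
    intro z hz
    rw [← hint_exp]
    have hfiε : Integrable (fun x => f x + ε) μ := hfi.add (integrable_const _)
    refine norm_integral_le_of_norm_le ((hfiε.mul_prod hfiε).const_mul c)
      (Filter.Eventually.of_forall fun p => ?_)
    rw [norm_mul, Complex.norm_exp, Complex.re_mul_ofReal, hz]
    have h1 : hh p = inner ℂ (W p.1 ψ)
        ((W p.1 ∘L U ∘L ContinuousLinearMap.adjoint (W p.2)) (W p.2 ψ)) :=
      ContinuousLinearMap.adjoint_inner_left _ _ _
    have h2 : ‖hh p‖ ≤ c * (Real.exp (g p.1 / 2) * Real.exp (g p.2 / 2)) := by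
      rw [h1]
      refine (norm_inner_le_norm _ _).trans ?_
      have h3 := (W p.1 ∘L U ∘L ContinuousLinearMap.adjoint (W p.2)).le_of_opNorm_le
        (hcorr p.1 p.2) (W p.2 ψ)
      calc _ ≤ Real.exp (g p.1 / 2) * (c * Real.exp (g p.2 / 2)) :=
            mul_le_mul (hsqrt _) (h3.trans (mul_le_mul_of_nonneg_left (hsqrt _) hc.le))
              (norm_nonneg _) (Real.exp_pos _).le
        _ = _ := by ring
    calc _ ≤ Real.exp (1 / 2 * G p) * (c * (Real.exp (g p.1 / 2) * Real.exp (g p.2 / 2))) :=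
          mul_le_mul_of_nonneg_left h2 (Real.exp_pos _).le
      _ = c * (Real.exp (g p.1) * Real.exp (g p.2)) := by
          rw [mul_left_comm, ← Real.exp_add, ← Real.exp_add, ← Real.exp_add]
          congr 2
          simp only [hG]; ring
      _ = _ := by rw [hexp, hexp]
  set c' := c * (1 + ε) ^ 2 with hc'
  have hc'0 : 0 < c' := by positivity
  -- interpolation
  have hinterp : ∀ t : ℝ, 0 < t → t ≤ 1 / 2 → ‖F t‖ ≤ Real.exp (2 * t * Real.log c') := by
    intro t ht0 ht1
    have h1 := Complex.HadamardThreeLines.norm_le_interp_of_mem_verticalClosedStrip' (f := F)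
      (z := (t : ℂ)) (a := 1) (b := c') (l := 0) (u := 1 / 2) (by norm_num)
      (by
        simp only [Complex.HadamardThreeLines.verticalClosedStrip, Set.mem_preimage,
          Complex.ofReal_re]
        exact ⟨ht0.le, ht1⟩)
      hFd.diffContOnCl
      (by
        refine ⟨Real.exp (1 / 2 * (Γ + Γ)) * (B ^ 2 * B ^ 2), ?_⟩
        rintro _ ⟨z, hz, rfl⟩
        have h2 := norm_integral_le_of_norm_le_const (Filter.Eventually.of_forall (hIb z))
          (μ := μ.prod μ)
        rw [probReal_univ, mul_one] at h2
        refine h2.trans (mul_le_mul_of_nonneg_right (Real.exp_le_exp.2 ?_) (by positivity))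
        refine mul_le_mul_of_nonneg_right ?_ (by positivity)
        have hz' : z.re ∈ Set.Icc (0 : ℝ) (1 / 2) := hz
        rw [abs_of_nonneg hz'.1]; exact hz'.2)
      (fun z hz => hF0 z hz) (fun z hz => hF1 z hz)
    rw [Real.one_rpow, one_mul, Complex.ofReal_re, sub_zero, sub_zero,
      Real.rpow_def_of_pos hc'0] at h1
    refine h1.trans_eq ?_
    congr 1; ring
  -- expansion at `t = 0`
  refine le_of_one_add_le_exp (C := (2 * Γ * B ^ 2) ^ 2) (t₀ := min (1 / 2) (1 / (Γ + 1)))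
    (lt_min (by norm_num) (by positivity)) fun t ht0 ht1 => ?_
  refine le_trans ?_ (hinterp t ht0 (ht1.trans (min_le_left _ _)))
  have htΓ : t * Γ ≤ 1 := by
    have := ht1.trans (min_le_right _ _)
    rw [le_div_iff₀ (by positivity)] at this
    nlinarith
  rw [hFv, Complex.conj_ofReal]
  set v := average μ W ψ g t with hv
  have hvi : Integrable (fun x => Complex.exp (t * g x) • frame W ψ x) μ :=
    hW.integrable_smul_frame ψ (aesm_cexp hgm t) (norm_cexp_le hgb t)
  have hwi : Integrable (frame W ψ) μ :=
    Integrable.of_bound (hW.aesm_frame ψ) _ (Filter.Eventually.of_forall hwb)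
  have hδ : v - ψ = ∫ x, (Complex.exp (t * g x) • frame W ψ x - frame W ψ x) ∂μ := by
    rw [integral_sub hvi hwi, hW.integral_frame]; rfl
  have hδi : Integrable (fun x => Complex.exp (t * g x) • frame W ψ x - frame W ψ x) μ := hvi.sub hwi
  have hee : ∀ x, Complex.exp (t * g x) = ((Real.exp (t * g x) : ℝ) : ℂ) := fun x => by
    push_cast; rfl
  have hδn : ‖v - ψ‖ ≤ 2 * Γ * B ^ 2 * t := by
    rw [hδ]
    have h2 := norm_integral_le_of_norm_le_const (C := 2 * Γ * B ^ 2 * t) (μ := μ)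
      (f := fun x => Complex.exp (t * g x) • frame W ψ x - frame W ψ x)
      (Filter.Eventually.of_forall fun x => ?_)
    · rwa [probReal_univ, mul_one] at h2
    · rw [show Complex.exp (t * g x) • frame W ψ x - frame W ψ x =
        (((Real.exp (t * g x) - 1 : ℝ)) : ℂ) • frame W ψ x by rw [hee]; push_cast; rw [sub_smul, one_smul],
        norm_smul, Complex.norm_real, Real.norm_eq_abs]
      have h3 : |t * g x| ≤ t * Γ := by
        rw [abs_mul, abs_of_pos ht0]
        exact mul_le_mul_of_nonneg_left (hgb x) ht0.le
      have h4 := (Real.abs_exp_sub_one_le (h3.trans htΓ)).trans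
        (mul_le_mul_of_nonneg_left h3 zero_le_two)
      calc _ ≤ 2 * (t * Γ) * B ^ 2 := mul_le_mul h4 (hwb x) (norm_nonneg _) (by positivity)
        _ = _ := by ring
  -- `e^s - 1 ≥ s`, integrated against the density `f`; no second order term is lost here.
  have hδψ : t * ∫ x, f x * g x ∂μ ≤ (inner ℂ ψ (v - ψ)).re := by
    have h1 : inner ℂ ψ (v - ψ) = ((∫ x, (Real.exp (t * g x) - 1) * f x ∂μ : ℝ) : ℂ) := by
      rw [hδ, ← integral_inner hδi, ← integral_complex_ofReal]
      refine integral_congr_ae (Filter.Eventually.of_forall fun x => ?_)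
      simp only [inner_sub_right, inner_smul_right, inner_frame, inner_self_eq_norm_sq_to_K, hee]
      simp only [hf]
      push_cast
      ring_nf
      rfl
    rw [h1, Complex.ofReal_re, ← integral_const_mul]
    refine integral_mono ?_ ?_ fun x => ?_
    · refine (Integrable.of_bound (hfm.mul hgm) (B ^ 2 * Γ)
        (Filter.Eventually.of_forall fun x => ?_)).const_mul t
      simp only [Pi.mul_apply]
      rw [norm_mul, Real.norm_eq_abs, Real.norm_eq_abs, abs_of_nonneg (hf0 x)]
      exact mul_le_mul (hfB x) (hgb x) (abs_nonneg _) (by positivity)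
    · refine Integrable.of_bound (C := (Real.exp (t * Γ) + 1) * B ^ 2) (((Real.continuous_exp.comp_aestronglyMeasurable
        (hgm.const_mul t)).sub aestronglyMeasurable_const).mul hfm)
        (Filter.Eventually.of_forall fun x => ?_)
      rw [norm_mul, Real.norm_eq_abs, Real.norm_eq_abs, abs_of_nonneg (hf0 x)]
      refine mul_le_mul ?_ (hfB x) (hf0 x) (by positivity)
      refine (abs_sub _ _).trans ?_
      rw [abs_of_pos (Real.exp_pos _), abs_one]
      have := mul_le_mul_of_nonneg_left ((le_abs_self _).trans (hgb x)) ht0.le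
      have := Real.exp_le_exp.2 this
      linarith
    · have h2 := Real.add_one_le_exp (t * g x)
      have h3 := hf0 x
      simp only
      nlinarith
  have hmain := le_norm_inner_of_eigenvector hU hψ heig (v - ψ)
  rw [add_sub_cancel] at hmain
  refine le_trans ?_ hmain
  have hsq := pow_le_pow_left₀ (norm_nonneg _) hδn 2
  nlinarith

end IsTightFamily

end Entropic

end

/-! ### Jensen's inequality and the entropy of a partition -/

section

section Partition

variable {X : Type*} [MeasurableSpace X] {μ : Measure X}
  {E : Type*} [NormedAddCommGroup E] [InnerProductSpace ℂ E] [FiniteDimensional ℂ E]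

/-- The convex function `x log x` lies above its tangent at `s`. -/
theorem mul_log_tangent_le {x s : ℝ} (hx : 0 ≤ x) (hs : 0 < s) :
    x * (1 + Real.log s) - s ≤ x * Real.log x := by
  rcases hx.eq_or_lt with rfl | hx
  · simpa using hs.le
  · have h := Real.log_le_sub_one_of_pos (div_pos hs hx)
    rw [Real.log_div hs.ne' hx.ne'] at h
    have h2 := mul_le_mul_of_nonneg_left h hx.le
    have h3 : x * (s / x - 1) = s - x := by field_simp
    rw [h3] at h2
    linarith

/-- Jensen's inequality for `x log x` against a weight `q`. -/
theorem mul_log_integral_le [IsProbabilityMeasure μ] {f q : X → ℝ} {C : ℝ}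
    (hf : AEStronglyMeasurable f μ) (hf0 : ∀ x, 0 ≤ f x) (hfC : ∀ x, f x ≤ C)
    (hfl : Integrable (fun x => f x * Real.log (f x)) μ)
    (hq : AEStronglyMeasurable q μ) (hq0 : ∀ x, 0 ≤ q x) (hq1 : ∀ x, q x ≤ 1)
    {S : ℝ} (hS : ∫ x, q x ∂μ ≤ S) :
    (∫ x, q x * f x ∂μ) * Real.log (∫ x, q x * f x ∂μ) - (∫ x, q x * f x ∂μ) * Real.log S ≤
      ∫ x, q x * (f x * Real.log (f x)) ∂μ := by
  have hqn : ∀ x, ‖q x‖ ≤ 1 := fun x => by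
    rw [Real.norm_of_nonneg (hq0 x)]; exact hq1 x
  have hqi : Integrable q μ := Integrable.of_bound hq 1 (Filter.Eventually.of_forall hqn)
  have hfi : Integrable f μ := Integrable.of_bound hf C (Filter.Eventually.of_forall fun x => by
    rw [Real.norm_of_nonneg (hf0 x)]; exact hfC x)
  have hqf : Integrable (fun x => q x * f x) μ :=
    hfi.bdd_mul hq (Filter.Eventually.of_forall hqn)
  have hqfl : Integrable (fun x => q x * (f x * Real.log (f x))) μ :=
    hfl.bdd_mul hq (Filter.Eventually.of_forall hqn)
  set m := ∫ x, q x * f x ∂μ with hm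
  set l := ∫ x, q x ∂μ with hl
  have hm0 : 0 ≤ m := integral_nonneg fun x => mul_nonneg (hq0 x) (hf0 x)
  have hl0 : 0 ≤ l := integral_nonneg hq0
  have hml : m ≤ C * l := by
    rw [hm, hl, ← integral_const_mul]
    refine integral_mono hqf (hqi.const_mul C) fun x => ?_
    simp only
    rw [mul_comm C]
    exact mul_le_mul_of_nonneg_left (hfC x) (hq0 x)
  -- The integrated tangent inequality. The best `s` is the mean value `m / l`; when `m = 0` it is
  -- applied with `s` tending to `0`, and `m > 0` forces `l > 0` because `m ≤ C l`.
  have key : ∀ s, 0 < s → m * (1 + Real.log s) - s * l ≤ ∫ x, q x * (f x * Real.log (f x)) ∂μ := by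
    intro s hs
    rw [hm, hl, ← integral_mul_const, ← integral_const_mul,
      ← integral_sub (hqf.mul_const _) (hqi.const_mul s)]
    refine integral_mono ((hqf.mul_const _).sub (hqi.const_mul s)) hqfl fun x => ?_
    have h := mul_le_mul_of_nonneg_left (mul_log_tangent_le (hf0 x) hs) (hq0 x)
    simp only
    linarith
  rcases hm0.eq_or_lt with h0 | hpos
  · rw [← h0, zero_mul, zero_mul, sub_zero]
    refine le_of_forall_pos_le_add fun s hs => ?_
    have h1 := key (s / (l + 1)) (by positivity)
    rw [← h0, zero_mul] at h1
    have h2 : s / (l + 1) * l ≤ s := by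
      rw [div_mul_eq_mul_div, div_le_iff₀ (by positivity)]
      nlinarith
    linarith
  · have hlpos : 0 < l := by
      refine hl0.lt_of_ne fun h => ?_
      rw [← h, mul_zero] at hml
      linarith
    have h1 := key (m / l) (div_pos hpos hlpos)
    rw [div_mul_cancel₀ _ hlpos.ne', Real.log_div hpos.ne' hlpos.ne'] at h1
    have h2 := mul_le_mul_of_nonneg_left (Real.log_le_log hlpos hS) hpos.le
    linarith

namespace IsTightFamily

variable [IsProbabilityMeasure μ] {W : X → E →L[ℂ] E} {B : ℝ} {U : E →L[ℂ] E} {ψ : E} {z₀ : ℂ} {c : ℝ}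

theorem integrable_mul_log (hW : IsTightFamily μ W B) (u : E) :
    Integrable (fun x => ‖W x u‖ ^ 2 * Real.log (‖W x u‖ ^ 2)) μ := by
  obtain ⟨C, hC⟩ := (isCompact_Icc (a := (0 : ℝ)) (b := (B * ‖u‖) ^ 2)).exists_bound_of_continuousOn
    Real.continuous_mul_log.continuousOn
  refine Integrable.of_bound (Real.continuous_mul_log.comp_aestronglyMeasurable
    ((hW.aesm_apply u).norm.pow 2)) C (Filter.Eventually.of_forall fun x => hC _ ⟨by positivity, ?_⟩)
  exact pow_le_pow_left₀ (norm_nonneg _) (hW.norm_apply_le u x) 2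

/-- The correlation bound is positive. -/
theorem corr_pos (hW : IsTightFamily μ W B) (hU : ∀ v, ‖U v‖ = ‖v‖)
    (hψ : ‖ψ‖ = 1) (heig : U ψ = z₀ • ψ)
    (hcorr : ∀ x y, ‖W x ∘L U ∘L ContinuousLinearMap.adjoint (W y)‖ ≤ c) : 0 < c := by
  by_contra hc
  push Not at hc
  set a := ∫ x, ‖W x ψ‖ ^ 2 * Real.log (‖W x ψ‖ ^ 2 + 1) ∂μ with ha
  -- If `c ≤ 0`, the preceding bound holds with any positive constant. This one, used with `ε = 1`,
  -- makes its right-hand side `a - 1`, while the left-hand side is `a`.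
  have hη : 0 < Real.exp (a - 1) / 4 := by positivity
  have h := hW.integral_mul_log_add_le hU hψ heig hη
    (fun x y => (hcorr x y).trans (hc.trans hη.le)) one_pos
  rw [show Real.exp (a - 1) / 4 * (1 + 1) ^ 2 = Real.exp (a - 1) by ring, Real.log_exp] at h
  linarith

/-- The entropic uncertainty bound for an eigenvector. -/
theorem integral_mul_log_le (hW : IsTightFamily μ W B) (hU : ∀ v, ‖U v‖ = ‖v‖)
    (hψ : ‖ψ‖ = 1) (heig : U ψ = z₀ • ψ)
    (hcorr : ∀ x y, ‖W x ∘L U ∘L ContinuousLinearMap.adjoint (W y)‖ ≤ c) :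
    ∫ x, ‖W x ψ‖ ^ 2 * Real.log (‖W x ψ‖ ^ 2) ∂μ ≤ Real.log c := by
  have hc := hW.corr_pos hU hψ heig hcorr
  -- The bound is used with `ε / 2`: the error `2 log (1 + ε/2)` is at most `ε`, and dropping `ε /
  -- 2` inside the logarithm only decreases the integral.
  refine le_of_forall_pos_le_add fun ε hε => ?_
  have h1 := hW.integral_mul_log_add_le hU hψ heig hc hcorr (half_pos hε)
  rw [Real.log_mul hc.ne' (by positivity), Real.log_pow] at h1
  have h2 := Real.log_le_sub_one_of_pos (show 0 < 1 + ε / 2 by positivity)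
  have h3 : ∫ x, ‖W x ψ‖ ^ 2 * Real.log (‖W x ψ‖ ^ 2) ∂μ ≤
      ∫ x, ‖W x ψ‖ ^ 2 * Real.log (‖W x ψ‖ ^ 2 + ε / 2) ∂μ := by
    have hm : AEStronglyMeasurable (fun x => ‖W x ψ‖ ^ 2) μ := (hW.aesm_apply ψ).norm.pow 2
    have hcont : Continuous fun s : ℝ => |s| * Real.log (|s| + ε / 2) :=
      continuous_abs.mul ((continuous_abs.add continuous_const).log fun s =>
      (add_pos_of_nonneg_of_pos (abs_nonneg s) (half_pos hε)).ne')
    obtain ⟨C, hC⟩ := (isCompact_Icc (a := (0 : ℝ)) (b := (B * ‖ψ‖) ^ 2)).exists_bound_of_continuousOn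
      hcont.continuousOn
    refine integral_mono (hW.integrable_mul_log ψ) ?_ fun x => ?_
    · have h := Integrable.of_bound (hcont.comp_aestronglyMeasurable hm) C
        (Filter.Eventually.of_forall fun x => hC _ ⟨by positivity,
          pow_le_pow_left₀ (norm_nonneg _) (hW.norm_apply_le ψ x) 2⟩)
      refine h.congr (Filter.Eventually.of_forall fun x => ?_)
      simp only [abs_of_nonneg (sq_nonneg ‖W x ψ‖)]
    · rcases (sq_nonneg ‖W x ψ‖).eq_or_lt with h | h
      · simp only [← h, zero_mul, le_refl]
      · exact mul_le_mul_of_nonneg_left (Real.log_le_log h (by linarith)) h.le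
  push_cast at h1
  linarith

/-- The entropy of an eigenvector with respect to a partition of unity. -/
theorem le_sum_negMulLog (hW : IsTightFamily μ W B) (hU : ∀ v, ‖U v‖ = ‖v‖)
    (hψ : ‖ψ‖ = 1) (heig : U ψ = z₀ • ψ)
    (hcorr : ∀ x y, ‖W x ∘L U ∘L ContinuousLinearMap.adjoint (W y)‖ ≤ c)
    {ι : Type*} [Fintype ι] {q : ι → X → ℝ} (hq : ∀ i, AEStronglyMeasurable (q i) μ)
    (hq0 : ∀ i x, 0 ≤ q i x) (hq1 : ∀ x, ∑ i, q i x = 1) :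
    -Real.log (⨆ i, ∫ x, q i x ∂μ) - Real.log c ≤
      ∑ i, Real.negMulLog (∫ x, q i x * ‖W x ψ‖ ^ 2 ∂μ) := by
  have hqle : ∀ i x, q i x ≤ 1 := fun i x => by
    rw [← hq1 x]
    exact Finset.single_le_sum (f := fun i => q i x) (fun j _ => hq0 j x) (Finset.mem_univ i)
  have hqn : ∀ i x, ‖q i x‖ ≤ 1 := fun i x => by
    rw [Real.norm_of_nonneg (hq0 i x)]; exact hqle i x
  set S := ⨆ i, ∫ x, q i x ∂μ with hS
  -- Every piece is compared with the common volume bound `S`. After summation the weights `q i` add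
  -- up to `1`, so the coefficient of `log S` is `∫ f = 1`.
  have hJ : ∀ i, _ := fun i => mul_log_integral_le (μ := μ) (f := fun x => ‖W x ψ‖ ^ 2) (q := q i)
    ((hW.aesm_apply ψ).norm.pow 2) (fun x => sq_nonneg _)
    (fun x => pow_le_pow_left₀ (norm_nonneg _) (hW.norm_apply_le ψ x) 2) (hW.integrable_mul_log ψ)
    (hq i) (hq0 i) (hqle i) (S := S)
    (le_ciSup (f := fun i => ∫ x, q i x ∂μ) (Set.finite_range _).bddAbove i)
  have hsum := Finset.sum_le_sum fun i (_ : i ∈ Finset.univ) => hJ i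
  rw [← integral_finsetSum _ fun i _ => (hW.integrable_mul_log ψ).bdd_mul (hq i)
    (Filter.Eventually.of_forall (hqn i)), Finset.sum_sub_distrib, ← Finset.sum_mul,
    ← integral_finsetSum _ fun i _ => (hW.integrable_norm_sq ψ).bdd_mul (hq i)
    (Filter.Eventually.of_forall (hqn i))] at hsum
  simp only [← Finset.sum_mul, hq1, one_mul, hW.integral_norm_sq, hψ, one_pow] at hsum
  have h1 := hW.integral_mul_log_le hU hψ heig hcorr
  simp only [Real.negMulLog, neg_mul, Finset.sum_neg_distrib]
  linarith

end IsTightFamily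

end Partition

end

/-! ### The localized operators as a tight family on the torus -/

variable {d : ℕ}

namespace TorusHilbert

variable {N : ℕ} {κ : Phase d} (H : TorusHilbert N κ)

/-- An operator on `H_N(κ)` as a continuous operator on the Hilbert space. -/
def op (hN : 0 < N) (T : torusSpace N κ →ₗ[ℂ] torusSpace N κ) : H.Space →L[ℂ] H.Space :=
  haveI := H.finiteDimensional hN
  LinearMap.toContinuousLinearMap (H.toS.toLinearMap ∘ₗ T ∘ₗ H.toS.symm.toLinearMap)

theorem op_apply (hN : 0 < N) (T : torusSpace N κ →ₗ[ℂ] torusSpace N κ) (v : torusSpace N κ) :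
    H.op hN T (H.toS v) = H.toS (T v) := by
  simp [op]

theorem op_comp (hN : 0 < N) (S T : torusSpace N κ →ₗ[ℂ] torusSpace N κ) :
    H.op hN (S ∘ₗ T) = H.op hN S ∘L H.op hN T := by
  ext v
  obtain ⟨v, rfl⟩ := H.toS.surjective v
  simp only [ContinuousLinearMap.comp_apply, op_apply, LinearMap.comp_apply]

theorem opNorm_eq (hN : 0 < N) (T : torusSpace N κ →ₗ[ℂ] torusSpace N κ) :
    H.opNorm T = ‖H.op hN T‖ := by
  rw [ContinuousLinearMap.norm_def, opNorm]
  congr 1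

/-- The adjoint exists in finite dimension, so `adj` is not its default value, and the defining
relation characterizes it. -/
theorem op_adj (hN : 0 < N) [FiniteDimensional ℂ H.Space]
    (T : torusSpace N κ →ₗ[ℂ] torusSpace N κ) :
    H.op hN (H.adj T) = ContinuousLinearMap.adjoint (H.op hN T) := by
  have hex : ∃ S : torusSpace N κ →ₗ[ℂ] torusSpace N κ, ∀ v w,
      H.core.inner (S v) w = H.core.inner v (T w) := by
    refine ⟨H.toS.symm.toLinearMap ∘ₗ (ContinuousLinearMap.adjoint (H.op hN T) :
      H.Space →ₗ[ℂ] H.Space) ∘ₗ H.toS.toLinearMap, fun v w => ?_⟩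
    change H.ip _ _ = H.ip _ _
    rw [← H.inner_toS, ← H.inner_toS]
    simp only [LinearMap.comp_apply, LinearEquiv.coe_coe, LinearEquiv.apply_symm_apply,
      ContinuousLinearMap.coe_coe, ContinuousLinearMap.adjoint_inner_left, op_apply]
  have hadj : ∀ v w, H.ip (H.adj T v) w = H.ip v (T w) := by
    intro v w
    rw [adj, dif_pos hex]
    exact hex.choose_spec v w
  rw [ContinuousLinearMap.eq_adjoint_iff]
  intro v w
  obtain ⟨v, rfl⟩ := H.toS.surjective v
  obtain ⟨w, rfl⟩ := H.toS.surjective w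
  rw [op_apply, op_apply, H.inner_toS, H.inner_toS, hadj]

end TorusHilbert

variable {N : ℕ} {κ : Phase d} (H : TorusHilbert N κ) {G Gh : Phase d → ℂ}

open Classical in
/-- The localized operators on the torus, extended by zero. -/
def locOp (hN : 0 < N) (G : Phase d → ℂ) (p : Phase d × Phase d) : H.Space →L[ℂ] H.Space :=
  if p ∈ cube d ×ˢ cube d then H.op hN (opLoc N κ G p.1 p.2) else 0

theorem locOp_of_mem (hN : 0 < N) {p : Phase d × Phase d} (hp : p ∈ cube d ×ˢ cube d) :
    locOp H hN G p = H.op hN (opLoc N κ G p.1 p.2) := if_pos hp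

theorem fourierCoeffZ_one (k : Fin d ⊕ Fin d → ℤ) :
    fourierCoeffZ (fun _ : Phase d => 1) k = if k = 0 then 1 else 0 := by
  have h := integral_unitCube_ee (-k)
  simp only [fourierCoeffZ, Complex.ofReal_one, one_mul]
  simp only [intVec_neg, neg_dotProduct, neg_eq_zero] at h
  exact h

/-- Only the frequency `0` survives in the series, and its coefficient is `moyalCoeff_zero`. -/
theorem TorusHilbert.opPlus_one (H : TorusHilbert N κ) (hG : IsWindow G Gh) (hN : 0 < N) (u : torusSpace N κ) :
    opPlus N κ G (fun _ => 1) u = u := by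
  have h1 := hasSum_toS_opW hN H (hG.rapidCoeff_mul N (a := fun _ => 1) (C := 1) (by simp))
    (hG.hasSum_conv_moyal hN continuous_const (C := 1) (by simp) (fun _ _ => rfl)) u
  have h2 := hasSum_single (f := fun k => (fourierCoeffZ (fun _ => 1) k * moyalCoeff N Gh (intVec k)) •
    H.toS (shift N κ (jZ k) u)) 0 (fun k hk => by
      rw [fourierCoeffZ_one, if_neg hk, zero_mul, zero_smul])
  have h3 := h1.unique h2
  rw [fourierCoeffZ_one, if_pos rfl, intVec_zero, hG.moyalCoeff_zero, one_mul, one_smul,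
    show jZ (0 : Fin d ⊕ Fin d → ℤ) = 0 by ext j; rcases j with j | j <;> simp [jZ],
    shift_zero hN] at h3
  exact H.toS.injective h3

theorem norm_op_shift_le (hN : 0 < N) (s : Fin d ⊕ Fin d → ℤ) : ‖H.op hN (shift N κ s)‖ ≤ 1 := by
  refine ContinuousLinearMap.opNorm_le_bound _ zero_le_one fun v => ?_
  obtain ⟨v, rfl⟩ := H.toS.surjective v
  rw [H.op_apply, H.norm_toS_shift, one_mul]

/-- The localized operators form a tight family over the torus. -/
theorem IsWindow.exists_isTightFamily_locOp (hG : IsWindow G Gh) (hN : 0 < N)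
    [FiniteDimensional ℂ H.Space] : ∃ B, IsTightFamily (torusMeasure d) (locOp H hN G) B := by
  obtain ⟨b, hbs, hb0, hb⟩ := hG.exists_norm_locCoeff_le N
  have hnorm : ∀ p ∈ cube d ×ˢ cube d, ∀ k,
      ‖locCoeff N Gh p.1 p.2 k • H.op hN (shift N κ (jZ k))‖ ≤ b k := by
    intro p hp k
    rw [norm_smul]
    calc _ ≤ b k * 1 := mul_le_mul (hb _ hp.1 _ _) (norm_op_shift_le H hN _) (norm_nonneg _) (hb0 k)
      _ = _ := mul_one _
  have heq : ∀ p ∈ cube d ×ˢ cube d, locOp H hN G p =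
      ∑' k, locCoeff N Gh p.1 p.2 k • H.op hN (shift N κ (jZ k)) := by
    intro p hp
    have hs := (Summable.of_norm_bounded hbs (hnorm p hp)).hasSum
    rw [locOp_of_mem H hN hp]
    ext v
    obtain ⟨v, rfl⟩ := H.toS.surjective v
    have h1 := hs.mapL (ContinuousLinearMap.apply ℂ H.Space (H.toS v))
    simp only [ContinuousLinearMap.apply_apply, _root_.smul_apply, H.op_apply] at h1
    rw [H.op_apply]
    exact (hG.hasSum_opLoc H hN p.1 p.2 v).unique h1
  have hms : MeasurableSet (cube d ×ˢ cube d) :=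
    (measurableSet_unitCube (ι := Fin d ⊕ Fin d)).prod measurableSet_unitCube
  refine ⟨∑' k, b k, ⟨?_, fun p => ?_, fun u => ?_⟩⟩
  -- The operator series converges uniformly on the product of cubes, so the family is continuous
  -- there; the extension by zero changes only a null set for `torusMeasure`.
  · have hcont : ContinuousOn (locOp H hN G) (cube d ×ˢ cube d) :=
      (continuousOn_tsum (fun k => ((hG.continuous_locCoeff N k).smul continuous_const).continuousOn)
        hbs fun k p hp => hnorm p hp k).congr heq
    have h1 := hcont.aestronglyMeasurable (μ := torusMeasure d) hms
    rwa [show (torusMeasure d).restrict (cube d ×ˢ cube d) = torusMeasure d from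
      Measure.restrict_eq_self_of_ae_mem (ae_torusMeasure d)] at h1
  · by_cases hp : p ∈ cube d ×ˢ cube d
    · rw [heq p hp]
      exact tsum_of_norm_bounded hbs.hasSum (hnorm p hp)
    · rw [locOp, if_neg hp, norm_zero]
      exact tsum_nonneg hb0
  -- Tightness is the decomposition of `Op⁺` for the constant observable `1`.
  · obtain ⟨u, rfl⟩ := H.toS.surjective u
    have h1 := hG.integral_ip_opLoc H hN (a := fun _ => 1) continuous_const (C := 1) (by simp)
      (fun _ _ => rfl) u
    rw [H.opPlus_one hG hN] at h1
    have hsq : ∀ v : torusSpace N κ, H.ip v v = ((‖H.toS v‖ ^ 2 : ℝ) : ℂ) := fun v => by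
      rw [← H.inner_toS, inner_self_eq_norm_sq_to_K]; push_cast; rfl
    simp only [hsq, Complex.ofReal_one, one_mul] at h1
    rw [integral_complex_ofReal, Complex.ofReal_inj] at h1
    rw [← h1]
    refine integral_congr_ae ((ae_torusMeasure d).mono fun p hp => ?_)
    simp only [locOp_of_mem H hN hp, H.op_apply]

/-- The measure of an observable as an integral of the Husimi function. -/
theorem IsWindow.quantumMeasure_eq (hG : IsWindow G Gh) (hN : 0 < N) {a : Phase d → ℝ}
    (hac : Continuous a) {C : ℝ} (hC : ∀ x, |a x| ≤ C)
    (hap : ∀ r x, a (x + intVec r) = a x) (ψ : torusSpace N κ) :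
    quantumMeasure H G ψ a = ∫ p, a p.2 * ‖locOp H hN G p (H.toS ψ)‖ ^ 2 ∂torusMeasure d := by
  have h1 := hG.integral_ip_opLoc H hN hac hC hap ψ
  have h2 : ∫ p, (a p.2 : ℂ) * H.ip (opLoc N κ G p.1 p.2 ψ) (opLoc N κ G p.1 p.2 ψ) ∂torusMeasure d =
      ((∫ p, a p.2 * ‖locOp H hN G p (H.toS ψ)‖ ^ 2 ∂torusMeasure d : ℝ) : ℂ) := by
    rw [← integral_complex_ofReal]
    refine integral_congr_ae ((ae_torusMeasure d).mono fun p hp => ?_)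
    simp only [locOp_of_mem H hN hp, H.op_apply]
    rw [← H.inner_toS, inner_self_eq_norm_sq_to_K]
    push_cast; rfl
  rw [quantumMeasure]
  change (H.ip ψ (opPlus N κ G a ψ)).re = _
  rw [← h1, h2, Complex.ofReal_re]

section Refined

variable (A : Matrix.symplecticGroup (Fin d) ℤ) {K : ℕ} {P : Fin K → Phase d → ℝ}

theorem continuous_refined (hP : IsSmoothPartition P) {m : ℕ} (α : Fin (2 * m) → Fin K) :
    Continuous (refined A P α) := by
  unfold refined
  refine continuous_finsetProd _ fun j _ => (hP.smooth _).smooth.continuous.comp ?_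
  exact Continuous.matrix_mulVec continuous_const continuous_id

theorem refined_add_intVec (hP : IsSmoothPartition P) {m : ℕ} (α : Fin (2 * m) → Fin K)
    (r : Fin d ⊕ Fin d → ℤ) (x : Phase d) : refined A P α (x + intVec r) = refined A P α x := by
  unfold refined
  refine Finset.prod_congr rfl fun j _ => ?_
  rw [Matrix.mulVec_add, intVec_mulVec]
  exact (hP.smooth _).periodic _ _

theorem refined_mem_Icc (hP : IsSmoothPartition P) {m : ℕ} (α : Fin (2 * m) → Fin K) (x : Phase d) :
    refined A P α x ∈ Set.Icc (0 : ℝ) 1 :=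
  ⟨Finset.prod_nonneg fun _ _ => (hP.mem_Icc _ _).1,
    Finset.prod_le_one (fun _ _ => (hP.mem_Icc _ _).1) fun _ _ => (hP.mem_Icc _ _).2⟩

/-- Expansion of a product of `2m` sums, each equal to `1`. -/
theorem sum_refined_sq (hP : IsSmoothPartition P) (m : ℕ) (x : Phase d) :
    ∑ α : Fin (2 * m) → Fin K, refined A P α x ^ 2 = 1 := by
  simp only [refined, ← Finset.prod_pow]
  rw [← Fintype.piFinset_univ, ← Finset.prod_univ_sum (fun _ => Finset.univ)
    (fun (j : Fin (2 * m)) i => P i (toReal (A ^ ((j : ℤ) - (m : ℤ))) *ᵥ x) ^ 2)]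
  simp [hP.sum_sq]

theorem integral_torusMeasure_snd (a : Phase d → ℝ) : ∫ p, a p.2 ∂torusMeasure d = leb a := by
  have := isFiniteMeasure_unitCube (ι := Fin d ⊕ Fin d)
  have h := integral_prod_mul (μ := volume.restrict (unitCube (Fin d ⊕ Fin d)))
    (ν := volume.restrict (unitCube (Fin d ⊕ Fin d))) (fun _ => (1 : ℝ)) a
  simp only [one_mul, integral_const, probReal_univ, smul_eq_mul, mul_one] at h
  exact h

end Refined

/-- A power of the propagator is isometric. -/
theorem norm_op_opM_pow {A : Matrix.symplecticGroup (Fin d) ℤ} (hN : 0 < N)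
    {M : 𝓢(Conf d, ℂ) ≃L[ℂ] 𝓢(Conf d, ℂ)} (hM : IsQuantumPropagator (hbar N) A M)
    (hMκ : (torusSpace N κ).map (propagator M) = torusSpace N κ) (n : ℕ) (v : H.Space) :
    ‖H.op hN (opM N κ M ^ n : Module.End ℂ (torusSpace N κ)) v‖ = ‖v‖ := by
  obtain ⟨v, rfl⟩ := H.toS.surjective v
  rw [H.op_apply]
  induction n with
  | zero => rfl
  | succ n ih =>
    rw [pow_succ', Module.End.mul_apply, ← ih, H.norm_toS, H.norm_toS, TorusHilbert.norm,
      TorusHilbert.norm]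
    congr 2
    exact H.ip_opM hN hM hMκ _ _

theorem opM_pow_apply {M : 𝓢(Conf d, ℂ) ≃L[ℂ] 𝓢(Conf d, ℂ)} {ψ : torusSpace N κ} {z : ℂ}
    (h : opM N κ M ψ = z • ψ) (n : ℕ) :
    (opM N κ M ^ n : Module.End ℂ (torusSpace N κ)) ψ = z ^ n • ψ := by
  induction n with
  | zero => simp
  | succ n ih => rw [pow_succ', Module.End.mul_apply, ih, map_smul, h, smul_smul, pow_succ]

end CatMap

end

/-! ### The entropy bound -/

theorem corollary5p1 {d : ℕ} (A : Matrix.symplecticGroup (Fin d) ℤ)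
    (hA_one : (1 : ℂ) ∉ CatMap.spec A) (hA_exp : ∃ β ∈ CatMap.spec A, 1 < ‖β‖)
    (R : CatMap.Reduction A) (ε₀ : ℝ) (hε₀ : 0 < ε₀)
    (N : ℕ) (hN : 0 < N)
    (κ : CatMap.Phase d) (hκ : ∀ j, κ j ∈ Set.Ico (0 : ℝ) (2 * Real.pi))
    (H : CatMap.TorusHilbert N κ)
    (M : SchwartzMap (CatMap.Conf d) ℂ ≃L[ℂ] SchwartzMap (CatMap.Conf d) ℂ)
    (hM : CatMap.IsQuantumPropagator (CatMap.hbar N) A M)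
    (hMκ : (CatMap.torusSpace N κ).map (CatMap.propagator M) = CatMap.torusSpace N κ)
    (ψ : CatMap.torusSpace N κ) (hψ_unit : H.norm ψ = 1)
    (hψ_eig : ∃ z : ℂ, CatMap.opM N κ M ψ = z • ψ)
    {K : ℕ} (P : Fin K → CatMap.Phase d → ℝ) (hP : CatMap.IsSmoothPartition P)
    (n m : ℕ) :
    BddAbove (CatMap.corrNorms H (R.gauss ε₀ (CatMap.hbar N)) M n) ∧
    0 < CatMap.corr H (R.gauss ε₀ (CatMap.hbar N)) M n ∧
    CatMap.quantumEntropy H (R.gauss ε₀ (CatMap.hbar N)) ψ A P m ≥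
      - Real.log (⨆ α : Fin (2 * m) → Fin K, CatMap.leb fun ρ => CatMap.refined A P α ρ ^ 2)
      - Real.log (CatMap.corr H (R.gauss ε₀ (CatMap.hbar N)) M n) := by
  have hfin := H.finiteDimensional hN
  obtain ⟨Gh, hG⟩ := CatMap.isWindow_gauss R ε₀ (CatMap.hbar_pos hN)
  set G := R.gauss ε₀ (CatMap.hbar N) with hGdef
  obtain ⟨B, hW⟩ := hG.exists_isTightFamily_locOp H hN
  obtain ⟨z, hz⟩ := hψ_eig
  set U := H.op hN (CatMap.opM N κ M ^ n : Module.End ℂ (CatMap.torusSpace N κ)) with hUdef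
  have hU : ∀ v, ‖U v‖ = ‖v‖ := CatMap.norm_op_opM_pow H hN hM hMκ n
  have hψ : ‖H.toS ψ‖ = 1 := hψ_unit
  have heig : U (H.toS ψ) = z ^ n • H.toS ψ := by
    rw [hUdef, H.op_apply, CatMap.opM_pow_apply hz, map_smul]
  have hB : 0 ≤ B := (norm_nonneg _).trans (hW.norm_le 0)
  have hnorm : ∀ p ∈ CatMap.cube d ×ˢ CatMap.cube d, ∀ p' ∈ CatMap.cube d ×ˢ CatMap.cube d,
      H.opNorm (CatMap.opLoc N κ G p.1 p.2 ∘ₗ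
        (CatMap.opM N κ M ^ n : Module.End ℂ (CatMap.torusSpace N κ)) ∘ₗ
        H.adj (CatMap.opLoc N κ G p'.1 p'.2)) =
      ‖CatMap.locOp H hN G p ∘L U ∘L
        ContinuousLinearMap.adjoint (CatMap.locOp H hN G p')‖ := by
    intro p hp p' hp'
    rw [H.opNorm_eq hN, H.op_comp, H.op_comp, H.op_adj, CatMap.locOp_of_mem H hN hp,
      CatMap.locOp_of_mem H hN hp']
  have hbdd : BddAbove (CatMap.corrNorms H G M n) := by
    refine ⟨B * (1 * B), ?_⟩
    rintro _ ⟨ρ, hρ, ρ', hρ', ρ₀, hρ₀, ρ₀', hρ₀', rfl⟩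
    rw [hnorm (ρ, ρ₀) ⟨hρ, hρ₀⟩ (ρ', ρ₀') ⟨hρ', hρ₀'⟩]
    refine (ContinuousLinearMap.opNorm_comp_le _ _).trans (mul_le_mul (hW.norm_le _)
      ((ContinuousLinearMap.opNorm_comp_le _ _).trans (mul_le_mul ?_ ?_ (norm_nonneg _) zero_le_one))
      (norm_nonneg _) hB)
    · exact U.opNorm_le_bound zero_le_one fun v => by rw [hU, one_mul]
    · rw [LinearIsometryEquiv.norm_map]; exact hW.norm_le _
  have hcorr0 : 0 ≤ CatMap.corr H G M n := by
    refine Real.sSup_nonneg ?_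
    rintro _ ⟨ρ, hρ, ρ', hρ', ρ₀, hρ₀, ρ₀', hρ₀', rfl⟩
    rw [H.opNorm_eq hN]; exact norm_nonneg _
  -- The family vanishes off the fundamental domain, so the supremum over the torus bounds all pairs
  -- of points.
  have hcorr : ∀ p p', ‖CatMap.locOp H hN G p ∘L U ∘L
      ContinuousLinearMap.adjoint (CatMap.locOp H hN G p')‖ ≤ CatMap.corr H G M n := by
    intro p p'
    by_cases hp : p ∈ CatMap.cube d ×ˢ CatMap.cube d
    · by_cases hp' : p' ∈ CatMap.cube d ×ˢ CatMap.cube d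
      · rw [← hnorm p hp p' hp']
        exact le_csSup hbdd ⟨p.1, hp.1, p'.1, hp'.1, p.2, hp.2, p'.2, hp'.2, rfl⟩
      · rw [show CatMap.locOp H hN G p' = 0 from if_neg hp', map_zero, ContinuousLinearMap.comp_zero,
          ContinuousLinearMap.comp_zero, norm_zero]
        exact hcorr0
    · rw [show CatMap.locOp H hN G p = 0 from if_neg hp, ContinuousLinearMap.zero_comp, norm_zero]
      exact hcorr0
  refine ⟨hbdd, hW.corr_pos hU hψ heig hcorr, ?_⟩
  -- The weights depend on `ρ₀` only; integrating out `ρ` over a cube of volume `1` leaves the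
  -- Lebesgue integrals of the partition.
  have hmain := hW.le_sum_negMulLog hU hψ heig hcorr
    (q := fun (α : Fin (2 * m) → Fin K) p => CatMap.refined A P α p.2 ^ 2)
    (fun α => (((CatMap.continuous_refined A hP α).comp continuous_snd).pow 2).aestronglyMeasurable)
    (fun α p => sq_nonneg _) (fun p => CatMap.sum_refined_sq A hP m p.2)
  rw [iSup_congr fun α : Fin (2 * m) → Fin K =>
    CatMap.integral_torusMeasure_snd fun ρ => CatMap.refined A P α ρ ^ 2] at hmain
  refine hmain.trans_eq ?_
  rw [CatMap.quantumEntropy]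
  refine Finset.sum_congr rfl fun α _ => ?_
  rw [hG.quantumMeasure_eq H hN (a := fun ρ => CatMap.refined A P α ρ ^ 2)
    ((CatMap.continuous_refined A hP α).pow 2) (C := 1) (fun x => ?_)
    fun r x => ?_]
  · rw [abs_of_nonneg (sq_nonneg _)]
    exact pow_le_one₀ (CatMap.refined_mem_Icc A hP α x).1 (CatMap.refined_mem_Icc A hP α x).2
  · rw [CatMap.refined_add_intVec A hP]
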